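/- **Notation.** For $t\in\mathbb R$ let $u_t=(\cos t,\sin t)$, $v_t=(-\sin t,\cos t)$ and let $R_t$ be the counterclockwise rotation of $\mathbb R^2$ by $t$ about the origin. Write $|X|$ for the area of $X\subseteq\mathbb R^2$ and $h_S(t)=\sup_{s\in S}s\cdot u_t$ for the support function of a nonempty compact set $S\subset\mathbb R^2$. Fix $\omega\in(0,\pi/2]$. *Moving sofas.* Let $H_L=(-\infty,1]\times[0,1]$, $V_L=[0,1]\times(-\infty,1]$, and let $L=H_L\cup V_L$ be the hallway. A *moving sofa with rotation angle $\omega$* is a nonempty connected closed set $S\subset\mathbb R^2$ for which there are continuous $\theta:[0,1]\to\mathbb R$ and $c:[0,1]\to\mathbb R^2$ with $\theta(0)=0$, $\theta(1)=\omega$ such that the rigid motions $\Phi_s(p)=R_{-\theta(s)}p+c(s)$ satisfy $\Phi_0(S)\subseteq H_L$, $\Phi_s(S)\subseteq L$ for all $s\in[0,1]$, and $\Phi_1(S)\subseteq V_L$. (Every such $S$ is bounded, because $\omega\in(0,\pi/2]$.) It is in *standard position* if $h_S(\omega)=h_S(\pi/2)=1$. *Supporting hallways.* For $S$ nonempty and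 compact, put $f_{S,t}(p)=R_tp+(h_S(t)-1)u_t+(h_S(t+\pi/2)-1)v_t$ and let $L_S(t)$, $Q^+_S(t)$, $Q^-_S(t)$ be the images under $f_{S,t}$ of $L$, $(-\infty,1]^2$, $(-\infty,0)^2$ respectively. Let $P_\omega=(\mathbb R\times[0,1])\cap R_\omega([0,1]\times\mathbb R)$, $F_\omega=\{p:p\cdot u_\omega\ge0,\ p\cdot u_{\pi/2}\ge0\}$ and $o_\omega=(\tan(\pi/4-\omega/2),1)$. *Monotone sofas.* For a moving sofa $S$ with rotation angle $\omega$ in standard position put $$\mathcal I(S)=P_\omega\cap\bigcap_{t\in[0,\omega]}L_S(t),\qquad \mathcal C(S)=P_\omega\cap\bigcap_{t\in[0,\omega]}Q^+_S(t).$$ A *monotone sofa* (with rotation angle $\omega$) is a set of the form $\mathcal I(S')$, where $S'$ is a moving sofa with rotation angle $\omega$ in standard position; $\mathcal C(S)$ is the *cap of* $S$. *Caps.* A *cap* with rotation angle $\omega$ is a nonempty compact convex set $K\subset\mathbb R^2$ with $h_K(\omega)=h_K(\pi/2)=1$ and $h_K(\omega+\pi)=h_K(3\pi/2)=0$ that is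 an intersection of closed half-planes $\{p:p\cdot u_t\le h\}$ with normal angles $t\in[0,\omega]\cup[\pi/2,\omega+\pi/2]\cup\{\omega+\pi,3\pi/2\}$. Its *niche* is $\mathcal N(K)=F_\omega\cap\bigcup_{t\in(0,\omega)}Q^-_K(t)$. *Polygon caps.* Let $\Theta\subset(0,\omega)$ be finite and nonempty. A *polygon cap* with angle set $\Theta$ is a cap with rotation angle $\omega$ that is an intersection of closed half-planes with normal angles in $\Theta\cup(\Theta+\pi/2)\cup\{\omega,\pi/2,\omega+\pi,3\pi/2\}$. For a cap $K$ put $\mathcal C_\Theta(K)=P_\omega\cap\bigcap_{t\in\Theta}Q^+_K(t)$, $\mathcal N_\Theta(K)=F_\omega\cap\bigcup_{t\in\Theta}Q^-_K(t)$ and $\mathcal A_\Theta(K)=|\mathcal C_\Theta(K)|-|\mathcal N_\Theta(K)|$. A *maximum polygon cap* with angle set $\Theta$ is a polygon cap $K$ with angle set $\Theta$ such that $o_\omega\in K$ and $\mathcal A_\Theta(K')\le\mathcal A_\Theta(K)$ for every polygon cap $K'$ with angle set $\Theta$. *Balanced maximum caps and sofas.* A *balanced maximum cap* with rotation angle $\omega$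 is a cap $K_\omega$ with rotation angle $\omega$ for which there are powers of two $1<n_1<n_2<\cdots$ and, for each $i$, a maximum polygon cap $K_i$ with angle set $\{\tfrac{j}{n_i}\omega:1\le j<n_i\}$, such that $K_i\to K_\omega$ in Hausdorff distance. A *balanced maximum sofa* is a monotone sofa $S_\omega$ whose cap $\mathcal C(S_\omega)$ is a balanced maximum cap. **Theorem.** Let $\omega\in(0,\pi/2]$. 1. There exists a balanced maximum cap with rotation angle $\omega$. 2. For every balanced maximum cap $K_\omega$ with rotation angle $\omega$, the set $S_\omega:=K_\omega\setminus\mathcal N(K_\omega)$ is a balanced maximum sofa with cap $\mathcal C(S_\omega)=K_\omega$. 3. Every balanced maximum sofa $S_\omega$ with rotation angle $\omega$ satisfies $S_\omega=\mathcal C(S_\omega)\setminus\mathcal N(\mathcal C(S_\omega))$, is a moving sofa with rotation angle $\omega$, and has the maximum area among all moving sofas with rotation angle $\omega$. In particular, a balanced maximum sofa $S_\omega=K_\omega\setminus\mathcal N(K_\omega)$ exists and attains the maximum area among all moving sofas with rotation angle $\omega$. -/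

import Mathlib

noncomputable section

namespace MovingSofa

/-- The Euclidean plane. -/
abbrev Plane := EuclideanSpace ℝ (Fin 2)

/-- The unit vector `u_t = (cos t, sin t)`. -/
def u (t : ℝ) : Plane := !₂[Real.cos t, Real.sin t]

/-- The unit vector `v_t = (-sin t, cos t)`. -/
def v (t : ℝ) : Plane := !₂[-Real.sin t, Real.cos t]

/-- Counterclockwise rotation of the plane by the angle `t` around the origin. -/
def rot (t : ℝ) (p : Plane) : Plane :=
  !₂[Real.cos t * p 0 - Real.sin t * p 1, Real.sin t * p 0 + Real.cos t * p 1]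

/-! ### The hallway and moving sofas -/

/-- Horizontal side `(-∞, 1] × [0, 1]` of the hallway. -/
def hallH : Set Plane := {p | p 0 ≤ 1 ∧ 0 ≤ p 1 ∧ p 1 ≤ 1}

/-- Vertical side `[0, 1] × (-∞, 1]` of the hallway. -/
def hallV : Set Plane := {p | 0 ≤ p 0 ∧ p 0 ≤ 1 ∧ p 1 ≤ 1}

/-- The right-angled hallway of unit width. -/
def hallway : Set Plane := hallH ∪ hallV

/-- `S` is a moving sofa that admits a movement with rotation angle `ω`: a nonempty, connected,
closed set with a continuous rigid motion `p ↦ R_{-θ(s)} p + c(s)`, `s ∈ [0, 1]`, which starts at a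
translation (`θ(0) = 0`) taking `S` into the horizontal side, keeps `S` inside the hallway, and ends
with `S` in the vertical side. As `R_{-θ}` is the clockwise rotation by `θ` and `θ` is a continuous
real function, `θ(1) = ω` is the total clockwise angle by which `S` turns. -/
def IsMovingSofa (ω : ℝ) (S : Set Plane) : Prop :=
  IsConnected S ∧ IsClosed S ∧
    ∃ (θ : ℝ → ℝ) (c : ℝ → Plane),
      ContinuousOn θ (Set.Icc 0 1) ∧ ContinuousOn c (Set.Icc 0 1) ∧ θ 0 = 0 ∧ θ 1 = ω ∧
      (∀ p ∈ S, rot (-θ 0) p + c 0 ∈ hallH) ∧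
      (∀ s ∈ Set.Icc (0 : ℝ) 1, ∀ p ∈ S, rot (-θ s) p + c s ∈ hallway) ∧
      (∀ p ∈ S, rot (-θ 1) p + c 1 ∈ hallV)

/-! ### Half-planes, support function, supporting hallways -/

/-- The closed half-plane `{p : p · u_t ≤ h}` with normal angle `t`. -/
def halfPlane (t h : ℝ) : Set Plane := {p | inner ℝ p (u t) ≤ h}

/-- The support function of a (nonempty compact) set. -/
def supp (S : Set Plane) (t : ℝ) : ℝ := sSup ((fun p : Plane => (inner ℝ p (u t) : ℝ)) '' S)

/-- The closed quarter-plane `(-∞, 1]²` bounded by the outer walls of the hallway. -/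
def outerQuadrant : Set Plane := {p | p 0 ≤ 1 ∧ p 1 ≤ 1}

/-- The open quarter-plane `(-∞, 0)²` bounded by the inner walls of the hallway. -/
def innerQuadrant : Set Plane := {p | p 0 < 0 ∧ p 1 < 0}

/-- The rigid map `f_{S,t}` taking the hallway, rotated counterclockwise by `t`, to the position
where its outer walls are the supporting lines of `S` with normal angles `t` and `t + π/2`. -/
def supportMap (S : Set Plane) (t : ℝ) (p : Plane) : Plane :=
  rot t p + (supp S t - 1) • u t + (supp S (t + Real.pi / 2) - 1) • v t

/-- The supporting hallway `L_S(t)`. -/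
def supportHallway (S : Set Plane) (t : ℝ) : Set Plane := supportMap S t '' hallway

/-- `Q⁺_S(t)`. -/
def Qplus (S : Set Plane) (t : ℝ) : Set Plane := supportMap S t '' outerQuadrant

/-- `Q⁻_S(t)`. -/
def Qminus (S : Set Plane) (t : ℝ) : Set Plane := supportMap S t '' innerQuadrant

/-! ### Monotone sofas -/

/-- The horizontal strip `ℝ × [0, 1]`. -/
def stripH : Set Plane := {p | 0 ≤ p 1 ∧ p 1 ≤ 1}

/-- The vertical strip `[0, 1] × ℝ`. -/
def stripV : Set Plane := {p | 0 ≤ p 0 ∧ p 0 ≤ 1}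

/-- The parallelogram `P_ω = H ∩ R_ω(V)`. -/
def parallelogram (ω : ℝ) : Set Plane := stripH ∩ rot ω '' stripV

/-- The vertex `o_ω = (tan(π/4 - ω/2), 1)` of `P_ω`. -/
def apex (ω : ℝ) : Plane := !₂[Real.tan (Real.pi / 4 - ω / 2), 1]

/-- Standard position: the lines with normal angles `ω` and `π/2` at distance `1` support `S`. -/
def InStandardPosition (ω : ℝ) (S : Set Plane) : Prop :=
  supp S ω = 1 ∧ supp S (Real.pi / 2) = 1

/-- The intersection `I(S)` of `P_ω` and the supporting hallways of `S`. -/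
def monotonization (ω : ℝ) (S : Set Plane) : Set Plane :=
  parallelogram ω ∩ ⋂ t ∈ Set.Icc 0 ω, supportHallway S t

/-- A monotone sofa is `I(S')` for some moving sofa `S'` in standard position. -/
def IsMonotoneSofa (ω : ℝ) (S : Set Plane) : Prop :=
  ∃ S' : Set Plane, IsMovingSofa ω S' ∧ InStandardPosition ω S' ∧ S = monotonization ω S'

/-- The cap `C(S)` of a moving sofa in standard position. -/
def capOf (ω : ℝ) (S : Set Plane) : Set Plane :=
  parallelogram ω ∩ ⋂ t ∈ Set.Icc 0 ω, Qplus S t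

/-! ### Caps and niches -/

/-- `K` is an intersection of closed half-planes with normal angles in `A`. -/
def IsInterHalfPlanes (A : Set ℝ) (K : Set Plane) : Prop :=
  ∃ F : Set (ℝ × ℝ), (∀ q ∈ F, q.1 ∈ A) ∧ K = ⋂ q ∈ F, halfPlane q.1 q.2

/-- A cap with rotation angle `ω`. -/
def IsCap (ω : ℝ) (K : Set Plane) : Prop :=
  K.Nonempty ∧ IsCompact K ∧ Convex ℝ K ∧
  supp K ω = 1 ∧ supp K (Real.pi / 2) = 1 ∧
  supp K (ω + Real.pi) = 0 ∧ supp K (3 * Real.pi / 2) = 0 ∧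
  IsInterHalfPlanes
    (Set.Icc 0 ω ∪ Set.Icc (Real.pi / 2) (ω + Real.pi / 2) ∪ {ω + Real.pi, 3 * Real.pi / 2}) K

/-- The fan `F_ω` above the two lower sides of `P_ω`. -/
def fan (ω : ℝ) : Set Plane :=
  {p | 0 ≤ inner ℝ p (u ω) ∧ 0 ≤ inner ℝ p (u (Real.pi / 2))}

/-- The niche `N(K)` of a cap. -/
def niche (ω : ℝ) (K : Set Plane) : Set Plane := fan ω ∩ ⋃ t ∈ Set.Ioo 0 ω, Qminus K t

/-! ### Polygon caps; an angle set is a nonempty finite subset `Θ` of `(0, ω)` -/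

/-- A polygon cap with angle set `Θ`: a cap which is an intersection of closed half-planes with
normal angles in `Θ ∪ (Θ + π/2) ∪ {ω, π/2} ∪ {ω + π, 3π/2}`. -/
def IsPolygonCap (ω : ℝ) (Θ : Set ℝ) (K : Set Plane) : Prop :=
  IsCap ω K ∧
  IsInterHalfPlanes
    (Θ ∪ (fun t => t + Real.pi / 2) '' Θ ∪ {ω, Real.pi / 2} ∪ {ω + Real.pi, 3 * Real.pi / 2}) K

/-- The polygon cap `C_Θ(K)` circumscribing `K`. -/
def polygonCap (ω : ℝ) (Θ : Set ℝ) (K : Set Plane) : Set Plane :=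
  parallelogram ω ∩ ⋂ t ∈ Θ, Qplus K t

/-- The polygon niche `N_Θ(K)`. -/
def polygonNiche (ω : ℝ) (Θ : Set ℝ) (K : Set Plane) : Set Plane :=
  fan ω ∩ ⋃ t ∈ Θ, Qminus K t

/-- The area of a plane set. -/
def area (X : Set Plane) : ENNReal := MeasureTheory.volume X

/-- The polygon sofa area functional `A_Θ(K) = |C_Θ(K)| - |N_Θ(K)|`. -/
def polygonArea (ω : ℝ) (Θ : Set ℝ) (K : Set Plane) : ℝ :=
  (area (polygonCap ω Θ K)).toReal - (area (polygonNiche ω Θ K)).toReal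

/-- A maximum polygon cap with angle set `Θ`. -/
def IsMaximumPolygonCap (ω : ℝ) (Θ : Set ℝ) (K : Set Plane) : Prop :=
  IsPolygonCap ω Θ K ∧ apex ω ∈ K ∧
    ∀ K', IsPolygonCap ω Θ K' → polygonArea ω Θ K' ≤ polygonArea ω Θ K

/-- The uniform angle set `{(i/n) ω : 1 ≤ i < n}` of `n` intervals. -/
def uniformAngleSet (ω : ℝ) (n : ℕ) : Set ℝ :=
  {t | ∃ i : ℕ, 1 ≤ i ∧ i < n ∧ t = (i : ℝ) / n * ω}

/-! ### Balanced maximum caps and sofas -/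

/-- A balanced maximum cap with rotation angle `ω`: a cap which is the limit in Hausdorff distance
of maximum polygon caps with uniform angle sets of `n 0 < n 1 < ⋯` intervals, where every `n i` is a
power of two greater than one. -/
def IsBalancedMaximumCap (ω : ℝ) (K : Set Plane) : Prop :=
  IsCap ω K ∧
  ∃ (n : ℕ → ℕ) (Kseq : ℕ → Set Plane),
    StrictMono n ∧ (∀ i, 1 < n i ∧ ∃ k : ℕ, n i = 2 ^ k) ∧
    (∀ i, IsMaximumPolygonCap ω (uniformAngleSet ω (n i)) (Kseq i)) ∧
    Filter.Tendsto (fun i => Metric.hausdorffDist (Kseq i) K) Filter.atTop (nhds 0)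

/-- A balanced maximum sofa: a monotone sofa whose cap is a balanced maximum cap. -/
def IsBalancedMaximumSofa (ω : ℝ) (S : Set Plane) : Prop :=
  IsMonotoneSofa ω S ∧ IsBalancedMaximumCap ω (capOf ω S)

end MovingSofa

end

noncomputable section

namespace MovingSofa

open Real Set Filter Topology MeasureTheory

/-! ### Coordinates in rotated frames -/

/-! Caps and niches depend on a set only through its support values at the wall angles, so the
argument runs on `capSet` and `nicheSet`, which accept an arbitrary height function. Walls with
normal `u t` are called right walls and those with normal `u (t + π / 2)` left walls.

The central fact is that a maximum polygon cap contains its niche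
(`IsMaximumPolygonCap.nicheSet_subset`). Suppose a niche point `z` lies strictly beyond the cap in a
direction `u s`. Translate all right walls of angle less than `s` by a small `ε • v s`, and slice
the plane by lines parallel to `v s`. Every slice of the cap loses length at most `ε`, and only
slices between a foot of the cap on the horizontal axis and the extreme height `H` of the cap lose
anything, up to an error of order `ε`. Every slice of the niche between that foot and `z` loses at
least `ε`. Since `z` lies beyond `H`, the area functional increases to first order. The walls that
move must have slack at the apex, so that the result is again a polygon cap; `exists_increase` shows
that a niche point outside the cap always leaves such a move on the right or, after reflection, on
the left.

Existence is a compactness argument: support values converge along Hausdorff limits, area is upper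
semicontinuous, niche points persist because the niche inequalities are strict, and caps containing
the apex are closed under limits (`HausdorffLimit.isCap`). For `ω = π / 2` the parallelogram is an
unbounded strip, and boundedness comes from the quadratic growth of the niche. The inclusion of the
niche passes to the limit (`IsBalancedMaximumCap.niche_subset`), as does maximality of `|K| -
|N(K)|` (`IsBalancedMaximumCap.volume_le`).

Finally, sofas and caps are matched. A moving sofa in standard position lies in its cap minus the
niche of that cap, and connectedness forces this niche into the cap (`IsMovingSofa.niche_subset`).
Conversely, a cap containing its niche leaves a connected closed remainder with the same support
values, which moves by following its supporting hallways (`IsCap.isMovingSofa_diff_niche`).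
Comparing areas gives optimality. -/

/-- The inner product with `u t`, in coordinates. -/
def pr (t : ℝ) (p : Plane) : ℝ := p 0 * cos t + p 1 * sin t

theorem inner_u (p : Plane) (t : ℝ) : inner ℝ p (u t) = pr t p := by
  simp [PiLp.inner_apply, u, pr, Fin.sum_univ_two, mul_comm]

theorem v_eq_u (t : ℝ) : v t = u (t + π / 2) := by
  ext i; fin_cases i <;> simp [u, v, cos_add_pi_div_two, sin_add_pi_div_two]

@[simp] theorem pr_add (t : ℝ) (p q : Plane) : pr t (p + q) = pr t p + pr t q := by
  simp [pr]; ring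

@[simp] theorem pr_sub (t : ℝ) (p q : Plane) : pr t (p - q) = pr t p - pr t q := by
  simp [pr]; ring

@[simp] theorem pr_smul (t a : ℝ) (p : Plane) : pr t (a • p) = a * pr t p := by
  simp [pr]; ring

@[simp] theorem pr_zero_right (t : ℝ) : pr t 0 = 0 := by simp [pr]

theorem pr_u (t s : ℝ) : pr t (u s) = cos (t - s) := by
  simp [pr, u, cos_sub]; ring

theorem pr_pi_div_two (p : Plane) : pr (π / 2) p = p 1 := by simp [pr]

theorem pr_zero (p : Plane) : pr 0 p = p 0 := by simp [pr]

theorem pr_add_pi (t : ℝ) (p : Plane) : pr (t + π) p = -pr t p := by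
  simp [pr]; ring

theorem pr_three_pi_div_two (p : Plane) : pr (3 * π / 2) p = -p 1 := by
  rw [show 3 * π / 2 = π / 2 + π by ring, pr_add_pi, pr_pi_div_two]

/-- This expands `u c` in the basis `u a`, `u b`. For `a ≤ c ≤ b < a + π` both coefficients are
nonnegative, so bounds in two directions control every direction between them; outside that range
the signs are known as well. -/
theorem pr_comb (a b c : ℝ) (p : Plane) :
    sin (b - a) * pr c p = sin (b - c) * pr a p + sin (c - a) * pr b p := by
  simp only [pr, sin_sub]; ring_nf

theorem pr_comb_quarter (a c : ℝ) (p : Plane) :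
    pr c p = cos (c - a) * pr a p + sin (c - a) * pr (a + π / 2) p := by
  have := pr_comb a (a + π / 2) c p
  rw [show a + π / 2 - a = π / 2 by ring, sin_pi_div_two, one_mul,
    show a + π / 2 - c = π / 2 - (c - a) by ring, sin_pi_div_two_sub] at this
  exact this

/-- The height is a combination of the coordinates in a rotated frame. -/
theorem pr_height (t : ℝ) (p : Plane) :
    p 1 = sin t * pr t p + cos t * pr (t + π / 2) p := by
  rw [← pr_pi_div_two, pr_comb_quarter t, cos_pi_div_two_sub, sin_pi_div_two_sub]

theorem continuous_pr₂ : Continuous fun q : ℝ × Plane => pr q.1 q.2 := by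
  unfold pr; fun_prop

@[fun_prop]
theorem continuous_pr (t : ℝ) : Continuous (pr t) := by
  unfold pr; fun_prop

theorem abs_pr_le (t : ℝ) (p : Plane) : |pr t p| ≤ ‖p‖ := by
  rw [← inner_u]
  refine (abs_real_inner_le_norm _ _).trans ?_
  have : ‖u t‖ = 1 := by simp [u, EuclideanSpace.norm_eq, Fin.sum_univ_two]
  rw [this, mul_one]

theorem plane_ext {p q : Plane} (h0 : p 0 = q 0) (h1 : p 1 = q 1) : p = q := by
  ext i; fin_cases i <;> assumption

theorem pr_injective {s : ℝ} {p q : Plane} (h0 : pr s p = pr s q)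
    (h1 : pr (s + π / 2) p = pr (s + π / 2) q) : p = q := by
  refine plane_ext ?_ ?_
  · rw [← pr_zero, ← pr_zero, pr_comb_quarter s 0 p, pr_comb_quarter s 0 q, h0, h1]
  · rw [pr_height s, pr_height s q, h0, h1]

/-! ### Support function -/

theorem supp_eq (S : Set Plane) (t : ℝ) : supp S t = sSup (pr t '' S) := by
  simp [supp, inner_u]

theorem bddAbove_pr {S : Set Plane} (hS : Bornology.IsBounded S) (t : ℝ) :
    BddAbove (pr t '' S) := by
  obtain ⟨R, hR⟩ := hS.exists_norm_le
  exact ⟨R, by rintro _ ⟨p, hp, rfl⟩; exact (le_abs_self _).trans ((abs_pr_le t p).trans (hR p hp))⟩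

theorem le_supp {S : Set Plane} (hS : Bornology.IsBounded S) {p : Plane} (hp : p ∈ S) (t : ℝ) :
    pr t p ≤ supp S t := by
  rw [supp_eq]; exact le_csSup (bddAbove_pr hS t) ⟨p, hp, rfl⟩

theorem supp_le {S : Set Plane} (hS : S.Nonempty) {t a : ℝ} (h : ∀ p ∈ S, pr t p ≤ a) :
    supp S t ≤ a := by
  rw [supp_eq]; exact csSup_le (hS.image _) (by rintro _ ⟨p, hp, rfl⟩; exact h p hp)

theorem supp_mono {S T : Set Plane} (hS : S.Nonempty) (hT : Bornology.IsBounded T) (h : S ⊆ T)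
    (t : ℝ) : supp S t ≤ supp T t :=
  supp_le hS fun _ hp => le_supp hT (h hp) t

theorem exists_pr_eq_supp {S : Set Plane} (hS : IsCompact S) (hne : S.Nonempty) (t : ℝ) :
    ∃ p ∈ S, pr t p = supp S t := by
  obtain ⟨p, hp, hmax⟩ := hS.exists_isMaxOn hne (continuous_pr t).continuousOn
  exact ⟨p, hp, le_antisymm (le_supp hS.isBounded hp t) (supp_le hne fun q hq => hmax hq)⟩

theorem supp_eq_of_mem {S : Set Plane} {p : Plane} (hp : p ∈ S) {t a : ℝ} (hpa : pr t p = a)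
    (h : ∀ q ∈ S, pr t q ≤ a) : supp S t = a := by
  rw [supp_eq]
  exact IsGreatest.csSup_eq ⟨⟨p, hp, hpa⟩, by rintro _ ⟨q, hq, rfl⟩; exact h q hq⟩

/-! ### Membership in the basic sets -/

theorem pr_supportMap_left (S : Set Plane) (t : ℝ) (p : Plane) :
    pr t (supportMap S t p) = p 0 + (supp S t - 1) := by
  simp only [supportMap, v_eq_u, pr_add, pr_smul, pr_u]
  rw [show t - (t + π / 2) = -(π / 2) by ring]
  have : pr t (rot t p) = p 0 := by
    simp only [pr, rot]; simp; linear_combination p 0 * sin_sq_add_cos_sq t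
  simp [this]

theorem pr_supportMap_right (S : Set Plane) (t : ℝ) (p : Plane) :
    pr (t + π / 2) (supportMap S t p) = p 1 + (supp S (t + π / 2) - 1) := by
  simp only [supportMap, v_eq_u, pr_add, pr_smul, pr_u]
  have : pr (t + π / 2) (rot t p) = p 1 := by
    simp only [pr, rot, cos_add_pi_div_two, sin_add_pi_div_two]; simp
    linear_combination p 1 * sin_sq_add_cos_sq t
  simp [this]

theorem mem_supportMap_image (S : Set Plane) (t : ℝ) (X : Set Plane) (p : Plane) :
    p ∈ supportMap S t '' X ↔
      (!₂[pr t p - (supp S t - 1), pr (t + π / 2) p - (supp S (t + π / 2) - 1)] : Plane) ∈ X := by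
  constructor
  · rintro ⟨q, hq, rfl⟩
    convert hq using 1
    refine plane_ext ?_ ?_
    · simp [pr_supportMap_left]
    · simp [pr_supportMap_right]
  · intro h
    refine ⟨_, h, pr_injective (s := t) ?_ ?_⟩
    · simp [pr_supportMap_left]
    · simp [pr_supportMap_right]

theorem mem_Qplus {S : Set Plane} {t : ℝ} {p : Plane} :
    p ∈ Qplus S t ↔ pr t p ≤ supp S t ∧ pr (t + π / 2) p ≤ supp S (t + π / 2) := by
  rw [Qplus, mem_supportMap_image]
  simp only [outerQuadrant, mem_ofPred_eq]
  simp

theorem mem_Qminus {S : Set Plane} {t : ℝ} {p : Plane} :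
    p ∈ Qminus S t ↔ pr t p < supp S t - 1 ∧ pr (t + π / 2) p < supp S (t + π / 2) - 1 := by
  rw [Qminus, mem_supportMap_image]
  simp only [innerQuadrant, mem_ofPred_eq]
  simp

theorem mem_hallway {p : Plane} : p ∈ hallway ↔ p 0 ≤ 1 ∧ p 1 ≤ 1 ∧ (0 ≤ p 0 ∨ 0 ≤ p 1) := by
  simp only [hallway, hallH, hallV, mem_union, mem_ofPred_eq]; tauto

theorem mem_supportHallway {S : Set Plane} {t : ℝ} {p : Plane} :
    p ∈ supportHallway S t ↔ pr t p ≤ supp S t ∧ pr (t + π / 2) p ≤ supp S (t + π / 2) ∧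
      (supp S t - 1 ≤ pr t p ∨ supp S (t + π / 2) - 1 ≤ pr (t + π / 2) p) := by
  rw [supportHallway, mem_supportMap_image, mem_hallway]
  simp

theorem mem_parallelogram {ω : ℝ} {p : Plane} :
    p ∈ parallelogram ω ↔ (0 ≤ p 1 ∧ p 1 ≤ 1) ∧ 0 ≤ pr ω p ∧ pr ω p ≤ 1 := by
  rw [parallelogram, mem_inter_iff]
  refine and_congr Iff.rfl ?_
  constructor
  · rintro ⟨q, hq, rfl⟩
    have : pr ω (rot ω q) = q 0 := by
      simp only [pr, rot]; simp; linear_combination q 0 * sin_sq_add_cos_sq ω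
    rw [this]; exact hq
  · intro h
    refine ⟨!₂[pr ω p, pr (ω + π / 2) p], by simpa [stripV] using h, plane_ext ?_ ?_⟩
    · simp [rot, pr, cos_add_pi_div_two, sin_add_pi_div_two]
      linear_combination p 0 * sin_sq_add_cos_sq ω
    · simp [rot, pr, cos_add_pi_div_two, sin_add_pi_div_two]
      linear_combination p 1 * sin_sq_add_cos_sq ω

theorem mem_fan {ω : ℝ} {p : Plane} : p ∈ fan ω ↔ 0 ≤ pr ω p ∧ 0 ≤ p 1 := by
  simp [fan, inner_u, pr_pi_div_two]

theorem parallelogram_subset_fan (ω : ℝ) : parallelogram ω ⊆ fan ω := fun _ hp =>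
  mem_fan.2 ⟨(mem_parallelogram.1 hp).2.1, (mem_parallelogram.1 hp).1.1⟩

theorem mem_halfPlane {t h : ℝ} {p : Plane} : p ∈ halfPlane t h ↔ pr t p ≤ h := by
  simp [halfPlane, inner_u]

/-! ### Area by slices -/

/-- The point with coordinates `(c, w)` in the frame `(u s, v s)`. -/
def pt (s c w : ℝ) : Plane := !₂[c * cos s - w * sin s, c * sin s + w * cos s]

theorem pr_pt (r s c w : ℝ) : pr r (pt s c w) = c * cos (s - r) - w * sin (s - r) := by
  simp [pr, pt, cos_sub, sin_sub]; ring

theorem pr_pt_self (s c w : ℝ) : pr s (pt s c w) = c := by simp [pr_pt]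

theorem pt_pr (s : ℝ) (p : Plane) : pt s (pr s p) (pr (s + π / 2) p) = p := by
  refine pr_injective (s := s) ?_ ?_
  · simp [pr_pt]
  · rw [pr_pt, show s - (s + π / 2) = -(π / 2) by ring]; simp

/-- The linear isometry with coordinate functions `pr a` and `pr b`, for orthonormal `u a`, `u b`. -/
def frameIso (a b : ℝ) (h : cos (a - b) = 0) : Plane ≃ₗᵢ[ℝ] Plane :=
  LinearIsometry.toLinearIsometryEquiv
    { toFun := fun p => !₂[pr a p, pr b p]
      map_add' := fun p q => by ext i; fin_cases i <;> simp
      map_smul' := fun c p => by ext i; fin_cases i <;> simp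
      norm_map' := fun p => by
        simp only [EuclideanSpace.norm_eq, Fin.sum_univ_two]
        congr 1
        have hs : sin (a - b) ^ 2 = 1 := by nlinarith [sin_sq_add_cos_sq (a - b)]
        have h1 : b = a - (a - b) := by ring
        simp only [LinearMap.coe_mk, AddHom.coe_mk, Real.norm_eq_abs, sq_abs]
        simp only [pr, Matrix.cons_val_zero, Matrix.cons_val_one]
        rw [h1, cos_sub a (a - b), sin_sub a (a - b), h]
        have h2 := sin_sq_add_cos_sq a
        linear_combination (p 0 * sin a - p 1 * cos a) ^ 2 * hs + (p 0 ^ 2 + p 1 ^ 2) * h2 }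
    rfl

theorem measurePreserving_pr (s : ℝ) :
    MeasurePreserving (fun p : Plane => (pr s p, pr (s + π / 2) p)) volume
      ((volume : Measure ℝ).prod volume) := by
  have h : cos (s - (s + π / 2)) = 0 := by
    rw [show s - (s + π / 2) = -(π / 2) by ring]; simp
  have h1 := (frameIso s (s + π / 2) h).measurePreserving
  have h2 := (PiLp.volume_preserving_ofLp (Fin 2)).comp h1
  have h3 := (volume_preserving_finTwoArrow ℝ).comp h2
  exact h3

/-- Fubini in the frame `(u s, v s)`; the slices are parallel to `v s`, the direction in which walls
are later translated. -/
theorem volume_eq_lintegral_slice (s : ℝ) {X : Set Plane} (hX : MeasurableSet X) :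
    volume X = ∫⁻ c, volume {w | pt s c w ∈ X} := by
  have hm : Measurable fun q : ℝ × ℝ => pt s q.1 q.2 := by
    have : Continuous fun q : ℝ × ℝ => pt s q.1 q.2 := by unfold pt; fun_prop
    exact this.measurable
  have h := (measurePreserving_pr s).measure_preimage (hm hX).nullMeasurableSet
  have hpre : (fun p : Plane => (pr s p, pr (s + π / 2) p)) ⁻¹'
      ((fun q : ℝ × ℝ => pt s q.1 q.2) ⁻¹' X) = X := by
    ext p; simp [pt_pr]
  rw [hpre] at h
  rw [h, Measure.prod_apply (hm hX)]
  rfl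

theorem volume_frame_box (s : ℝ) {I J : Set ℝ} (hI : MeasurableSet I) (hJ : MeasurableSet J) :
    volume {p : Plane | pr s p ∈ I ∧ pr (s + π / 2) p ∈ J} = volume I * volume J := by
  rw [← Measure.prod_prod]
  exact (measurePreserving_pr s).measure_preimage (hI.prod hJ).nullMeasurableSet

/-! ### Sets cut out by prescribed heights -/

/-- The part of the parallelogram below the lines with normal angles `t` and `t + π/2`, `t ∈ T`, and
heights `g`. -/
def capSet (ω : ℝ) (T : Set ℝ) (g : ℝ → ℝ) : Set Plane :=
  {p | p ∈ parallelogram ω ∧ ∀ t ∈ T, pr t p ≤ g t ∧ pr (t + π / 2) p ≤ g (t + π / 2)}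

/-- The union of the quarter-planes with inner walls prescribed by the heights `g`, in the fan. -/
def nicheSet (ω : ℝ) (T : Set ℝ) (g : ℝ → ℝ) : Set Plane :=
  {p | p ∈ fan ω ∧ ∃ t ∈ T, pr t p < g t - 1 ∧ pr (t + π / 2) p < g (t + π / 2) - 1}

theorem polygonCap_eq (ω : ℝ) (T : Set ℝ) (K : Set Plane) :
    polygonCap ω T K = capSet ω T (supp K) := by
  ext p; simp [polygonCap, capSet, mem_Qplus]

theorem capOf_eq (ω : ℝ) (K : Set Plane) : capOf ω K = capSet ω (Icc 0 ω) (supp K) := by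
  ext p; simp [capOf, capSet, mem_Qplus]

theorem polygonNiche_eq (ω : ℝ) (T : Set ℝ) (K : Set Plane) :
    polygonNiche ω T K = nicheSet ω T (supp K) := by
  ext p; simp only [polygonNiche, nicheSet, mem_inter_iff, mem_iUnion, mem_Qminus, mem_ofPred_eq, exists_prop]

theorem niche_eq (ω : ℝ) (K : Set Plane) : niche ω K = nicheSet ω (Ioo 0 ω) (supp K) := by
  ext p; simp only [niche, nicheSet, mem_inter_iff, mem_iUnion, mem_Qminus, mem_ofPred_eq, exists_prop]

theorem capSet_congr {ω : ℝ} {T : Set ℝ} {g g' : ℝ → ℝ}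
    (h : ∀ t ∈ T, g t = g' t ∧ g (t + π / 2) = g' (t + π / 2)) :
    capSet ω T g = capSet ω T g' := by
  ext p
  refine and_congr Iff.rfl (forall₂_congr fun t ht => ?_)
  rw [(h t ht).1, (h t ht).2]

theorem nicheSet_mono {ω : ℝ} {T T' : Set ℝ} {g g' : ℝ → ℝ} (hT : T ⊆ T')
    (h : ∀ t ∈ T, g t ≤ g' t ∧ g (t + π / 2) ≤ g' (t + π / 2)) :
    nicheSet ω T g ⊆ nicheSet ω T' g' := by
  rintro p ⟨hf, t, ht, h1, h2⟩
  exact ⟨hf, t, hT ht, by linarith [(h t ht).1], by linarith [(h t ht).2]⟩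

theorem nicheSet_congr {ω : ℝ} {T : Set ℝ} {g g' : ℝ → ℝ}
    (h : ∀ t ∈ T, g t = g' t ∧ g (t + π / 2) = g' (t + π / 2)) :
    nicheSet ω T g = nicheSet ω T g' :=
  (nicheSet_mono subset_rfl fun t ht => ⟨(h t ht).1.le, (h t ht).2.le⟩).antisymm
    (nicheSet_mono subset_rfl fun t ht => ⟨(h t ht).1.ge, (h t ht).2.ge⟩)

theorem isClosed_parallelogram (ω : ℝ) : IsClosed (parallelogram ω) := by
  have : parallelogram ω = {p | (0 ≤ p 1 ∧ p 1 ≤ 1) ∧ 0 ≤ pr ω p ∧ pr ω p ≤ 1} := by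
    ext p; exact mem_parallelogram
  rw [this]
  have h1 : Continuous fun p : Plane => p 1 := by fun_prop
  have h2 := continuous_pr ω
  exact ((isClosed_le continuous_const h1).inter (isClosed_le h1 continuous_const)).inter
    ((isClosed_le continuous_const h2).inter (isClosed_le h2 continuous_const))

theorem convex_parallelogram (ω : ℝ) : Convex ℝ (parallelogram ω) := by
  intro p hp q hq a b ha hb hab
  rw [mem_parallelogram] at *
  simp only [pr_add, pr_smul, PiLp.add_apply, PiLp.smul_apply, smul_eq_mul]
  obtain rfl : b = 1 - a := by linarith
  refine ⟨⟨?_, ?_⟩, ?_, ?_⟩ <;> nlinarith [hp.1.1, hp.1.2, hp.2.1, hp.2.2, hq.1.1, hq.1.2, hq.2.1, hq.2.2]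

theorem capSet_eq_inter (ω : ℝ) (T : Set ℝ) (g : ℝ → ℝ) :
    capSet ω T g = parallelogram ω ∩
      ⋂ t ∈ T, {p | pr t p ≤ g t} ∩ {p | pr (t + π / 2) p ≤ g (t + π / 2)} := by
  ext p; simp [capSet]

theorem isClosed_capSet (ω : ℝ) (T : Set ℝ) (g : ℝ → ℝ) : IsClosed (capSet ω T g) := by
  rw [capSet_eq_inter]
  exact (isClosed_parallelogram ω).inter (isClosed_biInter fun t _ =>
    (isClosed_le (by fun_prop) continuous_const).inter
      (isClosed_le (by fun_prop) continuous_const))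

theorem convex_pr_le (t a : ℝ) : Convex ℝ {p : Plane | pr t p ≤ a} := by
  intro p hp q hq c d hc hd hcd
  simp only [mem_ofPred_eq, pr_add, pr_smul] at *
  obtain rfl : d = 1 - c := by linarith
  nlinarith

theorem convex_capSet (ω : ℝ) (T : Set ℝ) (g : ℝ → ℝ) : Convex ℝ (capSet ω T g) := by
  rw [capSet_eq_inter]
  exact (convex_parallelogram ω).inter (convex_iInter₂ fun t _ =>
    (convex_pr_le _ _).inter (convex_pr_le _ _))

theorem isClosed_fan (ω : ℝ) : IsClosed (fan ω) := by
  have : fan ω = {p | 0 ≤ pr ω p ∧ 0 ≤ p 1} := by ext p; exact mem_fan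
  rw [this]
  have h1 : Continuous fun p : Plane => p 1 := by fun_prop
  exact (isClosed_le continuous_const (continuous_pr ω)).inter (isClosed_le continuous_const h1)

theorem nicheSet_eq_inter (ω : ℝ) (T : Set ℝ) (g : ℝ → ℝ) :
    nicheSet ω T g = fan ω ∩
      ⋃ t ∈ T, {p | pr t p < g t - 1} ∩ {p | pr (t + π / 2) p < g (t + π / 2) - 1} := by
  ext p; simp only [nicheSet, mem_inter_iff, mem_iUnion, mem_ofPred_eq, exists_prop]

theorem measurableSet_nicheSet (ω : ℝ) (T : Set ℝ) (g : ℝ → ℝ) :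
    MeasurableSet (nicheSet ω T g) := by
  rw [nicheSet_eq_inter]
  exact (isClosed_fan ω).measurableSet.inter (isOpen_biUnion fun t _ =>
    (isOpen_lt (by fun_prop) continuous_const).inter
      (isOpen_lt (by fun_prop) continuous_const)).measurableSet

theorem isBounded_of_abs_le {S : Set Plane} {a b : ℝ} (h : ∀ p ∈ S, |p 0| ≤ a ∧ |p 1| ≤ b) :
    Bornology.IsBounded S := by
  refine isBounded_iff_forall_norm_le.2 ⟨√(a ^ 2 + b ^ 2), fun p hp => ?_⟩
  rw [EuclideanSpace.norm_eq, Fin.sum_univ_two]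
  refine Real.sqrt_le_sqrt ?_
  simp only [Real.norm_eq_abs]
  have := h p hp
  gcongr
  · exact this.1
  · exact this.2

/-- A quarter-plane facing down meets the upper half-plane in a bounded set. -/
theorem isBounded_upper_quadrant {t a b : ℝ} (h0 : 0 < t) (h1 : t < π / 2) :
    Bornology.IsBounded {p : Plane | 0 ≤ p 1 ∧ pr t p ≤ a ∧ pr (t + π / 2) p ≤ b} := by
  have hs : 0 < sin t := sin_pos_of_pos_of_lt_pi h0 (by linarith)
  have hc : 0 < cos t := cos_pos_of_mem_Ioo ⟨by linarith, h1⟩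
  refine isBounded_of_abs_le (a := max (a / cos t) (b / sin t)) (b := sin t * a + cos t * b) ?_
  rintro p ⟨hp, ha, hb⟩
  have hy := pr_height t p
  have h3 : p 0 * cos t ≤ a := by
    have : pr t p = p 0 * cos t + p 1 * sin t := rfl
    nlinarith
  have h4 : -p 0 * sin t ≤ b := by
    have : pr (t + π / 2) p = -p 0 * sin t + p 1 * cos t := by
      simp [pr, cos_add_pi_div_two, sin_add_pi_div_two]
    nlinarith
  constructor
  · rw [abs_le]
    constructor
    · have : -p 0 ≤ b / sin t := (le_div_iff₀ hs).2 h4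
      linarith [le_max_right (a / cos t) (b / sin t)]
    · exact ((le_div_iff₀ hc).2 h3).trans (le_max_left _ _)
  · rw [abs_of_nonneg hp]; nlinarith

theorem isBounded_capSet {ω : ℝ} {T : Set ℝ} (g : ℝ → ℝ) {t : ℝ} (ht : t ∈ T) (h0 : 0 < t)
    (h1 : t < π / 2) : Bornology.IsBounded (capSet ω T g) :=
  (isBounded_upper_quadrant h0 h1 (a := g t) (b := g (t + π / 2))).subset fun _ hp =>
    ⟨(mem_parallelogram.1 hp.1).1.1, (hp.2 t ht).1, (hp.2 t ht).2⟩

theorem isBounded_nicheSet {ω : ℝ} {T : Set ℝ} (g : ℝ → ℝ) (hT : T.Finite)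
    (hT' : ∀ t ∈ T, 0 < t ∧ t < π / 2) : Bornology.IsBounded (nicheSet ω T g) := by
  have h : Bornology.IsBounded (⋃ t ∈ T, {p : Plane | 0 ≤ p 1 ∧ pr t p ≤ g t - 1 ∧
      pr (t + π / 2) p ≤ g (t + π / 2) - 1}) :=
    (Bornology.isBounded_biUnion hT).2 fun t ht =>
      isBounded_upper_quadrant (hT' t ht).1 (hT' t ht).2
  refine h.subset ?_
  rintro p ⟨hf, t, ht, h1, h2⟩
  exact mem_biUnion ht ⟨(mem_fan.1 hf).2, h1.le, h2.le⟩

/-! ### The apex and the origin -/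

/-- The apex lies on the bisector of `u ω` and `u (π / 2)`, at polar angle `π / 4 + ω / 2`. Its
coordinates are therefore nonnegative along all wall normals, which keeps the origin in any cap
containing it. -/
theorem pr_apex {ω : ℝ} (hω : ω ∈ Ioc 0 (π / 2)) (t : ℝ) :
    pr t (apex ω) = sin (t + (π / 4 - ω / 2)) / cos (π / 4 - ω / 2) := by
  have hc : cos (π / 4 - ω / 2) ≠ 0 :=
    (cos_pos_of_mem_Ioo ⟨by linarith [hω.2, pi_pos], by linarith [hω.1, pi_pos]⟩).ne'
  simp only [pr, apex, tan_eq_sin_div_cos, sin_add]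
  simp only [Matrix.cons_val_zero, Matrix.cons_val_one]
  rw [eq_div_iff hc, add_mul, mul_right_comm, div_mul_cancel₀ _ hc]
  ring

theorem pr_apex_nonneg {ω : ℝ} (hω : ω ∈ Ioc 0 (π / 2)) {t : ℝ} (ht : t ∈ Icc 0 (ω + π / 2)) :
    0 ≤ pr t (apex ω) := by
  rw [pr_apex hω]
  have := hω.1; have := hω.2; have := ht.1; have := ht.2
  refine div_nonneg (sin_nonneg_of_nonneg_of_le_pi ?_ ?_) (cos_nonneg_of_mem_Icc ⟨?_, ?_⟩) <;>
    linarith [pi_pos]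

theorem pr_apex_self {ω : ℝ} (hω : ω ∈ Ioc 0 (π / 2)) : pr ω (apex ω) = 1 := by
  have hc : cos (π / 4 - ω / 2) ≠ 0 :=
    (cos_pos_of_mem_Ioo ⟨by linarith [hω.2, pi_pos], by linarith [hω.1, pi_pos]⟩).ne'
  rw [pr_apex hω, show ω + (π / 4 - ω / 2) = π / 2 - (π / 4 - ω / 2) by ring,
    sin_pi_div_two_sub, div_self hc]

theorem apex_one (ω : ℝ) : apex ω 1 = 1 := by simp [apex]

theorem apex_mem_parallelogram {ω : ℝ} (hω : ω ∈ Ioc 0 (π / 2)) : apex ω ∈ parallelogram ω := by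
  rw [mem_parallelogram, apex_one, pr_apex_self hω]; norm_num

theorem zero_mem_capSet {ω : ℝ} (hω : ω ∈ Ioc 0 (π / 2)) {T : Set ℝ} (hT : T ⊆ Icc 0 ω)
    {g : ℝ → ℝ} (ha : apex ω ∈ capSet ω T g) : (0 : Plane) ∈ capSet ω T g := by
  refine ⟨mem_parallelogram.2 (by simp), fun t ht => ?_⟩
  have h := hT ht
  have := hω.1; have := hω.2; have := h.1; have := h.2
  simp only [pr_zero_right]
  exact ⟨(pr_apex_nonneg hω ⟨by linarith, by linarith⟩).trans (ha.2 t ht).1,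
    (pr_apex_nonneg hω ⟨by linarith, by linarith⟩).trans (ha.2 t ht).2⟩

/-- The lower boundary point of a cap to the right of the origin below a given point. -/
theorem foot_mem_capSet {ω : ℝ} (hω : ω ∈ Ioc 0 (π / 2)) {T : Set ℝ} (hT : T ⊆ Icc 0 ω)
    {g : ℝ → ℝ} (ha : apex ω ∈ capSet ω T g) {q : Plane} (hq : q ∈ capSet ω T g) :
    (!₂[max (q 0) 0, 0] : Plane) ∈ capSet ω T g := by
  rcases le_total (q 0) 0 with h | h
  · rw [max_eq_right h]
    have h0 : (!₂[0, 0] : Plane) = 0 := plane_ext (by simp) (by simp)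
    rw [h0]
    exact zero_mem_capSet hω hT ha
  · rw [max_eq_left h]
    have h1 := mem_parallelogram.1 hq.1
    have := hω.1; have := hω.2
    have hsω : 0 ≤ sin ω := sin_nonneg_of_nonneg_of_le_pi (by linarith) (by linarith [pi_pos])
    have hcω : 0 ≤ cos ω := cos_nonneg_of_mem_Icc ⟨by linarith, by linarith⟩
    simp only [pr] at h1
    refine ⟨mem_parallelogram.2 ?_, fun t ht => ?_⟩
    · simp only [pr]; simp
      exact ⟨by positivity, by nlinarith⟩
    · have h2 := hq.2 t ht
      have := (hT ht).1; have := (hT ht).2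
      have hs : 0 ≤ sin t := sin_nonneg_of_nonneg_of_le_pi (by linarith) (by linarith [pi_pos])
      have hc : 0 ≤ cos t := cos_nonneg_of_mem_Icc ⟨by linarith, by linarith⟩
      simp only [pr, cos_add_pi_div_two, sin_add_pi_div_two] at h2 ⊢
      simp
      constructor <;> nlinarith

/-! ### Caps as sets cut out by prescribed heights -/

/-- The normal angles used by caps with angle set `T`. -/
def capAngles (ω : ℝ) (T : Set ℝ) : Set ℝ :=
  T ∪ (fun t => t + π / 2) '' T ∪ {ω, π / 2} ∪ {ω + π, 3 * π / 2}

theorem capAngles_Icc {ω : ℝ} (hω : ω ∈ Ioc 0 (π / 2)) :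
    capAngles ω (Icc 0 ω) = Icc 0 ω ∪ Icc (π / 2) (ω + π / 2) ∪ {ω + π, 3 * π / 2} := by
  have h : (fun t => t + π / 2) '' Icc 0 ω = Icc (π / 2) (ω + π / 2) := by
    rw [image_add_const_Icc]; simp
  rw [capAngles, h]
  congr 1
  refine union_eq_self_of_subset_right ?_
  rintro x (rfl | rfl)
  · exact Or.inl ⟨hω.1.le, le_rfl⟩
  · exact Or.inr ⟨le_rfl, by linarith [hω.1]⟩

theorem isInterHalfPlanes_mono {A B : Set ℝ} (h : A ⊆ B) {K : Set Plane}
    (hK : IsInterHalfPlanes A K) : IsInterHalfPlanes B K := by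
  obtain ⟨F, hF, rfl⟩ := hK
  exact ⟨F, fun q hq => h (hF q hq), rfl⟩

theorem isInterHalfPlanes_capSet (ω : ℝ) (T : Set ℝ) (g : ℝ → ℝ) :
    IsInterHalfPlanes (capAngles ω T) (capSet ω T g) := by
  refine ⟨(fun t => (t, g t)) '' (T ∪ (fun t => t + π / 2) '' T) ∪
    {(ω, 1), (π / 2, 1), (ω + π, 0), (3 * π / 2, 0)}, ?_, ?_⟩
  · rintro q (⟨t, ht, rfl⟩ | rfl | rfl | rfl | rfl)
    · exact Or.inl (Or.inl ht)
    all_goals simp [capAngles]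
  · ext p
    simp only [capSet, mem_ofPred_eq, mem_iInter, mem_parallelogram]
    constructor
    · rintro ⟨⟨⟨h1, h2⟩, h3, h4⟩, h⟩ q (⟨t, (ht | ⟨t, ht, rfl⟩), rfl⟩ | rfl | rfl | rfl | rfl) <;>
        rw [mem_halfPlane]
      · exact (h t ht).1
      · exact (h t ht).2
      · exact h4
      · rwa [pr_pi_div_two]
      · rw [pr_add_pi]; linarith
      · rw [pr_three_pi_div_two]; linarith
    · intro h
      have h1 := h (ω, 1) (by simp)
      have h2 := h (π / 2, 1) (by simp)
      have h3 := h (ω + π, 0) (by simp)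
      have h4 := h (3 * π / 2, 0) (by simp)
      rw [mem_halfPlane] at h1 h2 h3 h4
      rw [pr_pi_div_two] at h2
      rw [pr_add_pi] at h3
      rw [pr_three_pi_div_two] at h4
      refine ⟨⟨⟨by linarith, h2⟩, by linarith, h1⟩, fun t ht => ⟨?_, ?_⟩⟩
      · exact mem_halfPlane.1 (h (t, g t) (Or.inl ⟨t, Or.inl ht, rfl⟩))
      · exact mem_halfPlane.1 (h (t + π / 2, g (t + π / 2))
          (Or.inl ⟨t + π / 2, Or.inr ⟨t, ht, rfl⟩, rfl⟩))

/-- The apex attains the support value `1` in the directions `ω` and `π / 2`, and the origin attains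
`0` in the two opposite ones. Hence any bounded `capSet` containing the apex is a cap, whatever the
heights. -/
theorem isCap_capSet {ω : ℝ} (hω : ω ∈ Ioc 0 (π / 2)) {T : Set ℝ} (hT : T ⊆ Icc 0 ω)
    {g : ℝ → ℝ} (ha : apex ω ∈ capSet ω T g) (hb : Bornology.IsBounded (capSet ω T g)) :
    IsCap ω (capSet ω T g) := by
  have h0 := zero_mem_capSet hω hT ha
  refine ⟨⟨_, ha⟩, Metric.isCompact_of_isClosed_isBounded (isClosed_capSet _ _ _) hb,
    convex_capSet _ _ _, ?_, ?_, ?_, ?_, ?_⟩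
  · exact supp_eq_of_mem ha (pr_apex_self hω) fun q hq => (mem_parallelogram.1 hq.1).2.2
  · refine supp_eq_of_mem ha (by rw [pr_pi_div_two, apex_one]) fun q hq => ?_
    rw [pr_pi_div_two]; exact (mem_parallelogram.1 hq.1).1.2
  · refine supp_eq_of_mem h0 (by simp) fun q hq => ?_
    rw [pr_add_pi]; linarith [(mem_parallelogram.1 hq.1).2.1]
  · refine supp_eq_of_mem h0 (by simp) fun q hq => ?_
    rw [pr_three_pi_div_two]; linarith [(mem_parallelogram.1 hq.1).1.1]
  · rw [← capAngles_Icc hω]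
    refine isInterHalfPlanes_mono ?_ (isInterHalfPlanes_capSet ω T g)
    unfold capAngles
    gcongr

theorem IsCap.isCompact {ω : ℝ} {K : Set Plane} (hK : IsCap ω K) : IsCompact K := hK.2.1

theorem IsCap.isBounded {ω : ℝ} {K : Set Plane} (hK : IsCap ω K) : Bornology.IsBounded K :=
  hK.2.1.isBounded

theorem IsCap.subset_parallelogram {ω : ℝ} {K : Set Plane} (hK : IsCap ω K) :
    K ⊆ parallelogram ω := by
  obtain ⟨-, hc, -, h1, h2, h3, h4, -⟩ := hK
  intro p hp
  have e1 := le_supp hc.isBounded hp ω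
  have e2 := le_supp hc.isBounded hp (π / 2)
  have e3 := le_supp hc.isBounded hp (ω + π)
  have e4 := le_supp hc.isBounded hp (3 * π / 2)
  rw [h1] at e1
  rw [h2, pr_pi_div_two] at e2
  rw [h3, pr_add_pi] at e3
  rw [h4, pr_three_pi_div_two] at e4
  exact mem_parallelogram.2 ⟨⟨by linarith, e2⟩, by linarith, e1⟩

theorem IsCap.subset_capSet {ω : ℝ} {K : Set Plane} (hK : IsCap ω K) (T : Set ℝ) :
    K ⊆ capSet ω T (supp K) := fun _ hp =>
  ⟨hK.subset_parallelogram hp, fun t _ => ⟨le_supp hK.isBounded hp t, le_supp hK.isBounded hp _⟩⟩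

/-- Each half-plane in the intersection can be shrunk to the supporting one with the same normal, so
the support values at the allowed angles determine the cap. -/
theorem IsCap.eq_capSet_of_interHalfPlanes {ω : ℝ} {K : Set Plane} (hK : IsCap ω K) {T : Set ℝ}
    (h : IsInterHalfPlanes (capAngles ω T) K) : K = capSet ω T (supp K) := by
  refine (hK.subset_capSet T).antisymm fun p hp => ?_
  obtain ⟨F, hF, hKF⟩ := h
  have hP := mem_parallelogram.1 hp.1
  rw [hKF, mem_iInter₂]
  intro q hq
  have hle : supp K q.1 ≤ q.2 := supp_le hK.1 fun r hr => by
    rw [hKF, mem_iInter₂] at hr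
    exact mem_halfPlane.1 (hr q hq)
  rw [mem_halfPlane]
  refine le_trans ?_ hle
  obtain ⟨-, -, -, h1, h2, h3, h4, -⟩ := hK
  rcases hF q hq with ((ht | ⟨t, ht, hte⟩) | hh | hh) | hh | hh
  · exact (hp.2 _ ht).1
  · rw [← hte]; exact (hp.2 _ ht).2
  · rw [hh, h1]; exact hP.2.2
  · rw [hh, h2, pr_pi_div_two]; exact hP.1.2
  · rw [hh, h3, pr_add_pi]; linarith [hP.2.1]
  · rw [hh, h4, pr_three_pi_div_two]; linarith [hP.1.1]

theorem IsCap.eq_capSet {ω : ℝ} (hω : ω ∈ Ioc 0 (π / 2)) {K : Set Plane} (hK : IsCap ω K) :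
    K = capSet ω (Icc 0 ω) (supp K) :=
  hK.eq_capSet_of_interHalfPlanes (by rw [capAngles_Icc hω]; exact hK.2.2.2.2.2.2.2)

theorem IsPolygonCap.eq_capSet {ω : ℝ} {Θ : Set ℝ} {K : Set Plane} (hK : IsPolygonCap ω Θ K) :
    K = capSet ω Θ (supp K) :=
  hK.1.eq_capSet_of_interHalfPlanes hK.2

theorem isPolygonCap_capSet {ω : ℝ} (hω : ω ∈ Ioc 0 (π / 2)) {Θ : Set ℝ} (hΘ : Θ ⊆ Ioo 0 ω)
    (hne : Θ.Nonempty) {g : ℝ → ℝ} (ha : apex ω ∈ capSet ω Θ g) :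
    IsPolygonCap ω Θ (capSet ω Θ g) := by
  obtain ⟨t, ht⟩ := hne
  exact ⟨isCap_capSet hω (hΘ.trans Ioo_subset_Icc_self) ha
    (isBounded_capSet g ht (hΘ ht).1 ((hΘ ht).2.trans_le hω.2)), isInterHalfPlanes_capSet _ _ _⟩

theorem supp_capSet {ω : ℝ} {T : Set ℝ} {S : Set Plane} (hS : S.Nonempty)
    (hsub : S ⊆ capSet ω T (supp S)) (hb : Bornology.IsBounded (capSet ω T (supp S)))
    {t : ℝ} (ht : t ∈ T) :
    supp (capSet ω T (supp S)) t = supp S t ∧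
      supp (capSet ω T (supp S)) (t + π / 2) = supp S (t + π / 2) :=
  ⟨(supp_le (hS.mono hsub) fun _ hp => (hp.2 t ht).1).antisymm (supp_mono hS hb hsub t),
    (supp_le (hS.mono hsub) fun _ hp => (hp.2 t ht).2).antisymm (supp_mono hS hb hsub _)⟩

/-- In the basis `u ω`, `u (π / 2)`, the vector `u t` with `t ≤ ω` has a nonpositive second
coefficient. The apex has the same `u ω` coordinate as `q` and at least its height, so its `u t`
coordinate is at most that of `q`. The left walls compare with `p` in the same way. -/
theorem apex_pr_le_of_support {ω : ℝ} (hω : ω ∈ Ioc 0 (π / 2)) (hω' : ω < π / 2) {S : Set Plane}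
    (hb : Bornology.IsBounded S) (hS : S ⊆ parallelogram ω) {p q : Plane} (hp : p ∈ S) (hp1 : p 1 = 1)
    (hq : q ∈ S) (hq1 : pr ω q = 1) {t : ℝ} (ht : t ∈ Icc 0 ω) :
    pr t (apex ω) ≤ supp S t ∧ pr (t + π / 2) (apex ω) ≤ supp S (t + π / 2) := by
  have hc : 0 < cos ω := cos_pos_of_mem_Ioo ⟨by linarith [hω.1], hω'⟩
  have := ht.1; have := ht.2
  have hd : 0 < sin (π / 2 - ω) := by rwa [sin_pi_div_two_sub]
  constructor
  · refine le_trans ?_ (le_supp hb hq t)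
    have e1 := pr_comb ω (π / 2) t (apex ω)
    have e2 := pr_comb ω (π / 2) t q
    rw [pr_pi_div_two, apex_one, pr_apex_self hω] at e1
    rw [pr_pi_div_two, hq1] at e2
    have hs : sin (t - ω) ≤ 0 := by
      have : 0 ≤ sin (ω - t) := sin_nonneg_of_nonneg_of_le_pi (by linarith) (by linarith)
      rw [← neg_sub, sin_neg]; linarith
    have := (mem_parallelogram.1 (hS hq)).1.2
    nlinarith
  · refine le_trans ?_ (le_supp hb hp _)
    have e1 := pr_comb ω (π / 2) (t + π / 2) (apex ω)
    have e2 := pr_comb ω (π / 2) (t + π / 2) p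
    rw [pr_pi_div_two, apex_one, pr_apex_self hω] at e1
    rw [pr_pi_div_two, hp1] at e2
    have hs : sin (π / 2 - (t + π / 2)) ≤ 0 := by
      have : 0 ≤ sin t := sin_nonneg_of_nonneg_of_le_pi (by linarith) (by linarith)
      rw [show π / 2 - (t + π / 2) = -t by ring, sin_neg]; linarith
    have := (mem_parallelogram.1 (hS hp)).2.2
    nlinarith

theorem IsCap.apex_mem {ω : ℝ} (hω : ω ∈ Ioc 0 (π / 2)) (hω' : ω < π / 2) {K : Set Plane}
    (hK : IsCap ω K) : apex ω ∈ K := by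
  obtain ⟨p, hp, hp1⟩ := exists_pr_eq_supp hK.isCompact hK.1 (π / 2)
  obtain ⟨q, hq, hq1⟩ := exists_pr_eq_supp hK.isCompact hK.1 ω
  rw [hK.2.2.2.2.1, pr_pi_div_two] at hp1
  rw [hK.2.2.2.1] at hq1
  rw [hK.eq_capSet hω]
  exact ⟨apex_mem_parallelogram hω, fun t ht =>
    apex_pr_le_of_support hω hω' hK.isBounded hK.subset_parallelogram hp hp1 hq hq1 ht⟩

/-! ### Shifting the right walls along another wall -/

/-- Besides `A` itself, `B` contains the open interval of length `ε` just below `sInf A`. -/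
theorem volume_add_le_of_Icc_subset {A B : Set ℝ} {ε : ℝ} (hA : A.Nonempty) (hb : BddBelow A)
    (hAB : ∀ a ∈ A, Icc (a - ε) a ⊆ B) (hε : 0 < ε) :
    volume A + ENNReal.ofReal ε ≤ volume B := by
  have hsub : A ∪ Ioo (sInf A - ε) (sInf A) ⊆ B := by
    rintro x (hx | hx)
    · exact hAB x hx ⟨by linarith, le_rfl⟩
    · obtain ⟨a, ha, hax⟩ := exists_lt_of_csInf_lt hA (show sInf A < x + ε by linarith [hx.1])
      exact hAB a ha ⟨by linarith, hx.2.le.trans (csInf_le hb ha)⟩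
  have hd : Disjoint A (Ioo (sInf A - ε) (sInf A)) :=
    disjoint_left.2 fun x hx hx' => (csInf_le hb hx).not_gt hx'.2
  calc volume A + ENNReal.ofReal ε = volume A + volume (Ioo (sInf A - ε) (sInf A)) := by
        rw [Real.volume_Ioo]; congr 2; ring
    _ = volume (A ∪ Ioo (sInf A - ε) (sInf A)) := (measure_union hd measurableSet_Ioo).symm
    _ ≤ volume B := measure_mono hsub

open scoped Classical in
/-- The heights after translating by `ε • v s` the walls with normal angles in `Θ` less than `s`. -/
def shiftHeights (Θ : Set ℝ) (s ε : ℝ) (g : ℝ → ℝ) (x : ℝ) : ℝ :=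
  -- Translation by `ε • v s` changes the height in direction `u x` by the inner product of `ε • v
  -- s` with `u x`, which is `-ε * sin (s - x)`.
  if x ∈ Θ ∧ x < s then g x - ε * sin (s - x) else g x

theorem shiftHeights_of_lt {Θ : Set ℝ} {s ε : ℝ} {g : ℝ → ℝ} {r : ℝ} (hr : r ∈ Θ) (hs : r < s) :
    shiftHeights Θ s ε g r = g r - ε * sin (s - r) := if_pos ⟨hr, hs⟩

theorem shiftHeights_of_le {Θ : Set ℝ} {s ε : ℝ} {g : ℝ → ℝ} {r : ℝ} (hs : s ≤ r) :
    shiftHeights Θ s ε g r = g r := if_neg fun h => h.2.not_ge hs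

section Shift

variable {ω : ℝ} {Θ : Set ℝ} {g : ℝ → ℝ} {s ε : ℝ}

/-- The foot lies below a rightmost point of the cap, or at the origin. A point on the right wall
`r` has abscissa at most `a` and height at most `1`, so `g r ≤ a * cos r + sin r < a * cos r + 1`.
Thus all inner right walls meet the horizontal axis strictly to the left of a point of the cap, and
this point serves as the common start for measuring both area changes. -/
theorem exists_foot (hω : ω ∈ Ioc 0 (π / 2)) (hΘ : Θ ⊆ Ioo 0 ω) (hne : Θ.Nonempty)
    (ha : apex ω ∈ capSet ω Θ g) (htight : ∀ r ∈ Θ, ∃ q ∈ capSet ω Θ g, pr r q = g r) :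
    ∃ a : ℝ, 0 ≤ a ∧ (!₂[a, 0] : Plane) ∈ capSet ω Θ g ∧ ∀ r ∈ Θ, g r - 1 < a * cos r := by
  have hΘ' : Θ ⊆ Icc 0 ω := hΘ.trans Ioo_subset_Icc_self
  have hcap := isPolygonCap_capSet hω hΘ hne ha
  obtain ⟨q, hq, hqm⟩ := hcap.1.isCompact.exists_isMaxOn ⟨_, ha⟩ (continuous_pr 0).continuousOn
  refine ⟨max (q 0) 0, le_max_right _ _, foot_mem_capSet hω hΘ' ha hq, fun r hr => ?_⟩
  obtain ⟨p, hp, hpr⟩ := htight r hr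
  have h0 := (hΘ hr).1
  have h1 := (hΘ hr).2.trans_le hω.2
  have hc : 0 < cos r := cos_pos_of_mem_Ioo ⟨by linarith, h1⟩
  have hs : sin r < 1 := by
    have : sin r < sin (π / 2) := sin_lt_sin_of_lt_of_le_pi_div_two (by linarith) le_rfl h1
    rwa [sin_pi_div_two] at this
  have hs0 : 0 < sin r := sin_pos_of_pos_of_lt_pi h0 (by linarith)
  have h2 : p 0 ≤ q 0 := by simpa [pr_zero] using hqm hp
  have h3 := (mem_parallelogram.1 hp.1).1.2
  have h4 : g r = p 0 * cos r + p 1 * sin r := hpr.symm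
  have h5 : p 0 ≤ max (q 0) 0 := h2.trans (le_max_left _ _)
  nlinarith

theorem exists_of_mem_diff_shift {p : Plane} (hΘ : Θ ⊆ Ioo 0 ω) (hω : ω ≤ π / 2)
    (hp : p ∈ capSet ω Θ g) (hp' : p ∉ capSet ω Θ (shiftHeights Θ s ε g)) :
    ∃ r ∈ Θ, r < s ∧ g r - ε * sin (s - r) < pr r p := by
  by_contra! hcon
  refine hp' ⟨hp.1, fun r hr => ⟨?_, ?_⟩⟩
  · rcases lt_or_ge r s with h | h
    · rw [shiftHeights_of_lt hr h]; exact hcon r hr h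
    · rw [shiftHeights_of_le h]; exact (hp.2 r hr).1
  · have : r + π / 2 ∉ Θ := fun h => by linarith [(hΘ h).2, (hΘ hr).1]
    rw [shiftHeights, if_neg fun h => this h.1]; exact (hp.2 r hr).2

theorem shiftHeights_le (hs : s ≤ π / 2) (hΘ : Θ ⊆ Ioo 0 ω) (hε : 0 ≤ ε) (x : ℝ) :
    shiftHeights Θ s ε g x ≤ g x := by
  unfold shiftHeights
  split_ifs with h
  · have : 0 ≤ sin (s - x) :=
      sin_nonneg_of_nonneg_of_le_pi (by linarith [h.2]) (by linarith [(hΘ h.1).1, pi_pos])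
    nlinarith
  · exact le_rfl

theorem shiftHeights_add_pi_div_two (hΘ : Θ ⊆ Ioo 0 ω) (hω : ω ≤ π / 2) {r : ℝ} (hr : r ∈ Θ) :
    shiftHeights Θ s ε g (r + π / 2) = g (r + π / 2) := by
  have : r + π / 2 ∉ Θ := fun h => by linarith [(hΘ h).2, (hΘ hr).1]
  rw [shiftHeights, if_neg fun h => this h.1]

/-- The area lost by a cap when right walls are shifted. -/
theorem volume_capSet_le_shift (hω : ω ∈ Ioc 0 (π / 2)) (hΘ : Θ ⊆ Ioo 0 ω) (hs : s ∈ Ioc 0 ω)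
    {H a : ℝ} (hH : ∀ p ∈ capSet ω Θ g, pr s p ≤ H) (ha : (!₂[a, 0] : Plane) ∈ capSet ω Θ g)
    (hε : 0 < ε) :
    volume (capSet ω Θ g) ≤ volume (capSet ω Θ (shiftHeights Θ s ε g)) +
      ENNReal.ofReal (ε * (H - a * cos s + ε)) := by
  set K := capSet ω Θ g
  set K' := capSet ω Θ (shiftHeights Θ s ε g)
  have hs2 : s ≤ π / 2 := hs.2.trans hω.2
  have hm : MeasurableSet (K \ K') :=
    (isClosed_capSet _ _ _).measurableSet.diff (isClosed_capSet _ _ _).measurableSet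
  have key : volume (K \ K') ≤ ENNReal.ofReal (ε * (H - a * cos s + ε)) := by
    rw [volume_eq_lintegral_slice s hm]
    -- The walls move by `ε` along the slices, so a slice loses at most `ε`. Nothing is lost above
    -- `H`, or below the foot by more than `ε`.
    have hle : ∀ c, volume {w | pt s c w ∈ K \ K'} ≤
        (Icc (a * cos s - ε) H).indicator (fun _ => ENNReal.ofReal ε) c := by
      intro c
      by_cases hc : c ∈ Icc (a * cos s - ε) H
      · rw [indicator_of_mem hc]
        refine (Real.volume_le_diam _).trans (Metric.ediam_le fun w₁ h₁ w₂ h₂ => ?_)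
        rw [edist_dist, Real.dist_eq]
        refine ENNReal.ofReal_le_ofReal ?_
        have one : ∀ w₁ w₂, pt s c w₁ ∈ K \ K' → pt s c w₂ ∈ K \ K' → w₂ - w₁ ≤ ε := by
          intro w₁ w₂ h₁ h₂
          obtain ⟨r, hr, hrs, hlt⟩ := exists_of_mem_diff_shift hΘ hω.2 h₂.1 h₂.2
          have h3 := (h₁.1.2 r hr).1
          rw [pr_pt] at hlt h3
          have hsin : 0 < sin (s - r) :=
            sin_pos_of_pos_of_lt_pi (by linarith) (by linarith [(hΘ hr).1, pi_pos])
          nlinarith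
        rw [abs_le]
        exact ⟨by linarith [one _ _ h₁ h₂], by linarith [one _ _ h₂ h₁]⟩
      · rw [indicator_of_notMem hc, nonpos_iff_eq_zero]
        convert measure_empty (μ := (volume : Measure ℝ))
        refine eq_empty_of_forall_notMem fun w hw => hc ?_
        have h1 := hH _ hw.1
        rw [pr_pt_self] at h1
        refine ⟨?_, h1⟩
        obtain ⟨r, hr, hrs, hlt⟩ := exists_of_mem_diff_shift hΘ hω.2 hw.1 hw.2
        have h2 := (ha.2 r hr).1
        have h2' : a * cos r ≤ g r := by simpa [pr] using h2
        have h0 := (hΘ hr).1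
        have hy := (mem_parallelogram.1 hw.1.1).1.1
        have hcomb := pr_comb r (π / 2) s (pt s c w)
        rw [pr_pt_self, pr_pi_div_two, sin_pi_div_two_sub, sin_pi_div_two_sub] at hcomb
        have hcr : 0 < cos r := cos_pos_of_mem_Ioo ⟨by linarith, by linarith⟩
        have hcs : 0 ≤ cos s := cos_nonneg_of_mem_Icc ⟨by linarith, hs2⟩
        have hcrs : cos s ≤ cos r := cos_le_cos_of_nonneg_of_le_pi h0.le (by linarith) hrs.le
        have hsin : 0 ≤ sin (s - r) :=
          sin_nonneg_of_nonneg_of_le_pi (by linarith) (by linarith)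
        have hsin1 : sin (s - r) ≤ 1 := sin_le_one _
        -- A lost point has nonnegative height and lies almost as far out as the foot in direction
        -- `u r`. As `u s` is a nonnegative combination of `u r` and the vertical, it also lies
        -- almost as far out in direction `u s`.
        have h3 : cos r * c ≥ cos s * (a * cos r - ε * sin (s - r)) := by
          rw [hcomb]
          have : cos s * (a * cos r - ε * sin (s - r)) ≤ cos s * pr r (pt s c w) :=
            mul_le_mul_of_nonneg_left (by linarith) hcs
          nlinarith
        have h4 : cos s * sin (s - r) ≤ cos r := by nlinarith
        have h5 : cos r * (a * cos s - ε) ≤ cos r * c := by nlinarith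
        exact le_of_mul_le_mul_left h5 hcr
    refine (lintegral_mono hle).trans ?_
    rw [lintegral_indicator measurableSet_Icc, lintegral_const, Measure.restrict_apply_univ,
      Real.volume_Icc, ← ENNReal.ofReal_mul hε.le]
    exact le_of_eq (by congr 2; ring)
  calc volume K ≤ volume (K' ∪ K \ K') := measure_mono fun p hp => by
        by_cases h : p ∈ K'
        · exact Or.inl h
        · exact Or.inr ⟨hp, h⟩
    _ ≤ volume K' + volume (K \ K') := measure_union_le _ _
    _ ≤ _ := by gcongr

/-- Points of a niche beyond the foot of a cap lie in quadrants with angle less than `s`. -/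
theorem lt_of_mem_quadrant {a : ℝ} (hω : ω ≤ π / 2) (hΘ : Θ ⊆ Ioo 0 ω) (hs : s ∈ Ioc 0 ω)
    (hg : ∀ r ∈ Θ, g r - 1 < a * cos r) {p : Plane} (hp : 0 ≤ p 1) (hc : a * cos s < pr s p)
    {r : ℝ} (hr : r ∈ Θ) (hpr : pr r p < g r - 1) : r < s := by
  by_contra! h
  have h0 := (hΘ hr).1
  have h1 := (hΘ hr).2
  have h2 := hg r hr
  have hcomb := pr_comb s (π / 2) r p
  rw [pr_pi_div_two, sin_pi_div_two_sub, sin_pi_div_two_sub] at hcomb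
  have hcr : 0 < cos r := cos_pos_of_mem_Ioo ⟨by linarith, by linarith⟩
  have hcs : 0 < cos s := cos_pos_of_mem_Ioo ⟨by linarith [hs.1], by linarith⟩
  have hsin : 0 ≤ sin (r - s) := sin_nonneg_of_nonneg_of_le_pi (by linarith) (by linarith [hs.1])
  nlinarith

/-- A point beyond the foot in direction `u s` but short of it in direction `u r`, with `r < s`,
must lie above the horizontal axis. Consequently the lower sides of the fan do not clip the niche
slices beyond the foot. -/
theorem mem_fan_of_quadrant {a : ℝ} (hω : ω ≤ π / 2) (ha : 0 ≤ a) (hΘ : Θ ⊆ Ioo 0 ω)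
    (hs : s ∈ Ioc 0 ω) (hg : ∀ r ∈ Θ, g r - 1 < a * cos r) {p : Plane}
    (hc : a * cos s < pr s p) {r : ℝ} (hr : r ∈ Θ) (hrs : r < s) (hpr : pr r p < g r - 1) :
    p ∈ fan ω := by
  have h0 := (hΘ hr).1
  have h1 := (hΘ hr).2
  have h2 := hg r hr
  have hs2 := hs.2
  have hcr : 0 < cos r := cos_pos_of_mem_Ioo ⟨by linarith, by linarith⟩
  have hcs : 0 ≤ cos s := cos_nonneg_of_mem_Icc ⟨by linarith, by linarith⟩
  have hsin : 0 < sin (s - r) := sin_pos_of_pos_of_lt_pi (by linarith) (by linarith)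
  have hy : 0 < p 1 := by
    have hcomb := pr_comb r (π / 2) s p
    rw [pr_pi_div_two, sin_pi_div_two_sub, sin_pi_div_two_sub] at hcomb
    have h3 : cos s * pr r p ≤ cos s * (a * cos r) :=
      mul_le_mul_of_nonneg_left (by linarith) hcs
    have h4 : 0 < sin (s - r) * p 1 := by nlinarith
    exact pos_of_mul_pos_right h4 hsin.le
  refine mem_fan.2 ⟨?_, hy.le⟩
  rcases hcs.eq_or_lt with h | h
  · have h3 : s = π / 2 := by
      by_contra hne
      have : 0 < cos s := cos_pos_of_mem_Ioo ⟨by linarith, lt_of_le_of_ne (by linarith) hne⟩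
      linarith
    rw [show ω = π / 2 by linarith, pr_pi_div_two]; exact hy.le
  · have hcomb := pr_comb s (π / 2) ω p
    rw [pr_pi_div_two, sin_pi_div_two_sub, sin_pi_div_two_sub] at hcomb
    have h5 : 0 ≤ cos ω := cos_nonneg_of_mem_Icc ⟨by linarith, by linarith⟩
    have h6 : 0 ≤ sin (ω - s) := sin_nonneg_of_nonneg_of_le_pi (by linarith) (by linarith)
    have h7 : 0 ≤ pr s p := by nlinarith
    have h8 : 0 ≤ cos s * pr ω p := by rw [hcomb]; positivity
    exact nonneg_of_mul_nonneg_right h8 h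

/-- The area lost by a niche when right walls are shifted. -/
theorem volume_nicheSet_shift_le (hω : ω ∈ Ioc 0 (π / 2)) (hΘf : Θ.Finite) (hΘ : Θ ⊆ Ioo 0 ω)
    (hs : s ∈ Ioc 0 ω) {a : ℝ} (ha : 0 ≤ a) (hg : ∀ r ∈ Θ, g r - 1 < a * cos r) (hε : 0 < ε)
    {z : Plane} (hz : z ∈ nicheSet ω Θ (shiftHeights Θ s ε g)) :
    volume (nicheSet ω Θ (shiftHeights Θ s ε g)) + ENNReal.ofReal (ε * (pr s z - a * cos s)) ≤
      volume (nicheSet ω Θ g) := by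
  set N := nicheSet ω Θ g
  set N' := nicheSet ω Θ (shiftHeights Θ s ε g)
  have hs2 : s ≤ π / 2 := hs.2.trans hω.2
  have hle' := shiftHeights_le (g := g) hs2 hΘ hε.le
  have hNN : N' ⊆ N := nicheSet_mono subset_rfl fun t _ => ⟨hle' _, hle' _⟩
  have hbdd : Bornology.IsBounded N' := isBounded_nicheSet _ hΘf fun t ht =>
    ⟨(hΘ ht).1, (hΘ ht).2.trans_le hω.2⟩
  rw [volume_eq_lintegral_slice s (measurableSet_nicheSet _ _ _ : MeasurableSet N),
    volume_eq_lintegral_slice s (measurableSet_nicheSet _ _ _ : MeasurableSet N')]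
  have hint : ENNReal.ofReal (ε * (pr s z - a * cos s)) =
      ∫⁻ c, (Ioo (a * cos s) (pr s z)).indicator (fun _ => ENNReal.ofReal ε) c := by
    rw [lintegral_indicator measurableSet_Ioo, lintegral_const, Measure.restrict_apply_univ,
      Real.volume_Ioo, ← ENNReal.ofReal_mul hε.le]
  rw [hint, ← lintegral_add_right _ (measurable_const.indicator measurableSet_Ioo)]
  refine lintegral_mono fun c => ?_
  by_cases hc : c ∈ Ioo (a * cos s) (pr s z)
  · rw [indicator_of_mem hc]
    obtain ⟨hzF, t, ht, hz1, hz2⟩ := hz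
    have hts : t < s := lt_of_mem_quadrant hω.2 hΘ hs hg (mem_fan.1 hzF).2 (hc.1.trans hc.2) ht
      (hz1.trans_le (by linarith [hle' t]))
    refine volume_add_le_of_Icc_subset ?_ ?_ ?_ hε
    -- Pulling `z` back along `-u s` decreases both wall coordinates, so the slice at `c` contains a
    -- point of the shifted niche.
    · set p : Plane := z - (pr s z - c) • u s with hp
      have hps : pr s p = c := by rw [hp]; simp [pr_u]
      have ht0 := (hΘ ht).1
      have hp1 : pr t p ≤ pr t z := by
        rw [hp, pr_sub, pr_smul, pr_u]
        have : 0 ≤ cos (t - s) := cos_nonneg_of_mem_Icc ⟨by linarith, by linarith⟩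
        nlinarith [hc.2]
      have hp2 : pr (t + π / 2) p ≤ pr (t + π / 2) z := by
        rw [hp, pr_sub, pr_smul, pr_u]
        have : 0 ≤ cos (t + π / 2 - s) := cos_nonneg_of_mem_Icc ⟨by linarith, by linarith⟩
        nlinarith [hc.2]
      refine ⟨pr (s + π / 2) p, ?_⟩
      change pt s c _ ∈ N'
      rw [← hps, pt_pr]
      refine ⟨?_, t, ht, hp1.trans_lt hz1, hp2.trans_lt hz2⟩
      exact mem_fan_of_quadrant hω.2 ha hΘ hs hg (by rw [hps]; exact hc.1) ht hts
        ((hp1.trans_lt hz1).trans_le (by linarith [hle' t]))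
    · obtain ⟨R, hR⟩ := hbdd.exists_norm_le
      refine ⟨-R, fun w hw => ?_⟩
      have h1 := (abs_pr_le (s + π / 2) (pt s c w)).trans (hR _ hw)
      rw [pr_pt, show s - (s + π / 2) = -(π / 2) by ring] at h1
      simp at h1
      linarith [(abs_le.1 h1).1]
    -- Descending by at most `ε` along `-v s` uses up at most the shift of the right wall `r`, and
    -- it moves away from the left wall.
    · rintro w ⟨hwF, r, hr, hw1, hw2⟩ w' hw'
      have hrs : r < s := lt_of_mem_quadrant hω.2 hΘ hs hg (mem_fan.1 hwF).2
        (by rw [pr_pt_self]; exact hc.1) hr (hw1.trans_le (by linarith [hle' r]))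
      have hr0 := (hΘ hr).1
      have hsin : 0 < sin (s - r) := sin_pos_of_pos_of_lt_pi (by linarith) (by linarith)
      have hcos : 0 ≤ cos (s - r) := cos_nonneg_of_mem_Icc ⟨by linarith, by linarith⟩
      rw [shiftHeights_of_lt hr hrs, pr_pt] at hw1
      rw [shiftHeights_add_pi_div_two hΘ hω.2 hr, pr_pt] at hw2
      rw [show s - (r + π / 2) = (s - r) - π / 2 by ring, cos_sub_pi_div_two,
        sin_sub_pi_div_two] at hw2
      have h1 : pr r (pt s c w') < g r - 1 := by
        rw [pr_pt]; nlinarith [hw'.1]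
      have h2 : pr (r + π / 2) (pt s c w') < g (r + π / 2) - 1 := by
        rw [pr_pt, show s - (r + π / 2) = (s - r) - π / 2 by ring, cos_sub_pi_div_two,
          sin_sub_pi_div_two]
        nlinarith [hw'.2]
      exact ⟨mem_fan_of_quadrant hω.2 ha hΘ hs hg (by rw [pr_pt_self]; exact hc.1) hr hrs h1,
        r, hr, h1, h2⟩
  · rw [indicator_of_notMem hc, add_zero]
    exact measure_mono fun w hw => hNN hw

/-- If a point of the niche lies strictly above a right wall `s`, and the right walls before `s` have
slack at the apex, then the polygon sofa area can be increased. -/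
theorem exists_increase_right (hω : ω ∈ Ioc 0 (π / 2)) (hΘf : Θ.Finite) (hΘ : Θ ⊆ Ioo 0 ω)
    (ha : apex ω ∈ capSet ω Θ g) (htight : ∀ r ∈ Θ, ∃ q ∈ capSet ω Θ g, pr r q = g r)
    (hs : s ∈ Ioc 0 ω) {H : ℝ} (hH : ∀ p ∈ capSet ω Θ g, pr s p ≤ H) {z : Plane}
    (hz : z ∈ nicheSet ω Θ g) (hzs : H < pr s z)
    (hslack : ∀ r ∈ Θ, r < s → pr r (apex ω) < g r) :
    ∃ g' : ℝ → ℝ, apex ω ∈ capSet ω Θ g' ∧ capSet ω Θ g' ⊆ capSet ω Θ g ∧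
      volume (capSet ω Θ g) + volume (nicheSet ω Θ g') <
        volume (capSet ω Θ g') + volume (nicheSet ω Θ g) := by
  obtain ⟨hzF, t, ht, hz1, hz2⟩ := hz
  obtain ⟨a, ha0, haK, hag⟩ := exists_foot hω hΘ ⟨t, ht⟩ ha htight
  have hs2 : s ≤ π / 2 := hs.2.trans hω.2
  have haH : a * cos s ≤ H := by simpa [pr] using hH _ haK
  have hts : t < s := lt_of_mem_quadrant hω.2 hΘ hs hag (mem_fan.1 hzF).2 (by linarith) ht hz1
  have hlim : ∀ k b : ℝ, 0 < b → ∀ᶠ ε in 𝓝[>] (0 : ℝ), ε * k < b := by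
    intro k b hb
    have h : Tendsto (fun ε : ℝ => ε * k) (𝓝[>] 0) (𝓝 (0 * k)) :=
      ((continuous_id.mul continuous_const).tendsto 0).mono_left nhdsWithin_le_nhds
    rw [zero_mul] at h
    exact h.eventually (gt_mem_nhds hb)
  have hev : ∀ᶠ ε in 𝓝[>] (0 : ℝ), ∀ r ∈ Θ, r < s → ε * sin (s - r) < g r - pr r (apex ω) := by
    refine (hΘf.eventually_all).2 fun r hr => ?_
    by_cases h : r < s
    · exact (hlim _ _ (sub_pos.2 (hslack r hr h))).mono fun ε hε _ => hε
    · exact Eventually.of_forall fun ε h' => absurd h' h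
  have hpos : ∀ᶠ ε in 𝓝[>] (0 : ℝ), 0 < ε := self_mem_nhdsWithin
  -- `ε` is small enough that the apex stays below the moved walls, `z` stays in the shifted niche,
  -- and `H + ε < pr s z`.
  obtain ⟨ε, ⟨⟨hε, hε1⟩, hε2⟩, hε3⟩ :=
    (((hpos.and hev).and (hlim (sin (s - t)) (g t - 1 - pr t z) (by linarith))).and
      (hlim 1 (pr s z - H) (by linarith))).exists
  rw [mul_one] at hε3
  have hsub : capSet ω Θ (shiftHeights Θ s ε g) ⊆ capSet ω Θ g := fun p hp =>
    ⟨hp.1, fun r hr => ⟨(hp.2 r hr).1.trans (shiftHeights_le hs2 hΘ hε.le _),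
      (hp.2 r hr).2.trans (shiftHeights_le hs2 hΘ hε.le _)⟩⟩
  have ht2 : t < π / 2 := (hΘ ht).2.trans_le hω.2
  have hKfin : volume (capSet ω Θ (shiftHeights Θ s ε g)) ≠ ⊤ :=
    (isBounded_capSet _ ht (hΘ ht).1 ht2).measure_lt_top.ne
  have hNfin : volume (nicheSet ω Θ (shiftHeights Θ s ε g)) ≠ ⊤ :=
    (isBounded_nicheSet _ hΘf fun t ht =>
      ⟨(hΘ ht).1, (hΘ ht).2.trans_le hω.2⟩).measure_lt_top.ne
  have hz' : z ∈ nicheSet ω Θ (shiftHeights Θ s ε g) := by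
    refine ⟨hzF, t, ht, ?_, ?_⟩
    · rw [shiftHeights_of_lt ht hts]; linarith
    · rwa [shiftHeights_add_pi_div_two hΘ hω.2 ht]
  refine ⟨shiftHeights Θ s ε g, ⟨ha.1, fun r hr => ⟨?_, ?_⟩⟩, hsub, ?_⟩
  · rcases lt_or_ge r s with h | h
    · rw [shiftHeights_of_lt hr h]; linarith [hε1 r hr h]
    · rw [shiftHeights_of_le h]; exact (ha.2 r hr).1
  · rw [shiftHeights_add_pi_div_two hΘ hω.2 hr]; exact (ha.2 r hr).2
  · have h1 := volume_capSet_le_shift hω hΘ hs hH haK hε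
    have h2 := volume_nicheSet_shift_le hω hΘf hΘ hs ha0 hag hε hz'
    have h3 : ENNReal.ofReal (ε * (H - a * cos s + ε)) <
        ENNReal.ofReal (ε * (pr s z - a * cos s)) := by
      rw [ENNReal.ofReal_lt_ofReal_iff (mul_pos hε (by linarith))]
      exact mul_lt_mul_of_pos_left (by linarith) hε
    calc _ ≤ volume (capSet ω Θ (shiftHeights Θ s ε g)) +
          ENNReal.ofReal (ε * (H - a * cos s + ε)) +
          volume (nicheSet ω Θ (shiftHeights Θ s ε g)) := by gcongr
      _ < volume (capSet ω Θ (shiftHeights Θ s ε g)) +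
          ENNReal.ofReal (ε * (pr s z - a * cos s)) +
          volume (nicheSet ω Θ (shiftHeights Θ s ε g)) :=
        ENNReal.add_lt_add_right hNfin (ENNReal.add_lt_add_left hKfin h3)
      _ ≤ _ := by
        rw [add_assoc]
        gcongr
        rwa [add_comm]

end Shift

/-! ### Reflection of caps -/

/-- The reflection exchanging the directions `u t` and `u (ω + π / 2 - t)`. -/
def refl (ω : ℝ) : Plane ≃ₗᵢ[ℝ] Plane := frameIso (ω + π / 2) ω (by simp)

theorem pr_refl (ω t : ℝ) (p : Plane) : pr t (refl ω p) = pr (ω + π / 2 - t) p := by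
  have h : pr t (refl ω p) = pr (ω + π / 2) p * cos t + pr ω p * sin t := rfl
  rw [h, pr_comb_quarter ω (ω + π / 2 - t) p, show ω + π / 2 - t - ω = π / 2 - t by ring,
    cos_pi_div_two_sub, sin_pi_div_two_sub]
  ring

theorem refl_one (ω : ℝ) (p : Plane) : refl ω p 1 = pr ω p := rfl

theorem refl_mem_fan {ω : ℝ} {p : Plane} : refl ω p ∈ fan ω ↔ p ∈ fan ω := by
  rw [mem_fan, mem_fan, pr_refl, refl_one, show ω + π / 2 - ω = π / 2 by ring, pr_pi_div_two,
    and_comm]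

theorem refl_mem_parallelogram {ω : ℝ} {p : Plane} :
    refl ω p ∈ parallelogram ω ↔ p ∈ parallelogram ω := by
  rw [mem_parallelogram, mem_parallelogram, pr_refl, refl_one, show ω + π / 2 - ω = π / 2 by ring,
    pr_pi_div_two, and_comm]

theorem refl_mem_capSet {ω : ℝ} {T : Set ℝ} {g : ℝ → ℝ} {p : Plane} :
    refl ω p ∈ capSet ω T g ↔
      p ∈ capSet ω ((fun t => ω - t) ⁻¹' T) (fun t => g (ω + π / 2 - t)) := by
  have e1 : ∀ t, ω + π / 2 - (ω - t) = t + π / 2 := fun t => by ring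
  have e2 : ∀ t, ω + π / 2 - (ω - t + π / 2) = t := fun t => by ring
  have e3 : ∀ t, ω + π / 2 - (t + π / 2) = ω - t := fun t => by ring
  have e4 : ∀ t, ω + π / 2 - t = ω - t + π / 2 := fun t => by ring
  refine and_congr refl_mem_parallelogram ⟨fun h t ht => ?_, fun h t ht => ?_⟩
  · have := h _ ht
    rw [pr_refl, pr_refl] at this
    beta_reduce at this ⊢
    rw [e1, e2] at this
    rw [e3, e4]
    exact this.symm
  · have := h (ω - t) (by simpa using ht)
    beta_reduce at this
    rw [pr_refl, pr_refl, e3, e4]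
    rw [e1, e2] at this
    exact this.symm

theorem refl_mem_nicheSet {ω : ℝ} {T : Set ℝ} {g : ℝ → ℝ} {p : Plane} :
    refl ω p ∈ nicheSet ω T g ↔
      p ∈ nicheSet ω ((fun t => ω - t) ⁻¹' T) (fun t => g (ω + π / 2 - t)) := by
  have e1 : ∀ t, ω + π / 2 - (ω - t) = t + π / 2 := fun t => by ring
  have e2 : ∀ t, ω + π / 2 - (ω - t + π / 2) = t := fun t => by ring
  have e3 : ∀ t, ω + π / 2 - (t + π / 2) = ω - t := fun t => by ring
  have e4 : ∀ t, ω + π / 2 - t = ω - t + π / 2 := fun t => by ring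
  refine and_congr refl_mem_fan ⟨?_, ?_⟩
  · rintro ⟨t, ht, h1, h2⟩
    rw [pr_refl, e4] at h1
    rw [pr_refl, e3] at h2
    refine ⟨ω - t, by simpa using ht, ?_, ?_⟩ <;> beta_reduce
    · rwa [e1]
    · rwa [e2]
  · rintro ⟨t, ht, h1, h2⟩
    beta_reduce at h1 h2
    rw [e4] at h1
    rw [e3] at h2
    refine ⟨ω - t, ht, ?_, ?_⟩
    · rwa [pr_refl, e1]
    · rwa [pr_refl, e2]

theorem refl_apex {ω : ℝ} (hω : ω ∈ Ioc 0 (π / 2)) : refl ω (apex ω) = apex ω := by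
  refine pr_injective (s := ω) ?_ ?_
  · rw [pr_refl, show ω + π / 2 - ω = π / 2 by ring, pr_pi_div_two, apex_one, pr_apex_self hω]
  · rw [pr_refl, show ω + π / 2 - (ω + π / 2) = 0 by ring, pr_apex hω, pr_apex hω,
      show ω + π / 2 + (π / 4 - ω / 2) = π - (0 + (π / 4 - ω / 2)) by ring, sin_pi_sub]

theorem refl_refl (ω : ℝ) (p : Plane) : refl ω (refl ω p) = p := by
  refine pr_injective (s := ω) ?_ ?_ <;> rw [pr_refl, pr_refl] <;> congr 1 <;> ring

theorem volume_capSet_refl (ω : ℝ) (T : Set ℝ) (g : ℝ → ℝ) :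
    volume (capSet ω ((fun t => ω - t) ⁻¹' T) (fun t => g (ω + π / 2 - t))) =
      volume (capSet ω T g) := by
  rw [← (refl ω).measurePreserving.measure_preimage
    (isClosed_capSet ω T g).measurableSet.nullMeasurableSet]
  congr 1; ext p; exact refl_mem_capSet.symm

theorem volume_nicheSet_refl (ω : ℝ) (T : Set ℝ) (g : ℝ → ℝ) :
    volume (nicheSet ω ((fun t => ω - t) ⁻¹' T) (fun t => g (ω + π / 2 - t))) =
      volume (nicheSet ω T g) := by
  rw [← (refl ω).measurePreserving.measure_preimage
    (measurableSet_nicheSet ω T g).nullMeasurableSet]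
  congr 1; ext p; exact refl_mem_nicheSet.symm

/-- The mirror image of `exists_increase_right`. -/
theorem exists_increase_left {ω : ℝ} {Θ : Set ℝ} {g : ℝ → ℝ} {s : ℝ}
    (hω : ω ∈ Ioc 0 (π / 2)) (hΘf : Θ.Finite) (hΘ : Θ ⊆ Ioo 0 ω)
    (ha : apex ω ∈ capSet ω Θ g)
    (htight : ∀ r ∈ Θ, ∃ q ∈ capSet ω Θ g, pr (r + π / 2) q = g (r + π / 2))
    (hs : s ∈ Ico 0 ω) {H : ℝ} (hH : ∀ p ∈ capSet ω Θ g, pr (s + π / 2) p ≤ H) {z : Plane}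
    (hz : z ∈ nicheSet ω Θ g) (hzs : H < pr (s + π / 2) z)
    (hslack : ∀ r ∈ Θ, s < r → pr (r + π / 2) (apex ω) < g (r + π / 2)) :
    ∃ g' : ℝ → ℝ, apex ω ∈ capSet ω Θ g' ∧ capSet ω Θ g' ⊆ capSet ω Θ g ∧
      volume (capSet ω Θ g) + volume (nicheSet ω Θ g') <
        volume (capSet ω Θ g') + volume (nicheSet ω Θ g) := by
  set Θ' : Set ℝ := (fun t => ω - t) ⁻¹' Θ
  set f : (ℝ → ℝ) → ℝ → ℝ := fun g t => g (ω + π / 2 - t) with hf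
  have hff : ∀ g, f (f g) = g := fun g => by
    funext t; simp only [hf]; congr 1; ring
  have hΘ' : (fun t => ω - t) ⁻¹' Θ' = Θ := by ext t; simp [Θ']
  have hang : ∀ r p, pr r (refl ω p) = pr (ω - r + π / 2) p := fun r p => by
    rw [pr_refl]; congr 1; ring
  have hcap : ∀ {g p}, p ∈ capSet ω Θ g ↔ refl ω p ∈ capSet ω Θ' (f g) := fun {g p} => by
    rw [refl_mem_capSet, hΘ']; change _ ↔ p ∈ capSet ω Θ (f (f g)); rw [hff]
  obtain ⟨g', h1, h2, h3⟩ := exists_increase_right (ω := ω) (Θ := Θ') (g := f g) (s := ω - s)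
    (H := H) (z := refl ω z) hω (hΘf.preimage (by intro a _ b _ h; simpa using h))
    (fun t ht => by have := hΘ ht; exact ⟨by linarith [this.2], by linarith [this.1]⟩)
    (by rw [← refl_apex hω]; exact hcap.1 ha)
    (fun r hr => by
      obtain ⟨q, hq, hqr⟩ := htight _ hr
      refine ⟨refl ω q, hcap.1 hq, ?_⟩
      rw [hang, hqr]; simp only [hf]; congr 1; ring)
    ⟨by linarith [hs.2], by linarith [hs.1]⟩
    (fun p hp => by
      have := hH (refl ω p) (hcap.2 (by rwa [refl_refl]))
      rw [pr_refl] at this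
      convert this using 2; ring)
    (by
      rw [refl_mem_nicheSet, hΘ']; change z ∈ nicheSet ω Θ (f (f g)); rwa [hff])
    (by rw [hang]; convert hzs using 2; ring)
    (fun r hr hrs => by
      rw [← refl_apex hω, hang]
      convert hslack _ hr (by linarith) using 1
      simp only [hf]; congr 1; ring)
  have hfg : f (f g') = g' := hff g'
  refine ⟨f g', ?_, ?_, ?_⟩
  · rw [hcap, refl_apex hω, hfg]; exact h1
  · intro p hp
    rw [hcap, hfg] at hp
    exact hcap.2 (h2 hp)
  · have e1 := volume_capSet_refl ω Θ g
    have e2 := volume_nicheSet_refl ω Θ g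
    have e3 := volume_capSet_refl ω Θ (f g')
    have e4 := volume_nicheSet_refl ω Θ (f g')
    change volume (capSet ω Θ' (f (f g'))) = _ at e3
    change volume (nicheSet ω Θ' (f (f g'))) = _ at e4
    rw [hfg] at e3 e4
    rw [← e1, ← e2, ← e3, ← e4]
    exact h3

/-! ### The niche of a maximum polygon cap -/

/-- Let `s` be the first right wall through the apex and `s'` the last left wall through it, with
defaults `ω` and `0`. Right directions up to `s` and left directions from `s'` on permit an
area-increasing shift. If `z` exceeds the cap in none of these, it lies in the cone below the apex
cut out by `s` and `s'`. The remaining wall normals lie between those two, so `z` satisfies those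
walls because the apex does, and `z` belongs to the cap. -/
theorem exists_increase {ω : ℝ} {Θ : Set ℝ} {g : ℝ → ℝ}
    (hω : ω ∈ Ioc 0 (π / 2)) (hΘf : Θ.Finite) (hΘ : Θ ⊆ Ioo 0 ω)
    (ha : apex ω ∈ capSet ω Θ g)
    (htight : ∀ r ∈ Θ, ∃ q ∈ capSet ω Θ g, pr r q = g r)
    (htight' : ∀ r ∈ Θ, ∃ q ∈ capSet ω Θ g, pr (r + π / 2) q = g (r + π / 2))
    {z : Plane} (hz : z ∈ nicheSet ω Θ g) (hzK : z ∉ capSet ω Θ g) :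
    ∃ g' : ℝ → ℝ, apex ω ∈ capSet ω Θ g' ∧ capSet ω Θ g' ⊆ capSet ω Θ g ∧
      volume (capSet ω Θ g) + volume (nicheSet ω Θ g') <
        volume (capSet ω Θ g') + volume (nicheSet ω Θ g) := by
  set K := capSet ω Θ g with hKdef
  set A := apex ω with hA
  -- the first right wall through the apex
  obtain ⟨s, ⟨hsmem, hsA⟩, hsmin⟩ : ∃ s, (s ∈ insert ω Θ ∧ (s = ω ∨ g s ≤ pr s A)) ∧
      ∀ r ∈ Θ, r < s → pr r A < g r := by
    have hfin : {s | s ∈ insert ω Θ ∧ (s = ω ∨ g s ≤ pr s A)}.Finite :=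
      (hΘf.insert ω).subset fun _ h => h.1
    obtain ⟨s, hs, hm⟩ := hfin.exists_minimal ⟨ω, mem_insert _ _, Or.inl rfl⟩
    refine ⟨s, hs, fun r hr hrs => ?_⟩
    by_contra! h
    exact hrs.not_ge (hm ⟨mem_insert_of_mem _ hr, Or.inr h⟩ hrs.le)
  -- the last left wall through the apex
  obtain ⟨s', ⟨hsmem', hsA'⟩, hsmax⟩ : ∃ s, (s ∈ insert 0 Θ ∧
      (s = 0 ∨ g (s + π / 2) ≤ pr (s + π / 2) A)) ∧
      ∀ r ∈ Θ, s < r → pr (r + π / 2) A < g (r + π / 2) := by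
    have hfin : {s | s ∈ insert 0 Θ ∧ (s = 0 ∨ g (s + π / 2) ≤ pr (s + π / 2) A)}.Finite :=
      (hΘf.insert 0).subset fun _ h => h.1
    obtain ⟨s, hs, hm⟩ := hfin.exists_maximal ⟨0, mem_insert _ _, Or.inl rfl⟩
    refine ⟨s, hs, fun r hr hrs => ?_⟩
    by_contra! h
    exact hrs.not_ge (hm ⟨mem_insert_of_mem _ hr, Or.inr h⟩ hrs.le)
  have hsI : s ∈ Ioc 0 ω := by
    rcases hsmem with rfl | h
    · exact ⟨hω.1, le_rfl⟩
    · exact ⟨(hΘ h).1, (hΘ h).2.le⟩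
  have hsI' : s' ∈ Ico 0 ω := by
    rcases hsmem' with rfl | h
    · exact ⟨le_rfl, hω.1⟩
    · exact ⟨(hΘ h).1.le, (hΘ h).2⟩
  have hAω : pr ω A = 1 := pr_apex_self hω
  have hA1 : A 1 = 1 := apex_one ω
  -- heights of `K` at these walls are those of the apex
  have hHs : ∀ p ∈ K, pr s p ≤ pr s A := by
    intro p hp
    rcases hsA with rfl | h
    · rw [hAω]; exact (mem_parallelogram.1 hp.1).2.2
    · rcases hsmem with rfl | h'
      · rw [hAω]; exact (mem_parallelogram.1 hp.1).2.2
      · exact (hp.2 s h').1.trans h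
  have hHs' : ∀ p ∈ K, pr (s' + π / 2) p ≤ pr (s' + π / 2) A := by
    intro p hp
    have h0 : pr (0 + π / 2) p ≤ pr (0 + π / 2) A := by
      rw [zero_add, pr_pi_div_two, pr_pi_div_two, hA1]; exact (mem_parallelogram.1 hp.1).1.2
    rcases hsA' with rfl | h
    · exact h0
    · rcases hsmem' with rfl | h'
      · exact h0
      · exact (hp.2 s' h').2.trans h
  have right : ∀ r ∈ Ioc 0 s, ∀ H, (∀ p ∈ K, pr r p ≤ H) → H < pr r z →
      ∃ g' : ℝ → ℝ, A ∈ capSet ω Θ g' ∧ capSet ω Θ g' ⊆ K ∧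
      volume K + volume (nicheSet ω Θ g') < volume (capSet ω Θ g') + volume (nicheSet ω Θ g) :=
    fun r hr H hH hlt => exists_increase_right hω hΘf hΘ ha htight ⟨hr.1, hr.2.trans hsI.2⟩ hH hz hlt
      fun q hq hqr => hsmin q hq (hqr.trans_le hr.2)
  have left : ∀ r ∈ Ico s' ω, ∀ H, (∀ p ∈ K, pr (r + π / 2) p ≤ H) → H < pr (r + π / 2) z →
      ∃ g' : ℝ → ℝ, A ∈ capSet ω Θ g' ∧ capSet ω Θ g' ⊆ K ∧
      volume K + volume (nicheSet ω Θ g') < volume (capSet ω Θ g') + volume (nicheSet ω Θ g) :=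
    fun r hr H hH hlt => exists_increase_left hω hΘf hΘ ha htight' ⟨hsI'.1.trans hr.1, hr.2⟩ hH hz hlt
      fun q hq hqr => hsmax q hq (hr.1.trans_lt hqr)
  by_cases hcs : pr s A < pr s z
  · exact right s ⟨hsI.1, le_rfl⟩ _ hHs hcs
  by_cases hcs' : pr (s' + π / 2) A < pr (s' + π / 2) z
  · exact left s' ⟨le_rfl, hsI'.2⟩ _ hHs' hcs'
  push Not at hcs hcs'
  have hω1 := hω.1
  have hω2 := hω.2
  -- a violated right wall beyond `s` or left wall before `s'` is impossible
  have noright : ∀ r, s < r → r ≤ ω → pr r z ≤ pr r A := by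
    intro r h1 h2
    have e1 := pr_comb s (s' + π / 2) r (z - A)
    simp only [pr_sub] at e1
    have hp1 : 0 < sin (s' + π / 2 - s) :=
      sin_pos_of_pos_of_lt_pi (by linarith [hsI'.1]) (by linarith [hsI.1, hsI'.2])
    have hp2 : 0 ≤ sin (s' + π / 2 - r) :=
      sin_nonneg_of_nonneg_of_le_pi (by linarith [hsI'.1]) (by linarith [hsI.1, hsI'.2])
    have hp3 : 0 ≤ sin (r - s) :=
      sin_nonneg_of_nonneg_of_le_pi (by linarith) (by linarith [hsI.1])
    nlinarith
  have noleft : ∀ r, 0 ≤ r → r < s' → pr (r + π / 2) z ≤ pr (r + π / 2) A := by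
    intro r h1 h2
    have e1 := pr_comb s (s' + π / 2) (r + π / 2) (z - A)
    simp only [pr_sub] at e1
    have hp1 : 0 < sin (s' + π / 2 - s) :=
      sin_pos_of_pos_of_lt_pi (by linarith [hsI'.1, hsI.2]) (by linarith [hsI.1, hsI'.2])
    have hp2 : 0 ≤ sin (s' + π / 2 - (r + π / 2)) :=
      sin_nonneg_of_nonneg_of_le_pi (by linarith [hsI'.1]) (by linarith [hsI.1, hsI'.2])
    have hp3 : 0 ≤ sin (r + π / 2 - s) :=
      sin_nonneg_of_nonneg_of_le_pi (by linarith [hsI.2]) (by linarith [hsI.1, hsI'.2])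
    nlinarith
  by_contra! hcon
  refine hzK ⟨mem_parallelogram.2 ⟨⟨(mem_fan.1 hz.1).2, ?_⟩, (mem_fan.1 hz.1).1, ?_⟩,
    fun r hr => ⟨?_, ?_⟩⟩
  · rw [← hA1, ← pr_pi_div_two, ← pr_pi_div_two, ← zero_add (π / 2)]
    rcases hsI'.1.eq_or_lt with h | h
    · rw [h]; exact hcs'
    · exact noleft 0 le_rfl h
  · rw [← hAω]
    rcases hsI.2.eq_or_lt with h | h
    · rw [← h]; exact hcs
    · exact noright ω h le_rfl
  · rcases lt_or_ge s r with h | h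
    · exact (noright r h (hΘ hr).2.le).trans (ha.2 r hr).1
    · by_contra! hlt
      obtain ⟨g', i1, i2, i3⟩ := right r ⟨(hΘ hr).1, h⟩ (g r) (fun p hp => (hp.2 r hr).1) hlt
      exact (hcon g' i1 i2).not_gt i3
  · rcases lt_or_ge r s' with h | h
    · exact (noleft r (hΘ hr).1.le h).trans (ha.2 r hr).2
    · by_contra! hlt
      obtain ⟨g', i1, i2, i3⟩ := left r ⟨h, (hΘ hr).2⟩ (g (r + π / 2))
        (fun p hp => (hp.2 r hr).2) hlt
      exact (hcon g' i1 i2).not_gt i3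

theorem polygonArea_eq (ω : ℝ) (Θ : Set ℝ) (K : Set Plane) :
    polygonArea ω Θ K = (volume (capSet ω Θ (supp K))).toReal -
      (volume (nicheSet ω Θ (supp K))).toReal := by
  rw [polygonArea, polygonCap_eq, polygonNiche_eq]; rfl

/-- Otherwise `exists_increase` yields better heights `g'`. The support values of the resulting cap
may be smaller than `g'`, but this only shrinks its niche, so maximality is still contradicted. -/
theorem IsMaximumPolygonCap.nicheSet_subset {ω : ℝ} {Θ : Set ℝ} {K : Set Plane}
    (hω : ω ∈ Ioc 0 (π / 2)) (hΘf : Θ.Finite) (hΘ : Θ ⊆ Ioo 0 ω)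
    (hK : IsMaximumPolygonCap ω Θ K) : nicheSet ω Θ (supp K) ⊆ K := by
  obtain ⟨hP, ha, hmax⟩ := hK
  intro z hz
  by_contra hzK
  have hKe := hP.eq_capSet
  have hΘ2 : ∀ t ∈ Θ, 0 < t ∧ t < π / 2 := fun t ht => ⟨(hΘ ht).1, (hΘ ht).2.trans_le hω.2⟩
  have hne : Θ.Nonempty := by obtain ⟨-, t, ht, -⟩ := hz; exact ⟨t, ht⟩
  have htight : ∀ t, ∃ q ∈ capSet ω Θ (supp K), pr t q = supp K t := fun t => by
    rw [← hKe]; exact exists_pr_eq_supp hP.1.isCompact hP.1.1 t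
  rw [hKe] at ha hzK
  obtain ⟨g', h1, h2, h3⟩ := exists_increase hω hΘf hΘ ha (fun r _ => htight r)
    (fun r _ => htight _) hz hzK
  have hP' := isPolygonCap_capSet hω hΘ hne h1
  have hle := hmax _ hP'
  have hKe' := hP'.eq_capSet
  set K' := capSet ω Θ g'
  rw [polygonArea_eq, polygonArea_eq, ← hKe'] at hle
  have hN : nicheSet ω Θ (supp K') ⊆ nicheSet ω Θ g' := nicheSet_mono subset_rfl fun t ht =>
    ⟨supp_le ⟨_, h1⟩ fun p hp => (hp.2 t ht).1, supp_le ⟨_, h1⟩ fun p hp => (hp.2 t ht).2⟩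
  have f1 : volume K' ≠ ⊤ := hP'.1.isBounded.measure_lt_top.ne
  have f2 : volume (nicheSet ω Θ g') ≠ ⊤ := (isBounded_nicheSet _ hΘf hΘ2).measure_lt_top.ne
  have f3 : volume (nicheSet ω Θ (supp K)) ≠ ⊤ :=
    (isBounded_nicheSet _ hΘf hΘ2).measure_lt_top.ne
  have f4 : volume (capSet ω Θ (supp K)) ≠ ⊤ := by
    rw [← hKe]; exact hP.1.isBounded.measure_lt_top.ne
  have h4 := (ENNReal.toReal_lt_toReal (ENNReal.add_ne_top.2 ⟨f4, f2⟩)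
    (ENNReal.add_ne_top.2 ⟨f1, f3⟩)).2 h3
  rw [ENNReal.toReal_add f4 f2, ENNReal.toReal_add f1 f3] at h4
  have h5 := ENNReal.toReal_mono f2 (measure_mono hN)
  linarith

/-! ### Limits in Hausdorff distance -/

/-- Nonempty compact sets converging to a nonempty compact set in Hausdorff distance. -/
structure HausdorffLimit (Ks : ℕ → Set Plane) (K : Set Plane) : Prop where
  isCompact_seq : ∀ i, IsCompact (Ks i)
  nonempty_seq : ∀ i, (Ks i).Nonempty
  isCompact : IsCompact K
  nonempty : K.Nonempty
  tendsto : Tendsto (fun i => Metric.hausdorffDist (Ks i) K) atTop (𝓝 0)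

theorem continuous_supp {K : Set Plane} (hK : IsCompact K) : Continuous (supp K) := by
  have h : supp K = fun t => sSup (pr t '' K) := funext fun t => supp_eq K t
  rw [h]
  exact hK.continuous_sSup continuous_pr₂

namespace HausdorffLimit

variable {Ks : ℕ → Set Plane} {K : Set Plane}

theorem edist_ne_top (h : HausdorffLimit Ks K) (i : ℕ) : Metric.hausdorffEDist (Ks i) K ≠ ⊤ :=
  Metric.hausdorffEDist_ne_top_of_nonempty_of_bounded (h.nonempty_seq i) h.nonempty
    (h.isCompact_seq i).isBounded h.isCompact.isBounded

theorem eventually_near (h : HausdorffLimit Ks K) {δ : ℝ} (hδ : 0 < δ) :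
    ∀ᶠ i in atTop, (∀ q ∈ Ks i, ∃ p ∈ K, dist q p < δ) ∧ ∀ p ∈ K, ∃ q ∈ Ks i, dist q p < δ := by
  filter_upwards [h.tendsto.eventually (gt_mem_nhds hδ)] with i hi
  exact ⟨fun q hq => Metric.exists_dist_lt_of_hausdorffDist_lt hq hi (h.edist_ne_top i),
    fun p hp => Metric.exists_dist_lt_of_hausdorffDist_lt' hp hi (h.edist_ne_top i)⟩

theorem supp_le_of_near {A B : Set Plane} {δ : ℝ} (hA : A.Nonempty) (hB : Bornology.IsBounded B)
    (h : ∀ q ∈ A, ∃ p ∈ B, dist q p < δ) (t : ℝ) : supp A t ≤ supp B t + δ := by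
  refine supp_le hA fun q hq => ?_
  obtain ⟨p, hp, hd⟩ := h q hq
  have h1 := (abs_pr_le t (q - p)).trans_lt (by rwa [← dist_eq_norm])
  rw [pr_sub] at h1
  linarith [le_supp hB hp t, (abs_lt.1 h1).2]

/-- Support functions of close sets are close uniformly in the angle, which allows the angle to vary
along the sequence. -/
theorem tendsto_supp (h : HausdorffLimit Ks K) {τ : ℕ → ℝ} {t : ℝ} (hτ : Tendsto τ atTop (𝓝 t)) :
    Tendsto (fun i => supp (Ks i) (τ i)) atTop (𝓝 (supp K t)) := by
  have h1 : Tendsto (fun i => supp K (τ i)) atTop (𝓝 (supp K t)) :=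
    ((continuous_supp h.isCompact).tendsto t).comp hτ
  rw [Metric.tendsto_nhds] at h1 ⊢
  intro ε hε
  filter_upwards [h1 (ε / 2) (half_pos hε), h.eventually_near (half_pos hε)] with i hi hn
  have e1 := supp_le_of_near (h.nonempty_seq i) h.isCompact.isBounded hn.1 (τ i)
  have e2 := supp_le_of_near h.nonempty (h.isCompact_seq i).isBounded
    (fun p hp => by simpa [dist_comm] using hn.2 p hp) (τ i)
  rw [Real.dist_eq, abs_lt] at *
  constructor <;> linarith [hi.1, hi.2]

theorem subset_of_isClosed (h : HausdorffLimit Ks K) {C : Set Plane} (hC : IsClosed C)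
    (hs : ∀ i, Ks i ⊆ C) : K ⊆ C := by
  intro p hp
  rw [← hC.closure_eq, Metric.mem_closure_iff]
  intro ε hε
  obtain ⟨i, -, hi⟩ := (h.eventually_near hε).exists
  obtain ⟨q, hq, hd⟩ := hi p hp
  exact ⟨q, hs i hq, by rwa [dist_comm]⟩

/-- Invariance under a continuous binary operation passes to the limit. -/
theorem op_mem (h : HausdorffLimit Ks K) {f : Plane × Plane → Plane} (hf : Continuous f)
    (hs : ∀ i, ∀ p ∈ Ks i, ∀ q ∈ Ks i, f (p, q) ∈ Ks i) {p q : Plane} (hp : p ∈ K) (hq : q ∈ K) :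
    f (p, q) ∈ K := by
  rw [← h.isCompact.isClosed.closure_eq, Metric.mem_closure_iff]
  intro ε hε
  obtain ⟨δ, hδ, hcont⟩ := Metric.continuousAt_iff.1 (hf.continuousAt (x := (p, q))) (ε / 2)
    (half_pos hε)
  obtain ⟨i, ⟨-, hi⟩, hi', -⟩ := ((h.eventually_near hδ).and
    (h.eventually_near (half_pos hε))).exists
  obtain ⟨p', hp', hpd⟩ := hi p hp
  obtain ⟨q', hq', hqd⟩ := hi q hq
  obtain ⟨k, hk, hkd⟩ := hi' _ (hs i p' hp' q' hq')
  have h1 := hcont (x := (p', q')) (by rw [Prod.dist_eq]; exact max_lt hpd hqd)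
  refine ⟨k, hk, ?_⟩
  have := dist_triangle_left (f (p, q)) k (f (p', q'))
  linarith

/-- Area is upper semicontinuous, with a lower semicontinuous error term. -/
theorem add_volume_le (h : HausdorffLimit Ks K) {a : ENNReal} {Ns : ℕ → Set Plane} {N : Set Plane}
    (hle : ∀ᶠ i in atTop, a + volume (Ns i) ≤ volume (Ks i))
    (hN : ∀ p ∈ N, ∀ᶠ i in atTop, p ∈ Ns i) : a + volume N ≤ volume K := by
  have hM : ∀ n, a + volume (⋂ i ≥ n, Ns i) ≤ volume K := by
    intro n
    -- The approximants eventually lie in any closed thickening of `K`, whose volume decreases to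
    -- that of `K`.
    have hlim := tendsto_measure_cthickening_of_isCompact (μ := (volume : Measure Plane)) h.isCompact
    have hlim' := hlim.mono_left (nhdsWithin_le_nhds (s := Ioi (0 : ℝ)))
    refine ge_of_tendsto hlim' ?_
    filter_upwards [self_mem_nhdsWithin] with δ hδ
    obtain ⟨i, ⟨h1, h2⟩, hin⟩ :=
      ((hle.and (h.eventually_near hδ)).and (eventually_ge_atTop n)).exists
    calc a + volume (⋂ i ≥ n, Ns i) ≤ a + volume (Ns i) := by
          gcongr; exact iInter₂_subset i hin
      _ ≤ volume (Ks i) := h1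
      _ ≤ _ := measure_mono fun q hq => by
        obtain ⟨p, hp, hd⟩ := h2.1 q hq
        exact Metric.mem_cthickening_of_dist_le _ _ _ _ hp hd.le
  have hmono : Monotone fun n => ⋂ i ≥ n, Ns i := fun n m hnm =>
    biInter_subset_biInter_left fun i (hi : m ≤ i) => hnm.trans hi
  -- `N` lies in the set-theoretic limit inferior of `Ns`, an increasing union, so continuity of
  -- measure from below applies.
  have hsub : N ⊆ ⋃ n, ⋂ i ≥ n, Ns i := fun p hp => by
    obtain ⟨n, hn⟩ := eventually_atTop.1 (hN p hp)
    exact mem_iUnion.2 ⟨n, mem_iInter₂.2 hn⟩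
  calc a + volume N ≤ a + volume (⋃ n, ⋂ i ≥ n, Ns i) := by gcongr
    _ = ⨆ n, a + volume (⋂ i ≥ n, Ns i) := by rw [hmono.measure_iUnion, ENNReal.add_iSup]
    _ ≤ volume K := iSup_le hM

theorem eventually_mem_nicheSet (h : HausdorffLimit Ks K) {ω : ℝ} {T : Set ℝ} {Θs : ℕ → Set ℝ}
    (hT : ∀ t ∈ T, ∃ τ : ℕ → ℝ, Tendsto τ atTop (𝓝 t) ∧ ∀ᶠ i in atTop, τ i ∈ Θs i) {p : Plane}
    (hp : p ∈ nicheSet ω T (supp K)) :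
    ∀ᶠ i in atTop, p ∈ nicheSet ω (Θs i) (supp (Ks i)) := by
  obtain ⟨hf, t, ht, h1, h2⟩ := hp
  obtain ⟨τ, hτ, hmem⟩ := hT t ht
  have hτ' : Tendsto (fun i => τ i + π / 2) atTop (𝓝 (t + π / 2)) := hτ.add_const _
  have c1 : Tendsto (fun i => pr (τ i) p) atTop (𝓝 (pr t p)) :=
    ((by unfold pr; fun_prop : Continuous fun s => pr s p).tendsto t).comp hτ
  have c2 : Tendsto (fun i => pr (τ i + π / 2) p) atTop (𝓝 (pr (t + π / 2) p)) :=
    ((by unfold pr; fun_prop : Continuous fun s => pr s p).tendsto _).comp hτ'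
  filter_upwards [hmem, c1.eventually_lt ((h.tendsto_supp hτ).sub_const 1) h1,
    c2.eventually_lt ((h.tendsto_supp hτ').sub_const 1) h2] with i i1 i2 i3
  exact ⟨hf, τ i, i1, i2, i3⟩

end HausdorffLimit

/-- Blaschke's selection theorem. -/
theorem exists_hausdorffLimit_subseq {Ks : ℕ → Set Plane} (hc : ∀ i, IsCompact (Ks i))
    (hne : ∀ i, (Ks i).Nonempty) {R : ℝ} (hR : ∀ i, Ks i ⊆ Metric.closedBall 0 R) :
    ∃ (K : Set Plane) (φ : ℕ → ℕ), StrictMono φ ∧ HausdorffLimit (Ks ∘ φ) K := by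
  let L : ℕ → TopologicalSpace.NonemptyCompacts Plane := fun i => ⟨⟨Ks i, hc i⟩, hne i⟩
  obtain ⟨K, -, φ, hφ, hlim⟩ :=
    (TopologicalSpace.NonemptyCompacts.isCompact_subsets_of_isCompact
      (isCompact_closedBall (0 : Plane) R)).tendsto_subseq (x := L) fun i => hR i
  refine ⟨K, φ, hφ, fun i => hc _, fun i => hne _, K.isCompact, K.nonempty, ?_⟩
  rw [tendsto_iff_dist_tendsto_zero] at hlim
  exact hlim

/-! ### Existence of maximum polygon caps -/

theorem polygonArea_capSet {ω : ℝ} {Θ : Set ℝ} {S : Set Plane} (hS : S.Nonempty)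
    (hsub : S ⊆ capSet ω Θ (supp S)) (hb : Bornology.IsBounded (capSet ω Θ (supp S))) :
    polygonArea ω Θ (capSet ω Θ (supp S)) = polygonArea ω Θ S := by
  have h : ∀ t ∈ Θ, supp (capSet ω Θ (supp S)) t = supp S t ∧
      supp (capSet ω Θ (supp S)) (t + π / 2) = supp S (t + π / 2) :=
    fun t ht => supp_capSet hS hsub hb ht
  rw [polygonArea_eq, polygonArea_eq, capSet_congr h, nicheSet_congr h]

theorem IsPolygonCap.polygonArea_eq' {ω : ℝ} {Θ : Set ℝ} {K : Set Plane} (hK : IsPolygonCap ω Θ K) :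
    polygonArea ω Θ K = (volume K).toReal - (volume (nicheSet ω Θ (supp K))).toReal := by
  rw [polygonArea_eq, ← hK.eq_capSet]

theorem parallelogram_subset_closedBall {ω : ℝ} (h0 : 0 < ω) (h1 : ω < π / 2) :
    ∃ R, parallelogram ω ⊆ Metric.closedBall 0 R := by
  have hc : 0 < cos ω := cos_pos_of_mem_Ioo ⟨by linarith, h1⟩
  have hs : 0 < sin ω := sin_pos_of_pos_of_lt_pi h0 (by linarith)
  have hb : Bornology.IsBounded (parallelogram ω) := by
    refine isBounded_of_abs_le (a := 1 / cos ω) (b := 1) fun p hp => ?_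
    obtain ⟨⟨e1, e2⟩, e3, e4⟩ := mem_parallelogram.1 hp
    have hs1 := sin_le_one ω
    simp only [pr] at e3 e4
    refine ⟨?_, abs_le.2 ⟨by linarith, e2⟩⟩
    rw [le_div_iff₀ hc, ← abs_of_pos hc, ← abs_mul, abs_le]
    constructor <;> nlinarith
  exact hb.subset_closedBall 0

theorem apex_right_zero : apex (π / 2) 0 = 0 := by
  simp [apex, show π / 4 - π / 2 / 2 = 0 by ring]

/-- For `ω = π/2`, polygon caps of nonnegative area with `π/4` in the angle set are uniformly
bounded. -/
theorem IsPolygonCap.subset_closedBall_of_right {Θ : Set ℝ} (hΘf : Θ.Finite)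
    (hΘ : Θ ⊆ Ioo 0 (π / 2)) (h4 : π / 4 ∈ Θ) {K : Set Plane} (hK : IsPolygonCap (π / 2) Θ K)
    (ha : apex (π / 2) ∈ K) (hA : 0 ≤ polygonArea (π / 2) Θ K) :
    K ⊆ Metric.closedBall 0 100 := by
  have hω : π / 2 ∈ Ioc 0 (π / 2) := ⟨by positivity, le_rfl⟩
  set h1 := supp K (π / 4)
  set h2 := supp K (π / 4 + π / 2)
  have e1 : ∀ p : Plane, √2 * pr (π / 4) p = p 0 + p 1 := fun p => by
    simp only [pr, cos_pi_div_four, sin_pi_div_four]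
    linear_combination (p 0 + p 1) / 2 * Real.mul_self_sqrt (show (0 : ℝ) ≤ 2 by norm_num)
  have e2 : ∀ p : Plane, √2 * pr (π / 4 + π / 2) p = p 1 - p 0 := fun p => by
    simp only [pr, cos_add_pi_div_two, sin_add_pi_div_two, cos_pi_div_four, sin_pi_div_four]
    linear_combination (p 1 - p 0) / 2 * Real.mul_self_sqrt (show (0 : ℝ) ≤ 2 by norm_num)
  have hsq := Real.mul_self_sqrt (show (0 : ℝ) ≤ 2 by norm_num)
  have hs0 : 0 < √2 := by positivity
  have hs2 : √2 < 3 / 2 := by nlinarith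
  have hs1 : 1 < √2 := by nlinarith
  have hle : ∀ p ∈ K, p 0 + p 1 ≤ √2 * h1 ∧ p 1 - p 0 ≤ √2 * h2 := fun p hp => by
    rw [← e1, ← e2]
    exact ⟨mul_le_mul_of_nonneg_left (le_supp hK.1.isBounded hp _) hs0.le,
      mul_le_mul_of_nonneg_left (le_supp hK.1.isBounded hp _) hs0.le⟩
  have hy : ∀ p ∈ K, 0 ≤ p 1 ∧ p 1 ≤ 1 := fun p hp =>
    (mem_parallelogram.1 (hK.1.subset_parallelogram hp)).1
  have hap := hle _ ha
  rw [apex_one, apex_right_zero] at hap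
  set b := √2 * h1
  set c := √2 * h2
  -- `H` is the height of the inner corner of the hallway at angle `π / 4`. The cap lies in a box of
  -- area `b + c`, whereas for `H > 0` the niche contains a square of side `H / 2` hanging from that
  -- corner, so its area grows quadratically.
  set H : ℝ := (b + c) / 2 - √2 with hH
  have hbc : b + c ≤ 40 := by
    by_contra! hlarge
    have hHpos : 18 < H := by rw [hH]; linarith
    have hKvol : volume K ≤ ENNReal.ofReal (b + c) := by
      have hbox := volume_frame_box 0 (measurableSet_Icc (a := -c) (b := b))
        (measurableSet_Icc (a := (0 : ℝ)) (b := 1))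
      rw [Real.volume_Icc, Real.volume_Icc, sub_zero, ENNReal.ofReal_one, mul_one, zero_add] at hbox
      rw [show b + c = b - -c by ring, ← hbox]
      refine measure_mono fun p hp => ?_
      have := hle p hp
      have := hy p hp
      simp only [mem_ofPred_eq, pr_zero, pr_pi_div_two, mem_Icc]
      refine ⟨⟨?_, ?_⟩, ?_, ?_⟩ <;> linarith
    have hNvol : ENNReal.ofReal (H / 2 * (H / 2)) ≤
        volume (nicheSet (π / 2) Θ (supp K)) := by
      have hbox := volume_frame_box (π / 4) (measurableSet_Ioo (a := h1 - 1 - H / 2) (b := h1 - 1))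
        (measurableSet_Ioo (a := h2 - 1 - H / 2) (b := h2 - 1))
      rw [Real.volume_Ioo, Real.volume_Ioo, ← ENNReal.ofReal_mul (by linarith)] at hbox
      rw [show H / 2 * (H / 2) = (h1 - 1 - (h1 - 1 - H / 2)) * (h2 - 1 - (h2 - 1 - H / 2)) by ring,
        ← hbox]
      refine measure_mono fun p hp => ⟨?_, π / 4, h4, hp.1.2, hp.2.2⟩
      have hp0 : 0 ≤ p 1 := by
        have i1 : √2 * (h1 - 1 - H / 2) ≤ √2 * pr (π / 4) p :=
          mul_le_mul_of_nonneg_left hp.1.1.le hs0.le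
        have i2 : √2 * (h2 - 1 - H / 2) ≤ √2 * pr (π / 4 + π / 2) p :=
          mul_le_mul_of_nonneg_left hp.2.1.le hs0.le
        rw [e1] at i1
        rw [e2] at i2
        have i3 : √2 * (h1 - 1 - H / 2) = b - √2 - √2 * H / 2 := by ring
        have i4 : √2 * (h2 - 1 - H / 2) = c - √2 - √2 * H / 2 := by ring
        nlinarith
      exact mem_fan.2 ⟨by rw [pr_pi_div_two]; exact hp0, hp0⟩
    have hNfin : volume (nicheSet (π / 2) Θ (supp K)) ≠ ⊤ :=
      (isBounded_nicheSet _ hΘf fun t ht => hΘ ht).measure_lt_top.ne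
    have r1 := ENNReal.toReal_mono ENNReal.ofReal_ne_top hKvol
    have r2 := ENNReal.toReal_mono hNfin hNvol
    rw [ENNReal.toReal_ofReal (by linarith)] at r1
    rw [ENNReal.toReal_ofReal (by positivity)] at r2
    rw [hK.polygonArea_eq'] at hA
    nlinarith
  intro p hp
  have i1 := hle p hp
  have i2 := hy p hp
  rw [mem_closedBall_zero_iff, EuclideanSpace.norm_eq, Fin.sum_univ_two, Real.sqrt_le_left (by norm_num)]
  simp only [Real.norm_eq_abs, sq_abs]
  have j1 : -40 ≤ p 0 := by linarith
  have j2 : p 0 ≤ 40 := by linarith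
  nlinarith

/-- Polygon caps of nonnegative area with `ω/2` in the angle set are uniformly bounded. -/
theorem exists_radius {ω : ℝ} (hω : ω ∈ Ioc 0 (π / 2)) : ∃ R : ℝ, ∀ Θ : Set ℝ, Θ.Finite →
    Θ ⊆ Ioo 0 ω → ω / 2 ∈ Θ → ∀ K, IsPolygonCap ω Θ K → apex ω ∈ K → 0 ≤ polygonArea ω Θ K →
    K ⊆ Metric.closedBall 0 R := by
  rcases hω.2.lt_or_eq with h | rfl
  · obtain ⟨R, hR⟩ := parallelogram_subset_closedBall hω.1 h
    exact ⟨R, fun Θ _ _ _ K hK _ _ => hK.1.subset_parallelogram.trans hR⟩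
  · refine ⟨100, fun Θ hΘf hΘ h K hK ha hA => hK.subset_closedBall_of_right hΘf hΘ ?_ ha hA⟩
    rwa [show π / 4 = π / 2 / 2 by ring]

/-- Some polygon cap has nonnegative area. -/
theorem exists_polygonCap_nonneg {ω : ℝ} (hω : ω ∈ Ioc 0 (π / 2)) {Θ : Set ℝ} (hΘ : Θ ⊆ Ioo 0 ω)
    (hne : Θ.Nonempty) :
    ∃ K, IsPolygonCap ω Θ K ∧ apex ω ∈ K ∧ 0 ≤ polygonArea ω Θ K := by
  -- All walls pass through the apex. An inner corner then has height at most `1 - sin t - cos t ≤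
  -- 0`, so the niche is empty.
  have ha : apex ω ∈ capSet ω Θ (fun t => pr t (apex ω)) :=
    ⟨apex_mem_parallelogram hω, fun t _ => ⟨le_rfl, le_rfl⟩⟩
  have hP := isPolygonCap_capSet hω hΘ hne ha
  refine ⟨_, hP, ha, ?_⟩
  rw [hP.polygonArea_eq']
  have hN : nicheSet ω Θ (supp (capSet ω Θ (fun t => pr t (apex ω)))) = ∅ := by
    refine eq_empty_of_forall_notMem ?_
    rintro p ⟨hf, t, ht, h1, h2⟩
    have hs1 : supp (capSet ω Θ (fun t => pr t (apex ω))) t ≤ pr t (apex ω) :=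
      supp_le ⟨_, ha⟩ fun p hp => (hp.2 t ht).1
    have hs2 : supp (capSet ω Θ (fun t => pr t (apex ω))) (t + π / 2) ≤ pr (t + π / 2) (apex ω) :=
      supp_le ⟨_, ha⟩ fun p hp => (hp.2 t ht).2
    have h0 := (hΘ ht).1
    have h3 := (hΘ ht).2.trans_le hω.2
    have hs : 0 < sin t := sin_pos_of_pos_of_lt_pi h0 (by linarith)
    have hc : 0 < cos t := cos_pos_of_mem_Ioo ⟨by linarith, h3⟩
    have i1 := pr_height t p
    have i2 := pr_height t (apex ω)
    rw [apex_one] at i2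
    have i3 := (mem_fan.1 hf).2
    have i4 := sin_sq_add_cos_sq t
    have i5 := sin_le_one t
    have i6 := cos_le_one t
    nlinarith
  rw [hN]
  simp

/-- This removes the subtraction, giving the form in which `HausdorffLimit.add_volume_le` passes to
the limit. -/
theorem volume_add_le_iff_polygonArea {ω : ℝ} {Θ : Set ℝ} {K : Set Plane}
    (hΘ : Θ.Finite) (hΘ2 : ∀ t ∈ Θ, 0 < t ∧ t < π / 2) (hK : IsPolygonCap ω Θ K) {a : ℝ}
    (ha : 0 ≤ a) : a ≤ polygonArea ω Θ K ↔
      ENNReal.ofReal a + volume (nicheSet ω Θ (supp K)) ≤ volume K := by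
  have f1 : volume K ≠ ⊤ := hK.1.isBounded.measure_lt_top.ne
  have f2 : volume (nicheSet ω Θ (supp K)) ≠ ⊤ := (isBounded_nicheSet _ hΘ hΘ2).measure_lt_top.ne
  rw [hK.polygonArea_eq', ← ENNReal.toReal_le_toReal (ENNReal.add_ne_top.2 ⟨by simp, f2⟩) f1,
    ENNReal.toReal_add (by simp) f2, ENNReal.toReal_ofReal ha]
  constructor <;> intro h <;> linarith

theorem exists_maximum_among_apex {ω : ℝ} (hω : ω ∈ Ioc 0 (π / 2)) {Θ : Set ℝ} (hΘf : Θ.Finite)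
    (hΘ : Θ ⊆ Ioo 0 ω) (hmid : ω / 2 ∈ Θ) :
    ∃ K, IsPolygonCap ω Θ K ∧ apex ω ∈ K ∧
      ∀ K', IsPolygonCap ω Θ K' → apex ω ∈ K' → polygonArea ω Θ K' ≤ polygonArea ω Θ K := by
  have hΘ2 : ∀ t ∈ Θ, 0 < t ∧ t < π / 2 := fun t ht => ⟨(hΘ ht).1, (hΘ ht).2.trans_le hω.2⟩
  obtain ⟨R, hR⟩ := exists_radius hω
  set C : Set (Set Plane) := {K | IsPolygonCap ω Θ K ∧ apex ω ∈ K ∧ 0 ≤ polygonArea ω Θ K} with hC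
  obtain ⟨K₀, hK₀⟩ := exists_polygonCap_nonneg hω hΘ ⟨_, hmid⟩
  have hCR : ∀ K ∈ C, K ⊆ Metric.closedBall 0 R := fun K hK =>
    hR Θ hΘf hΘ hmid K hK.1 hK.2.1 hK.2.2
  have hbdd : BddAbove (polygonArea ω Θ '' C) := by
    refine ⟨(volume (Metric.closedBall (0 : Plane) R)).toReal, ?_⟩
    rintro _ ⟨K, hK, rfl⟩
    rw [hK.1.polygonArea_eq']
    have := ENNReal.toReal_mono measure_closedBall_lt_top.ne
      (measure_mono (μ := (volume : Measure Plane)) (hCR K hK))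
    linarith [ENNReal.toReal_nonneg (a := volume (nicheSet ω Θ (supp K)))]
  obtain ⟨as, -, hlim, has⟩ := exists_seq_tendsto_sSup (Set.Nonempty.image _ (⟨K₀, hK₀⟩ : C.Nonempty)) hbdd
  choose Ks hKs hKas using has
  obtain ⟨L, φ, hφ, hL⟩ := exists_hausdorffLimit_subseq (fun i => (hKs i).1.1.isCompact)
    (fun i => (hKs i).1.1.1) (fun i => hCR _ (hKs i))
  have haL : apex ω ∈ L := by
    obtain ⟨q, hq⟩ := hL.nonempty
    exact hL.op_mem (f := fun _ => apex ω) continuous_const (fun i _ _ _ _ => (hKs _).2.1) hq hq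
  have hLP : L ⊆ parallelogram ω := hL.subset_of_isClosed (isClosed_parallelogram ω)
    fun i => (hKs _).1.1.subset_parallelogram
  have hLsub : L ⊆ capSet ω Θ (supp L) := fun p hp => ⟨hLP hp, fun t _ =>
    ⟨le_supp hL.isCompact.isBounded hp t, le_supp hL.isCompact.isBounded hp _⟩⟩
  have hP := isPolygonCap_capSet hω hΘ ⟨_, hmid⟩ (hLsub haL)
  have hsupp : ∀ t ∈ Θ, supp (capSet ω Θ (supp L)) t = supp L t ∧
      supp (capSet ω Θ (supp L)) (t + π / 2) = supp L (t + π / 2) :=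
    fun t ht => supp_capSet ⟨_, haL⟩ hLsub hP.1.isBounded ht
  -- The maximizing sequence eventually exceeds any `a` below the supremum. The case `a = 0` is
  -- separate because all members of `C` have nonnegative area, and it also handles a vanishing
  -- supremum.
  have hge : ∀ a, 0 ≤ a → a < sSup (polygonArea ω Θ '' C) ∨ a = 0 →
      a ≤ polygonArea ω Θ (capSet ω Θ (supp L)) := by
    intro a ha hlt
    rw [volume_add_le_iff_polygonArea hΘf hΘ2 hP ha, nicheSet_congr hsupp]
    refine le_trans (hL.add_volume_le (Ns := fun i => nicheSet ω Θ (supp (Ks (φ i)))) ?_ ?_)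
      (measure_mono hLsub)
    · have hev : ∀ᶠ i in atTop, a ≤ as (φ i) := by
        rcases hlt with h | rfl
        · exact ((hlim.comp hφ.tendsto_atTop).eventually (lt_mem_nhds h)).mono fun i hi => le_of_lt hi
        · exact Eventually.of_forall fun i => by rw [← hKas]; exact (hKs _).2.2
      filter_upwards [hev] with i hi
      rw [← hKas] at hi
      exact (volume_add_le_iff_polygonArea hΘf hΘ2 (hKs _).1 ha).1 hi
    · intro p hp
      exact hL.eventually_mem_nicheSet (Θs := fun _ => Θ)
        (fun t ht => ⟨fun _ => t, tendsto_const_nhds, Eventually.of_forall fun _ => ht⟩) hp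
  have hge' : sSup (polygonArea ω Θ '' C) ≤ polygonArea ω Θ (capSet ω Θ (supp L)) := by
    have h0 := hge 0 le_rfl (Or.inr rfl)
    refine le_of_forall_lt fun a ha => ?_
    obtain ⟨b, hab, hb⟩ := exists_between ha
    rcases le_total 0 b with h | h
    · exact hab.trans_le (hge b h (Or.inl hb))
    · linarith
  refine ⟨_, hP, hLsub haL, fun K' hK' ha' => ?_⟩
  rcases le_total 0 (polygonArea ω Θ K') with h | h
  · exact (le_csSup hbdd ⟨K', ⟨hK', ha', h⟩, rfl⟩).trans hge'
  · exact h.trans (hge 0 le_rfl (Or.inr rfl))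

/-! ### Horizontal translations for the right angle -/

theorem supp_translate {K : Set Plane} (hne : K.Nonempty) (hb : Bornology.IsBounded K) (w : Plane)
    (t : ℝ) : supp ((fun p => p + w) '' K) t = supp K t + pr t w := by
  have hb' : Bornology.IsBounded ((fun p => p + w) '' K) := by
    obtain ⟨R, hR⟩ := hb.exists_norm_le
    refine isBounded_iff_forall_norm_le.2 ⟨R + ‖w‖, ?_⟩
    rintro _ ⟨p, hp, rfl⟩
    exact (norm_add_le _ _).trans (by gcongr; exact hR p hp)
  refine le_antisymm (supp_le (hne.image _) ?_) ?_
  · rintro _ ⟨p, hp, rfl⟩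
    rw [pr_add]; gcongr; exact le_supp hb hp t
  · rw [← le_sub_iff_add_le]
    refine supp_le hne fun p hp => ?_
    have := le_supp hb' ⟨p, hp, rfl⟩ t
    rw [pr_add] at this
    linarith

/-- The horizontal vector of length `d`. -/
def hvec (d : ℝ) : Plane := !₂[d, 0]

theorem add_hvec_one (p : Plane) (d : ℝ) : (p + hvec d) 1 = p 1 := by simp [hvec]

theorem add_hvec_mem_parallelogram {p : Plane} {d : ℝ} :
    p + hvec d ∈ parallelogram (π / 2) ↔ p ∈ parallelogram (π / 2) := by
  rw [mem_parallelogram, mem_parallelogram, pr_pi_div_two, pr_pi_div_two, add_hvec_one]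

theorem add_hvec_mem_fan {p : Plane} {d : ℝ} :
    p + hvec d ∈ fan (π / 2) ↔ p ∈ fan (π / 2) := by
  rw [mem_fan, mem_fan, pr_pi_div_two, pr_pi_div_two, add_hvec_one]

theorem image_add_capSet (Θ : Set ℝ) (g : ℝ → ℝ) (d : ℝ) :
    (fun p => p + hvec d) '' capSet (π / 2) Θ g =
      capSet (π / 2) Θ (fun t => g t + pr t (hvec d)) := by
  rw [image_add_right]
  ext p
  obtain ⟨q, rfl⟩ : ∃ q, p = q + hvec d := ⟨p - hvec d, by simp⟩
  simp only [mem_preimage, add_neg_cancel_right, capSet, mem_ofPred_eq, add_hvec_mem_parallelogram,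
    pr_add, add_le_add_iff_right]

theorem image_add_nicheSet (Θ : Set ℝ) (g : ℝ → ℝ) (d : ℝ) :
    (fun p => p + hvec d) '' nicheSet (π / 2) Θ g =
      nicheSet (π / 2) Θ (fun t => g t + pr t (hvec d)) := by
  rw [image_add_right]
  ext p
  obtain ⟨q, rfl⟩ : ∃ q, p = q + hvec d := ⟨p - hvec d, by simp⟩
  simp only [mem_preimage, add_neg_cancel_right, nicheSet, mem_ofPred_eq, add_hvec_mem_fan,
    pr_add, add_sub_right_comm, add_lt_add_iff_right]

theorem volume_image_add (w : Plane) (X : Set Plane) :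
    volume ((fun p => p + w) '' X) = volume X := by
  rw [image_add_right, measure_preimage_add_right]

/-- Only the right angle needs work: there the strip and the fan are invariant under horizontal
translation, so a topmost point can be moved to the apex without changing the area. -/
theorem IsPolygonCap.exists_apex_mem {ω : ℝ} (hω : ω ∈ Ioc 0 (π / 2)) {Θ : Set ℝ}
    (hΘ : Θ ⊆ Ioo 0 ω) (hne : Θ.Nonempty) {K : Set Plane} (hK : IsPolygonCap ω Θ K) :
    ∃ K', IsPolygonCap ω Θ K' ∧ apex ω ∈ K' ∧ polygonArea ω Θ K' = polygonArea ω Θ K := by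
  rcases hω.2.lt_or_eq with h | rfl
  · exact ⟨K, hK, hK.1.apex_mem hω h, rfl⟩
  · obtain ⟨q, hq, hq1⟩ := exists_pr_eq_supp hK.1.isCompact hK.1.1 (π / 2)
    rw [hK.1.2.2.2.2.1, pr_pi_div_two] at hq1
    set d := -q 0
    set g : ℝ → ℝ := fun t => supp K t + pr t (hvec d)
    have hKe : (fun p => p + hvec d) '' K = capSet (π / 2) Θ g := by
      conv_lhs => rw [hK.eq_capSet]
      exact image_add_capSet _ _ _
    have ha : apex (π / 2) ∈ capSet (π / 2) Θ g := by
      rw [← hKe]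
      refine ⟨q, hq, plane_ext ?_ ?_⟩
      · rw [apex_right_zero]; simp [d, hvec]
      · simp only [add_hvec_one, apex_one, hq1]
    have hP := isPolygonCap_capSet hω hΘ hne ha
    refine ⟨_, hP, ha, ?_⟩
    rw [hP.polygonArea_eq', hK.polygonArea_eq', ← hKe, volume_image_add]
    have hs : supp ((fun p => p + hvec d) '' K) = g := by
      funext t; exact supp_translate hK.1.1 hK.1.isBounded _ _
    rw [hs, ← image_add_nicheSet, volume_image_add]

theorem exists_isMaximumPolygonCap {ω : ℝ} (hω : ω ∈ Ioc 0 (π / 2)) {Θ : Set ℝ} (hΘf : Θ.Finite)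
    (hΘ : Θ ⊆ Ioo 0 ω) (hmid : ω / 2 ∈ Θ) : ∃ K, IsMaximumPolygonCap ω Θ K := by
  obtain ⟨K, hK, ha, hmax⟩ := exists_maximum_among_apex hω hΘf hΘ hmid
  refine ⟨K, hK, ha, fun K' hK' => ?_⟩
  obtain ⟨K'', h1, h2, h3⟩ := hK'.exists_apex_mem hω hΘ ⟨_, hmid⟩
  rw [← h3]
  exact hmax _ h1 h2

/-! ### Uniform angle sets -/

theorem uniformAngleSet_finite (ω : ℝ) (n : ℕ) : (uniformAngleSet ω n).Finite :=
  ((finite_Iio n).image fun i : ℕ => (i : ℝ) / n * ω).subset fun _ ⟨i, _, hi, h⟩ => ⟨i, hi, h.symm⟩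

theorem uniformAngleSet_subset {ω : ℝ} (hω : 0 < ω) (n : ℕ) : uniformAngleSet ω n ⊆ Ioo 0 ω := by
  rintro _ ⟨i, h1, h2, rfl⟩
  have hi : (0 : ℝ) < i := by exact_mod_cast h1
  have hin : (i : ℝ) < n := by exact_mod_cast h2
  have hn : (0 : ℝ) < n := hi.trans hin
  have hq : (i : ℝ) / n < 1 := (div_lt_one hn).2 hin
  exact ⟨by positivity, by nlinarith⟩

theorem half_mem_uniformAngleSet (ω : ℝ) {n : ℕ} (hn : 1 < n) (hk : ∃ k : ℕ, n = 2 ^ k) :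
    ω / 2 ∈ uniformAngleSet ω n := by
  obtain ⟨k, rfl⟩ := hk
  rcases k with _ | k
  · simp at hn
  · refine ⟨2 ^ k, Nat.one_le_two_pow, by rw [pow_succ]; have := Nat.one_le_two_pow (n := k); omega, ?_⟩
    push_cast
    rw [pow_succ]
    field_simp

theorem exists_tendsto_uniformAngleSet {ω : ℝ} (hω : 0 < ω) {n : ℕ → ℕ}
    (hn : Tendsto n atTop atTop) {t : ℝ} (ht : t ∈ Ioo 0 ω) :
    ∃ τ : ℕ → ℝ, Tendsto τ atTop (𝓝 t) ∧ ∀ᶠ i in atTop, τ i ∈ uniformAngleSet ω (n i) := by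
  have hn' : Tendsto (fun i => (n i : ℝ)) atTop atTop := tendsto_natCast_atTop_atTop.comp hn
  have ha : 0 < t / ω := div_pos ht.1 hω
  have ha1 : t / ω < 1 := (div_lt_one hω).2 ht.2
  refine ⟨fun i => (⌊t / ω * n i⌋₊ : ℝ) / n i * ω, ?_, ?_⟩
  · have h := (((tendsto_nat_floor_mul_div_atTop ha.le).comp hn').mul_const ω)
    rw [div_mul_cancel₀ _ hω.ne'] at h
    exact h
  -- From `n i ≥ ω / t` on, the floor is at least `1`, so the approximating angle is not `0`.
  · filter_upwards [hn'.eventually_ge_atTop (1 / (t / ω))] with i hi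
    rw [div_le_iff₀' ha] at hi
    refine ⟨_, Nat.le_floor (by simpa using hi), ?_, rfl⟩
    rw [Nat.floor_lt (by positivity)]
    have : (0 : ℝ) < n i := by
      by_contra! h
      nlinarith
    nlinarith

/-! ### Closedness of the space of caps -/

theorem exists_polar (a b : ℝ) : ∃ r t : ℝ, 0 ≤ r ∧ t ∈ Ico 0 (2 * π) ∧ a = r * cos t ∧
    b = r * sin t := by
  have h1 := Complex.norm_mul_cos_arg ⟨a, b⟩
  have h2 := Complex.norm_mul_sin_arg ⟨a, b⟩
  set z : ℂ := ⟨a, b⟩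
  have h3 := Complex.neg_pi_lt_arg z
  have h4 := Complex.arg_le_pi z
  rcases lt_or_ge z.arg 0 with h | h
  · exact ⟨‖z‖, z.arg + 2 * π, norm_nonneg _, ⟨by linarith, by linarith⟩, by rw [cos_add_two_pi, h1],
      by rw [sin_add_two_pi, h2]⟩
  · exact ⟨‖z‖, z.arg, norm_nonneg _, ⟨h, by linarith [pi_pos]⟩, h1.symm, h2.symm⟩

theorem exists_pr_lt_of_notMem {K : Set Plane} (hc : IsClosed K) (hv : Convex ℝ K) {p : Plane} (hp : p ∉ K) :
    ∃ t ∈ Ico 0 (2 * π), ∀ q ∈ K, pr t q < pr t p := by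
  obtain ⟨f, c, h1, h2⟩ := geometric_hahn_banach_closed_point hv hc hp
  obtain ⟨r, t, hr, ht, ha, hb⟩ := exists_polar (f (!₂[1, 0] : Plane)) (f (!₂[0, 1] : Plane))
  have hf : ∀ q, f q = r * pr t q := fun q => by
    have hq : q = q 0 • (!₂[1, 0] : Plane) + q 1 • (!₂[0, 1] : Plane) :=
      plane_ext (by simp) (by simp)
    conv_lhs => rw [hq]
    rw [map_add, map_smul, map_smul, ha, hb, pr]
    simp only [smul_eq_mul]; ring
  refine ⟨t, ht, fun q hq => ?_⟩
  have h3 := (h1 q hq).trans h2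
  rw [hf, hf] at h3
  exact lt_of_mul_lt_mul_left h3 hr

/-- The lower boundary point of a cap to the right of the origin below `q`. -/
def footR (q : Plane) : Plane := !₂[max (q 0) 0, 0]

/-- The mirror image of `footR`. -/
def footL (ω : ℝ) (q : Plane) : Plane := refl ω (footR (refl ω q))

theorem continuous_footR : Continuous footR := by unfold footR; fun_prop

theorem continuous_footL (ω : ℝ) : Continuous (footL ω) :=
  (refl ω).continuous.comp (continuous_footR.comp (refl ω).continuous)

theorem pr_footL (ω t : ℝ) (q : Plane) :
    pr t (footL ω q) = max (pr (ω + π / 2) q) 0 * sin (t - ω) := by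
  have h : refl ω q 0 = pr (ω + π / 2) q := by rw [← pr_zero, pr_refl, sub_zero]
  rw [footL, pr_refl, pr]
  simp only [footR, h]
  simp only [Matrix.cons_val_zero, Matrix.cons_val_one]
  rw [show ω + π / 2 - t = π / 2 - (t - ω) by ring, cos_pi_div_two_sub]
  ring

theorem preimage_sub_Icc (ω : ℝ) : (fun t => ω - t) ⁻¹' Icc 0 ω = Icc 0 ω := by
  rw [preimage_const_sub_Icc]; simp

theorem footL_mem_capSet {ω : ℝ} (hω : ω ∈ Ioc 0 (π / 2)) {g : ℝ → ℝ}
    (ha : apex ω ∈ capSet ω (Icc 0 ω) g) {q : Plane} (hq : q ∈ capSet ω (Icc 0 ω) g) :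
    footL ω q ∈ capSet ω (Icc 0 ω) g := by
  rw [footL, refl_mem_capSet, preimage_sub_Icc]
  refine foot_mem_capSet hω subset_rfl ?_ ?_
  · have := refl_mem_capSet.1 ((refl_apex hω).symm ▸ ha)
    rwa [preimage_sub_Icc] at this
  · have h : refl ω (refl ω q) ∈ capSet ω (Icc 0 ω) g := by rwa [refl_refl]
    rw [refl_mem_capSet, preimage_sub_Icc] at h
    exact h

/-- Being an intersection of half-planes with restricted normals is replaced by containing certain
points and being closed under continuous maps, conditions that pass to Hausdorff limits. A point of
the circumscribed `capSet` outside `K` would be separated by some normal `u t`, and every arc of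
angles is excluded. -/
theorem isCap_of_feet {ω : ℝ} (hω : ω ∈ Ioc 0 (π / 2)) {K : Set Plane} (hc : IsCompact K)
    (hv : Convex ℝ K) (hP : K ⊆ parallelogram ω) (ha : apex ω ∈ K) (h0 : (0 : Plane) ∈ K)
    (hR : ∀ q ∈ K, footR q ∈ K) (hL : ∀ q ∈ K, footL ω q ∈ K) : IsCap ω K := by
  have hω1 := hω.1
  have hω2 := hω.2
  have hsub : K ⊆ capSet ω (Icc 0 ω) (supp K) := fun p hp =>
    ⟨hP hp, fun t _ => ⟨le_supp hc.isBounded hp t, le_supp hc.isBounded hp _⟩⟩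
  have hK : K = capSet ω (Icc 0 ω) (supp K) := by
    refine hsub.antisymm fun p hp => ?_
    by_contra hpK
    obtain ⟨t, ⟨ht0, ht1⟩, hlt⟩ := exists_pr_lt_of_notMem hc.isClosed hv hpK
    obtain ⟨⟨p1, p2⟩, p3, p4⟩ := mem_parallelogram.1 hp.1
    have hsupp : ¬ pr t p ≤ supp K t := fun h => by
      obtain ⟨q, hq, hqt⟩ := exists_pr_eq_supp hc ⟨_, ha⟩ t
      linarith [hlt q hq]
    have c1 : ω < t := by
      by_contra! h
      exact hsupp (hp.2 t ⟨ht0, h⟩).1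
    -- Between `ω` and `π / 2` the apex is extremal in the whole parallelogram.
    rcases lt_or_ge t (π / 2) with h | c2
    · have e0 := hlt _ ha
      have e1 := pr_comb ω (π / 2) t (apex ω)
      have e2 := pr_comb ω (π / 2) t p
      rw [pr_pi_div_two, apex_one, pr_apex_self hω] at e1
      rw [pr_pi_div_two] at e2
      have s1 : 0 < sin (π / 2 - ω) := sin_pos_of_pos_of_lt_pi (by linarith) (by linarith)
      have s2 : 0 < sin (π / 2 - t) := sin_pos_of_pos_of_lt_pi (by linarith) (by linarith)
      have s3 : 0 < sin (t - ω) := sin_pos_of_pos_of_lt_pi (by linarith) (by linarith)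
      nlinarith
    have c3 : ω + π / 2 < t := by
      by_contra! h
      have := (hp.2 (t - π / 2) ⟨by linarith, by linarith⟩).2
      rw [sub_add_cancel] at this
      exact hsupp this
    -- Here the left foot of a point extremal in direction `u (ω + π / 2)` is at least as far out as
    -- `p`.
    rcases lt_or_ge t (ω + π) with h | c4
    · obtain ⟨q, hq, hqs⟩ := exists_pr_eq_supp hc ⟨_, ha⟩ (ω + π / 2)
      have e0 := hlt _ (hL q hq)
      have e1 := pr_comb_quarter ω t p
      have e2 := (hp.2 ω ⟨hω1.le, le_rfl⟩).2
      rw [pr_footL, hqs] at e0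
      have s1 : cos (t - ω) ≤ 0 := cos_nonpos_of_pi_div_two_le_of_le (by linarith) (by linarith)
      have s2 : 0 < sin (t - ω) := sin_pos_of_pos_of_lt_pi (by linarith) (by linarith)
      have e3 := le_max_left (supp K (ω + π / 2)) 0
      nlinarith
    -- Between the two lower normals the origin is extremal; beyond them, the right foot of a
    -- rightmost point is.
    rcases le_or_gt t (3 * π / 2) with h | c5
    · have e0 := hlt _ h0
      rw [pr_zero_right] at e0
      rcases h.eq_or_lt with h | h
      · rw [h, pr_three_pi_div_two] at e0; linarith
      · have e2 := pr_comb (ω + π) (3 * π / 2) t p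
        rw [pr_three_pi_div_two, pr_add_pi] at e2
        have s1 : 0 < sin (3 * π / 2 - (ω + π)) :=
          sin_pos_of_pos_of_lt_pi (by linarith) (by linarith)
        have s2 : 0 < sin (3 * π / 2 - t) := sin_pos_of_pos_of_lt_pi (by linarith) (by linarith)
        have s3 : 0 ≤ sin (t - (ω + π)) :=
          sin_nonneg_of_nonneg_of_le_pi (by linarith) (by linarith)
        nlinarith
    · obtain ⟨q, hq, hqs⟩ := exists_pr_eq_supp hc ⟨_, ha⟩ 0
      have e0 := hlt _ (hR q hq)
      have e2 := (hp.2 0 ⟨le_rfl, hω1.le⟩).1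
      rw [← hqs, pr_zero, pr_zero] at e2
      have e3 := le_max_left (q 0) 0
      have s1 : 0 ≤ cos t := by
        rw [← cos_sub_two_pi]
        exact cos_nonneg_of_mem_Icc ⟨by linarith, by linarith⟩
      have s2 : sin t ≤ 0 := by
        rw [← sin_sub_two_pi]
        exact sin_nonpos_of_nonpos_of_neg_pi_le (by linarith) (by linarith)
      simp only [pr, footR, Matrix.cons_val_zero, Matrix.cons_val_one] at e0
      nlinarith
  rw [hK]
  exact isCap_capSet hω subset_rfl (hsub ha) (by rw [← hK]; exact hc.isBounded)

theorem HausdorffLimit.isCap {ω : ℝ} (hω : ω ∈ Ioc 0 (π / 2)) {Ks : ℕ → Set Plane} {K : Set Plane}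
    (h : HausdorffLimit Ks K) (hcap : ∀ i, IsCap ω (Ks i)) (ha : ∀ i, apex ω ∈ Ks i) :
    IsCap ω K ∧ apex ω ∈ K := by
  obtain ⟨q₀, hq₀⟩ := h.nonempty
  have haK : apex ω ∈ K := h.op_mem (f := fun _ => apex ω) continuous_const
    (fun i _ _ _ _ => ha i) hq₀ hq₀
  have heq : ∀ i, Ks i = capSet ω (Icc 0 ω) (supp (Ks i)) := fun i => (hcap i).eq_capSet hω
  have ha' : ∀ i, apex ω ∈ capSet ω (Icc 0 ω) (supp (Ks i)) := fun i => heq i ▸ ha i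
  refine ⟨isCap_of_feet hω h.isCompact ?_ ?_ haK ?_ ?_ ?_, haK⟩
  · intro x hx y hy a b ha hb hab
    exact h.op_mem (f := fun r => a • r.1 + b • r.2) (by fun_prop)
      (fun i p hp q hq => (hcap i).2.2.1 hp hq ha hb hab) hx hy
  · exact h.subset_of_isClosed (isClosed_parallelogram ω) fun i => (hcap i).subset_parallelogram
  · refine h.op_mem (f := fun _ => 0) continuous_const (fun i _ _ _ _ => ?_) haK haK
    rw [heq i]; exact zero_mem_capSet hω subset_rfl (ha' i)
  · refine fun q hq => h.op_mem (f := fun r => footR r.1) (continuous_footR.comp continuous_fst)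
      (fun i p hp _ _ => ?_) hq hq
    rw [heq i] at hp ⊢; exact foot_mem_capSet hω subset_rfl (ha' i) hp
  · refine fun q hq => h.op_mem (f := fun r => footL ω r.1)
      ((continuous_footL ω).comp continuous_fst) (fun i p hp _ _ => ?_) hq hq
    rw [heq i] at hp ⊢; exact footL_mem_capSet hω (ha' i) hp

/-! ### Balanced maximum caps -/

theorem exists_isBalancedMaximumCap {ω : ℝ} (hω : ω ∈ Ioc 0 (π / 2)) :
    ∃ K, IsBalancedMaximumCap ω K := by
  have hn : ∀ k : ℕ, 1 < 2 ^ (k + 1) := fun k => Nat.one_lt_two_pow (by omega)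
  have hmid : ∀ k, ω / 2 ∈ uniformAngleSet ω (2 ^ (k + 1)) := fun k =>
    half_mem_uniformAngleSet ω (hn k) ⟨_, rfl⟩
  have hsub : ∀ k, uniformAngleSet ω (2 ^ (k + 1)) ⊆ Ioo 0 ω := fun k =>
    uniformAngleSet_subset hω.1 _
  choose Ks hKs using fun k =>
    exists_isMaximumPolygonCap hω (uniformAngleSet_finite ω (2 ^ (k + 1))) (hsub k) (hmid k)
  obtain ⟨R, hR⟩ := exists_radius hω
  have hball : ∀ k, Ks k ⊆ Metric.closedBall 0 R := fun k => by
    obtain ⟨K', h1, -, h2⟩ := exists_polygonCap_nonneg hω (hsub k) ⟨_, hmid k⟩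
    exact hR _ (uniformAngleSet_finite _ _) (hsub k) (hmid k) _ (hKs k).1 (hKs k).2.1
      (h2.trans ((hKs k).2.2 K' h1))
  obtain ⟨L, φ, hφ, hL⟩ := exists_hausdorffLimit_subseq (fun k => (hKs k).1.1.isCompact)
    (fun k => (hKs k).1.1.1) hball
  refine ⟨L, (hL.isCap hω (fun i => (hKs _).1.1) fun i => (hKs _).2.1).1,
    fun i => 2 ^ (φ i + 1), Ks ∘ φ, fun i j hij => ?_, fun i => ⟨hn _, _, rfl⟩, fun i => hKs _,
    hL.tendsto⟩
  exact Nat.pow_lt_pow_right (by norm_num) (by have := hφ hij; omega)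

/-- A point of the limit niche eventually lies in the polygon niches, hence in the polygon caps, and
is therefore a limit of points of `K`. -/
theorem IsBalancedMaximumCap.niche_subset {ω : ℝ} (hω : ω ∈ Ioc 0 (π / 2)) {K : Set Plane}
    (hK : IsBalancedMaximumCap ω K) : niche ω K ⊆ K := by
  obtain ⟨hcap, n, Ks, hn, -, hmax, hlim⟩ := hK
  have h : HausdorffLimit Ks K := ⟨fun i => (hmax i).1.1.isCompact, fun i => (hmax i).1.1.1,
    hcap.isCompact, hcap.1, hlim⟩
  rw [niche_eq]
  intro p hp
  rw [← hcap.isCompact.isClosed.closure_eq, Metric.mem_closure_iff]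
  intro ε hε
  obtain ⟨i, hi, hi', -⟩ := ((h.eventually_mem_nicheSet
    (fun t ht => exists_tendsto_uniformAngleSet hω.1 hn.tendsto_atTop ht) hp).and
    (h.eventually_near hε)).exists
  exact hi' p ((hmax i).nicheSet_subset hω (uniformAngleSet_finite _ _)
    (uniformAngleSet_subset hω.1 _) hi)

theorem measurableSet_niche (ω : ℝ) (K : Set Plane) : MeasurableSet (niche ω K) := by
  rw [niche_eq]; exact measurableSet_nicheSet _ _ _

/-- Balanced maximum caps maximize the area of `K \ niche ω K`. -/
theorem IsBalancedMaximumCap.volume_le {ω : ℝ} (hω : ω ∈ Ioc 0 (π / 2)) {K : Set Plane}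
    (hK : IsBalancedMaximumCap ω K) {K' : Set Plane} (hcap' : IsCap ω K') (ha' : apex ω ∈ K')
    (hN' : niche ω K' ⊆ K') :
    volume (K' \ niche ω K') + volume (niche ω K) ≤ volume K := by
  obtain ⟨hcap, n, Ks, hn, hn2, hmax, hlim⟩ := hK
  have h : HausdorffLimit Ks K := ⟨fun i => (hmax i).1.1.isCompact, fun i => (hmax i).1.1.1,
    hcap.isCompact, hcap.1, hlim⟩
  have hfin : volume K' ≠ ⊤ := hcap'.isBounded.measure_lt_top.ne
  have hfinN : volume (niche ω K') ≠ ⊤ := measure_ne_top_of_subset hN' hfin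
  have hdiff := measure_sdiff hN' (measurableSet_niche ω K').nullMeasurableSet hfinN
  have hfinD : volume (K' \ niche ω K') ≠ ⊤ := measure_ne_top_of_subset sdiff_subset hfin
  have hreal : (volume (K' \ niche ω K')).toReal =
      (volume K').toReal - (volume (niche ω K')).toReal := by
    rw [hdiff, ENNReal.toReal_sub_of_le (measure_mono hN') hfin]
  refine h.add_volume_le (Ns := fun i => nicheSet ω (uniformAngleSet ω (n i)) (supp (Ks i)))
    (Eventually.of_forall fun i => ?_) fun p hp => ?_
  · set Θ := uniformAngleSet ω (n i)
    have hΘf : Θ.Finite := uniformAngleSet_finite _ _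
    have hΘ : Θ ⊆ Ioo 0 ω := uniformAngleSet_subset hω.1 _
    have hne : Θ.Nonempty := ⟨_, half_mem_uniformAngleSet ω (hn2 i).1 (hn2 i).2⟩
    have hΘ2 : ∀ t ∈ Θ, 0 < t ∧ t < π / 2 := fun t ht => ⟨(hΘ ht).1, (hΘ ht).2.trans_le hω.2⟩
    rw [← ENNReal.ofReal_toReal hfinD, ← volume_add_le_iff_polygonArea hΘf hΘ2 (hmax i).1
      ENNReal.toReal_nonneg, hreal]
    have hsub := hcap'.subset_capSet Θ
    have hP := isPolygonCap_capSet hω hΘ hne (hsub ha')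
    -- The competitor is the polygon cap circumscribing `K'`: it contains `K'`, and its polygon
    -- niche lies in the niche of `K'`, so its polygon area is at least that of `K' \ niche ω K'`.
    refine le_trans ?_ ((hmax i).2.2 _ hP)
    rw [polygonArea_capSet hcap'.1 hsub hP.1.isBounded, polygonArea_eq]
    have h1 := ENNReal.toReal_mono hP.1.isBounded.measure_lt_top.ne
      (measure_mono (μ := (volume : Measure Plane)) hsub)
    have h2 : nicheSet ω Θ (supp K') ⊆ niche ω K' := by
      rw [niche_eq]; exact nicheSet_mono hΘ fun _ _ => ⟨le_rfl, le_rfl⟩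
    have h3 := ENNReal.toReal_mono hfinN (measure_mono h2)
    linarith
  · rw [niche_eq] at hp
    exact h.eventually_mem_nicheSet
      (fun t ht => exists_tendsto_uniformAngleSet hω.1 hn.tendsto_atTop ht) hp

/-! ### Moving sofas in standard position -/

/-- Standard position makes the inner quadrants at the end angles `0` and `ω` miss the
parallelogram, so the open range of angles in the niche suffices. -/
theorem monotonization_eq {ω : ℝ} {S : Set Plane} (hS : InStandardPosition ω S) :
    monotonization ω S =
      capSet ω (Icc 0 ω) (supp S) \ nicheSet ω (Ioo 0 ω) (supp S) := by
  ext p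
  simp only [monotonization, mem_inter_iff, mem_iInter, mem_supportHallway]
  constructor
  · rintro ⟨hP, h⟩
    refine ⟨⟨hP, fun t ht => ⟨(h t ht).1, (h t ht).2.1⟩⟩, ?_⟩
    rintro ⟨-, t, ht, h1, h2⟩
    rcases (h t ⟨ht.1.le, ht.2.le⟩).2.2 with h3 | h3 <;> linarith
  · rintro ⟨hC, hN⟩
    refine ⟨hC.1, fun t ht => ⟨(hC.2 t ht).1, (hC.2 t ht).2, ?_⟩⟩
    have hP := mem_parallelogram.1 hC.1
    rcases ht.1.eq_or_lt with rfl | h0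
    · right; rw [zero_add, hS.2, pr_pi_div_two]; linarith [hP.1.1]
    rcases ht.2.eq_or_lt with rfl | h1
    · left; rw [hS.1]; linarith [hP.2.1]
    by_contra! hcon
    exact hN ⟨parallelogram_subset_fan ω hC.1, t, ⟨h0, h1⟩, hcon.1, hcon.2⟩

theorem rot_neg_zero (t : ℝ) (p : Plane) : rot (-t) p 0 = pr t p := by
  simp [rot, pr]; ring

theorem rot_neg_one (t : ℝ) (p : Plane) : rot (-t) p 1 = pr (t + π / 2) p := by
  simp [rot, pr, cos_add_pi_div_two, sin_add_pi_div_two]; ring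

theorem IsMovingSofa.isCompact {ω : ℝ} (hω : ω ∈ Ioc 0 (π / 2)) {S : Set Plane}
    (hS : IsMovingSofa ω S) : IsCompact S := by
  obtain ⟨-, hcl, θ, c, -, -, h0, h1, hH, -, hV⟩ := hS
  refine Metric.isCompact_of_isClosed_isBounded hcl ?_
  have hs : 0 < sin ω := sin_pos_of_pos_of_lt_pi hω.1 (by linarith [hω.2, pi_pos])
  set B := 1 + |c 0 1|
  set A := (1 + |c 1 1| + B) / sin ω
  refine isBounded_of_abs_le (a := max (1 + |c 0 0|) A) (b := B) fun p hp => ?_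
  have e1 := hH p hp
  have e2 := hV p hp
  simp only [hallH, hallV, mem_ofPred_eq, PiLp.add_apply, rot_neg_zero, rot_neg_one, h0, h1,
    zero_add, pr_zero, pr_pi_div_two] at e1 e2
  have a0 := abs_le.1 (le_refl |c 0 0|)
  have a1 := abs_le.1 (le_refl |c 0 1|)
  have a2 := abs_le.1 (le_refl |c 1 1|)
  have hy : |p 1| ≤ B := abs_le.2 ⟨by linarith, by linarith⟩
  refine ⟨abs_le.2 ⟨?_, ?_⟩, hy⟩
  · have h : -p 0 ≤ A := by
      rw [le_div_iff₀ hs]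
      have h2 := e2.2.2
      simp only [pr, cos_add_pi_div_two, sin_add_pi_div_two] at h2
      have h3 := abs_le.1 hy
      have h4 := cos_le_one ω
      have h5 : 0 ≤ cos ω := cos_nonneg_of_mem_Icc ⟨by linarith [hω.1, pi_pos], hω.2⟩
      nlinarith
    linarith [le_max_right (1 + |c 0 0|) A]
  · linarith [le_max_left (1 + |c 0 0|) A]

/-- Every angle in `[0, ω]` occurs during the motion by the intermediate value theorem. Pushing the
outer walls in until they support `S` moves the inner walls away from `S`. -/
theorem IsMovingSofa.subset_monotonization {ω : ℝ} (hω : ω ∈ Ioc 0 (π / 2)) {S : Set Plane}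
    (hS : IsMovingSofa ω S) (hst : InStandardPosition ω S) : S ⊆ monotonization ω S := by
  have hb := (hS.isCompact hω).isBounded
  obtain ⟨hconn, -, θ, c, hθ, -, h0, h1, hH, hL, hV⟩ := hS
  have hne := hconn.nonempty
  intro p hp
  refine ⟨mem_parallelogram.2 ?_, mem_iInter₂.2 fun t ht => mem_supportHallway.2
    ⟨le_supp hb hp t, le_supp hb hp _, ?_⟩⟩
  · have e1 := fun q hq => (hH q hq).2
    have e2 := fun q hq => hV q hq
    simp only [hallV, mem_ofPred_eq, PiLp.add_apply, rot_neg_zero, rot_neg_one, h0, h1,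
      zero_add, pr_pi_div_two] at e1 e2
    have s1 : supp S (π / 2) ≤ 1 - c 0 1 := supp_le hne fun q hq => by
      rw [pr_pi_div_two]; linarith [(e1 q hq).2]
    have s2 : supp S ω ≤ 1 - c 1 0 := supp_le hne fun q hq => by linarith [(e2 q hq).2.1]
    have s3 := le_supp hb hp (π / 2)
    have s4 := le_supp hb hp ω
    rw [hst.2] at s1 s3
    rw [hst.1] at s2 s4
    rw [pr_pi_div_two] at s3
    exact ⟨⟨by linarith [(e1 p hp).1], s3⟩, by linarith [(e2 p hp).1], s4⟩
  · obtain ⟨r, hr, hrt⟩ := intermediate_value_Icc zero_le_one hθ (by rw [h0, h1]; exact ht)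
    have e := fun q hq => mem_hallway.1 (hL r hr q hq)
    simp only [PiLp.add_apply, rot_neg_zero, rot_neg_one, hrt] at e
    have s1 : supp S t ≤ 1 - c r 0 := supp_le hne fun q hq => by linarith [(e q hq).1]
    have s2 : supp S (t + π / 2) ≤ 1 - c r 1 := supp_le hne fun q hq => by linarith [(e q hq).2.1]
    rcases (e p hp).2.2 with h | h
    · left; linarith
    · right; linarith

theorem IsMovingSofa.translate {ω : ℝ} {S : Set Plane} (hS : IsMovingSofa ω S) (w : Plane) :
    IsMovingSofa ω ((fun p => p + w) '' S) := by
  obtain ⟨hconn, hcl, θ, c, hθ, hc, h0, h1, hH, hL, hV⟩ := hS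
  have hadd : ∀ s p, rot (-θ s) (p + w) + (c s - rot (-θ s) w) = rot (-θ s) p + c s := by
    intro s p
    refine plane_ext ?_ ?_ <;> simp [rot_neg_zero, rot_neg_one]
  refine ⟨hconn.image _ (by fun_prop), (Homeomorph.addRight w).isClosedMap _ hcl, θ,
    fun s => c s - rot (-θ s) w, hθ, hc.sub ?_, h0, h1, ?_, ?_, ?_⟩
  · have : Continuous fun t => rot (-t) w := by unfold rot; fun_prop
    exact this.comp_continuousOn hθ
  · rintro _ ⟨p, hp, rfl⟩; rw [hadd]; exact hH p hp
  · rintro s hs _ ⟨p, hp, rfl⟩; rw [hadd]; exact hL s hs p hp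
  · rintro _ ⟨p, hp, rfl⟩; rw [hadd]; exact hV p hp

section Standard

variable {ω : ℝ} {S : Set Plane}

theorem IsMovingSofa.subset_capOf (hω : ω ∈ Ioc 0 (π / 2)) (hS : IsMovingSofa ω S)
    (hst : InStandardPosition ω S) : S ⊆ capSet ω (Icc 0 ω) (supp S) := fun _ hp =>
  (monotonization_eq hst ▸ hS.subset_monotonization hω hst hp).1

theorem isBounded_capSet_Icc (hω : ω ∈ Ioc 0 (π / 2)) (g : ℝ → ℝ) :
    Bornology.IsBounded (capSet ω (Icc 0 ω) g) :=
  isBounded_capSet g (t := ω / 2) ⟨by linarith [hω.1], by linarith [hω.1]⟩ (by linarith [hω.1])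
    (by linarith [hω.1, hω.2])

theorem IsMovingSofa.exists_translate (hω : ω ∈ Ioc 0 (π / 2)) (hS : IsMovingSofa ω S) :
    ∃ w : Plane, InStandardPosition ω ((fun p => p + w) '' S) ∧
      apex ω ∈ capOf ω ((fun p => p + w) '' S) := by
  have hc := hS.isCompact hω
  have hne := hS.1.nonempty
  have hsupp := fun w t => supp_translate hne hc.isBounded w t
  rcases hω.2.lt_or_eq with h | rfl
  · have hcos : 0 < cos ω := cos_pos_of_mem_Ioo ⟨by linarith [hω.1], h⟩
    set b := 1 - supp S (π / 2)
    set w : Plane := !₂[(1 - supp S ω - b * sin ω) / cos ω, b] with hw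
    have hst : InStandardPosition ω ((fun p => p + w) '' S) := by
      constructor
      · rw [hsupp, pr, hw]
        simp only [Matrix.cons_val_zero, Matrix.cons_val_one]
        rw [div_mul_cancel₀ _ hcos.ne']; ring
      · rw [hsupp, pr_pi_div_two, hw]
        simp only [Matrix.cons_val_one]
        simp [b]
    refine ⟨w, hst, ?_⟩
    have hS' := hS.translate w
    have hc' := hS'.isCompact hω
    obtain ⟨p, hp, hp1⟩ := exists_pr_eq_supp hc' hS'.1.nonempty (π / 2)
    obtain ⟨q, hq, hq1⟩ := exists_pr_eq_supp hc' hS'.1.nonempty ω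
    rw [hst.2, pr_pi_div_two] at hp1
    rw [hst.1] at hq1
    rw [capOf_eq]
    exact ⟨apex_mem_parallelogram hω, fun t ht => apex_pr_le_of_support hω h hc'.isBounded
      (fun r hr => (hS'.subset_capOf hω hst hr).1) hp hp1 hq hq1 ht⟩
  · obtain ⟨q, hq, hq1⟩ := exists_pr_eq_supp hc hne (π / 2)
    have hst : InStandardPosition (π / 2) ((fun p => p + (apex (π / 2) - q)) '' S) := by
      rw [InStandardPosition, and_self, hsupp, pr_sub, hq1, pr_pi_div_two, apex_one]; ring
    refine ⟨_, hst, ?_⟩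
    rw [capOf_eq]
    exact (hS.translate _).subset_capOf hω hst ⟨q, hq, by simp⟩

theorem IsMovingSofa.supp_capOf (hω : ω ∈ Ioc 0 (π / 2)) (hS : IsMovingSofa ω S)
    (hst : InStandardPosition ω S) {t : ℝ} (ht : t ∈ Icc 0 ω) :
    supp (capOf ω S) t = supp S t ∧ supp (capOf ω S) (t + π / 2) = supp S (t + π / 2) := by
  rw [capOf_eq]
  exact supp_capSet hS.1.nonempty (hS.subset_capOf hω hst) (isBounded_capSet_Icc hω _) ht

theorem IsMovingSofa.niche_capOf (hω : ω ∈ Ioc 0 (π / 2)) (hS : IsMovingSofa ω S)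
    (hst : InStandardPosition ω S) : niche ω (capOf ω S) = nicheSet ω (Ioo 0 ω) (supp S) := by
  rw [niche_eq]
  exact nicheSet_congr fun t ht => hS.supp_capOf hω hst (Ioo_subset_Icc_self ht)

theorem IsMovingSofa.monotonization_eq_diff (hω : ω ∈ Ioc 0 (π / 2)) (hS : IsMovingSofa ω S)
    (hst : InStandardPosition ω S) :
    monotonization ω S = capOf ω S \ niche ω (capOf ω S) := by
  rw [monotonization_eq hst, hS.niche_capOf hω hst, capOf_eq]

/-- The niche of the cap of a moving sofa is contained in the cap. -/
theorem IsMovingSofa.niche_subset (hω : ω ∈ Ioc 0 (π / 2)) (hS : IsMovingSofa ω S)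
    (hst : InStandardPosition ω S) : niche ω (capOf ω S) ⊆ capOf ω S := by
  rw [hS.niche_capOf hω hst, capOf_eq]
  have hω1 := hω.1
  have hω2 := hω.2
  have hc := hS.isCompact hω
  have hne := hS.1.nonempty
  have hmono := hS.subset_monotonization hω hst
  rintro z ⟨hzF, t, ⟨ht0, htω⟩, hz1, hz2⟩
  obtain ⟨hzF1, hzF2⟩ := mem_fan.1 hzF
  -- The two arms of the supporting hallway cover `S`, and each contains a contact point with an
  -- outer wall. Connectedness gives a point of `S` in both arms, hence beyond `z` in both
  -- coordinates.
  obtain ⟨p, hpS, hp1, hp2⟩ : ∃ p ∈ S, pr t z < pr t p ∧ pr (t + π / 2) z < pr (t + π / 2) p := by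
    obtain ⟨A, hA, hAt⟩ := exists_pr_eq_supp hc hne t
    obtain ⟨B, hB, hBt⟩ := exists_pr_eq_supp hc hne (t + π / 2)
    obtain ⟨p, hp, h1, h2⟩ := isPreconnected_closed_iff.1 hS.1.isPreconnected
      {p | supp S t - 1 ≤ pr t p} {p | supp S (t + π / 2) - 1 ≤ pr (t + π / 2) p}
      (isClosed_le continuous_const (continuous_pr _))
      (isClosed_le continuous_const (continuous_pr _))
      (fun q hq => (mem_supportHallway.1 (mem_iInter₂.1 (hmono hq).2 t ⟨ht0.le, htω.le⟩)).2.2)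
      ⟨A, hA, by simp only [mem_ofPred_eq]; linarith⟩
      ⟨B, hB, by simp only [mem_ofPred_eq]; linarith⟩
    exact ⟨p, hp, hz1.trans_le h1, hz2.trans_le h2⟩
  have right : ∀ s ∈ Icc 0 ω, pr s z ≤ supp S s := by
    intro s ⟨hs0, hsω⟩
    -- For `s > t`, `u s` is a nonnegative combination of `u t` and `v t`, so `p` dominates `z`.
    -- Otherwise a contact point `A` of wall `t` works: it exceeds `z` by more than `1` in direction
    -- `u t` but by at most `1` vertically.
    rcases lt_or_ge t s with h | h
    · refine le_trans ?_ (le_supp hc.isBounded hpS s)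
      have e := pr_comb_quarter t s (p - z)
      simp only [pr_sub] at e
      have s1 : 0 ≤ cos (s - t) := cos_nonneg_of_mem_Icc ⟨by linarith, by linarith⟩
      have s2 : 0 ≤ sin (s - t) := sin_nonneg_of_nonneg_of_le_pi (by linarith) (by linarith)
      nlinarith
    · obtain ⟨A, hA, hAt⟩ := exists_pr_eq_supp hc hne t
      refine le_trans ?_ (le_supp hc.isBounded hA s)
      have hA1 := (mem_parallelogram.1 (hmono hA).1).1.2
      rcases h.eq_or_lt with rfl | h
      · linarith
      have e := pr_comb s (π / 2) t (A - z)
      simp only [pr_sub, pr_pi_div_two, sin_pi_div_two_sub] at e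
      have s1 : 0 < cos t := cos_pos_of_mem_Ioo ⟨by linarith, by linarith⟩
      have s2 : 0 ≤ sin (t - s) := sin_nonneg_of_nonneg_of_le_pi (by linarith) (by linarith)
      have s3 : sin (t - s) ≤ cos s := by
        rw [← sin_pi_div_two_sub]
        exact sin_le_sin_of_le_of_le_pi_div_two (by linarith) (by linarith) (by linarith)
      have s4 : 0 < cos s := cos_pos_of_mem_Ioo ⟨by linarith, by linarith⟩
      by_contra! hlt
      nlinarith
  have left : ∀ s ∈ Icc 0 ω, pr (s + π / 2) z ≤ supp S (s + π / 2) := by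
    intro s ⟨hs0, hsω⟩
    rcases lt_or_ge s t with h | h
    · refine le_trans ?_ (le_supp hc.isBounded hpS _)
      have e := pr_comb_quarter t (s + π / 2) (p - z)
      simp only [pr_sub] at e
      have s1 : 0 ≤ cos (s + π / 2 - t) := cos_nonneg_of_mem_Icc ⟨by linarith, by linarith⟩
      have s2 : 0 ≤ sin (s + π / 2 - t) :=
        sin_nonneg_of_nonneg_of_le_pi (by linarith) (by linarith)
      nlinarith
    · obtain ⟨B, hB, hBt⟩ := exists_pr_eq_supp hc hne (t + π / 2)
      refine le_trans ?_ (le_supp hc.isBounded hB _)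
      have hB1 := (mem_parallelogram.1 (hmono hB).1).2.2
      rcases h.eq_or_lt with rfl | h
      · linarith
      have e := pr_comb ω (s + π / 2) (t + π / 2) (B - z)
      simp only [pr_sub] at e
      rw [show s + π / 2 - ω = π / 2 - (ω - s) by ring,
        show s + π / 2 - (t + π / 2) = s - t by ring,
        show t + π / 2 - ω = π / 2 - (ω - t) by ring,
        sin_pi_div_two_sub, sin_pi_div_two_sub] at e
      have s1 : 0 < cos (ω - t) := cos_pos_of_mem_Ioo ⟨by linarith, by linarith⟩
      have s2 : 0 ≤ sin (s - t) := sin_nonneg_of_nonneg_of_le_pi (by linarith) (by linarith)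
      have s3 : sin (s - t) ≤ cos (ω - s) := by
        rw [← sin_pi_div_two_sub]
        exact sin_le_sin_of_le_of_le_pi_div_two (by linarith) (by linarith) (by linarith)
      have s4 : 0 < cos (ω - s) := cos_pos_of_mem_Ioo ⟨by linarith, by linarith⟩
      by_contra! hlt
      nlinarith
  refine ⟨mem_parallelogram.2 ⟨⟨hzF2, ?_⟩, hzF1, ?_⟩, fun s hs => ⟨right s hs, left s hs⟩⟩
  · have := left 0 ⟨le_rfl, hω1.le⟩
    rwa [zero_add, hst.2, pr_pi_div_two] at this
  · have := right ω ⟨hω1.le, le_rfl⟩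
    rwa [hst.1] at this

end Standard

/-! ### Sofas from caps that contain their niches -/

theorem exists_add_smul_mem_nicheSet {ω : ℝ} {T : Set ℝ} {g : ℝ → ℝ} {p d : Plane}
    (hp : p ∈ nicheSet ω T g) (h0 : 0 ≤ pr ω d) (h1 : 0 ≤ d 1) :
    ∃ δ : ℝ, 0 < δ ∧ p + δ • d ∈ nicheSet ω T g := by
  obtain ⟨hf, t, ht, hp1, hp2⟩ := hp
  have hev : ∀ s b, pr s p < b → ∀ᶠ δ in 𝓝[>] (0 : ℝ), pr s (p + δ • d) < b := by
    intro s b hb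
    have h : Tendsto (fun δ : ℝ => pr s (p + δ • d)) (𝓝[>] 0) (𝓝 (pr s (p + (0 : ℝ) • d))) :=
      (((continuous_pr s).comp (by fun_prop)).tendsto 0).mono_left nhdsWithin_le_nhds
    rw [zero_smul, add_zero] at h
    exact h.eventually (gt_mem_nhds hb)
  have hpos : ∀ᶠ δ in 𝓝[>] (0 : ℝ), 0 < δ := self_mem_nhdsWithin
  obtain ⟨δ, ⟨hδ, e1⟩, e2⟩ := ((hpos.and (hev _ _ hp1)).and (hev _ _ hp2)).exists
  obtain ⟨f1, f2⟩ := mem_fan.1 hf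
  refine ⟨δ, hδ, mem_fan.2 ⟨?_, ?_⟩, t, ht, e1, e2⟩
  · rw [pr_add, pr_smul]; positivity
  · simp only [PiLp.add_apply, PiLp.smul_apply, smul_eq_mul]; positivity

section Cap

variable {ω : ℝ} {K : Set Plane}

/-- A support point of `K` in the niche could be moved slightly along `u s` within the niche, hence
within `K`, contradicting extremality. So removing the niche keeps every such support point. -/
theorem IsCap.supp_diff_niche (hω : ω ∈ Ioc 0 (π / 2)) (hK : IsCap ω K) (hN : niche ω K ⊆ K)
    {s : ℝ} (hs : s ∈ Icc 0 (ω + π / 2)) : supp (K \ niche ω K) s = supp K s := by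
  obtain ⟨q, hq, hqs⟩ := exists_pr_eq_supp hK.isCompact hK.1 s
  have h1 := hω.1
  have h2 := hω.2
  have hqN : q ∉ niche ω K := by
    intro hqN
    rw [niche_eq] at hqN
    obtain ⟨δ, hδ, hmem⟩ := exists_add_smul_mem_nicheSet (d := u s) hqN
      (by rw [pr_u]; exact cos_nonneg_of_mem_Icc ⟨by linarith [hs.2], by linarith [hs.1]⟩)
      (by rw [← pr_pi_div_two, pr_u]
          exact cos_nonneg_of_mem_Icc ⟨by linarith [hs.2], by linarith [hs.1]⟩)
    rw [← niche_eq] at hmem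
    have := le_supp hK.isBounded (hN hmem) s
    rw [pr_add, pr_smul, pr_u, sub_self, cos_zero] at this
    linarith
  exact supp_eq_of_mem (S := K \ niche ω K) ⟨hq, hqN⟩ hqs fun p hp => le_supp hK.isBounded hp.1 s

/-- A cap lies in its fan, so the closed fan condition may be dropped and only an open set is
removed. -/
theorem IsCap.isClosed_diff_niche (hK : IsCap ω K) :
    IsClosed (K \ niche ω K) := by
  have h : K \ niche ω K = K \ ⋃ t ∈ Ioo 0 ω,
      {p | pr t p < supp K t - 1} ∩ {p | pr (t + π / 2) p < supp K (t + π / 2) - 1} := by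
    rw [niche_eq, nicheSet_eq_inter]
    ext p
    have hf : p ∈ K → p ∈ fan ω := fun hp => parallelogram_subset_fan ω (hK.subset_parallelogram hp)
    simp only [Set.mem_sdiff, mem_inter_iff]
    tauto
  rw [h]
  exact hK.isCompact.isClosed.sdiff (isOpen_biUnion fun t _ =>
    (isOpen_lt (continuous_pr _) continuous_const).inter
      (isOpen_lt (continuous_pr _) continuous_const))

/-- Project to the horizontal axis. The top of each vertical fibre of `K` avoids the niche, so the
image is still an interval. Within `K` the niche is closed downwards along verticals, so the fibres
of the difference are segments. Two closed sets covering the difference and both meeting it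
therefore share a fibre, and then a point. -/
theorem IsCap.isConnected_diff_niche (hω : ω ∈ Ioc 0 (π / 2)) (hK : IsCap ω K)
    (hN : niche ω K ⊆ K) : IsConnected (K \ niche ω K) := by
  have hω1 := hω.1
  have hω2 := hω.2
  have hcosω : 0 ≤ cos ω := cos_nonneg_of_mem_Icc ⟨by linarith, hω2⟩
  have hsinω : 0 ≤ sin ω := sin_nonneg_of_nonneg_of_le_pi (by linarith) (by linarith)
  set S := K \ niche ω K with hSdef
  have hScl : IsClosed S := hK.isClosed_diff_niche
  have hSc : IsCompact S := hK.isCompact.of_isClosed_subset hScl fun _ h => h.1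
  have htop : ∀ q ∈ K, ∃ m ∈ S, m 0 = q 0 := by
    intro q hq
    have hcl : IsClosed {p : Plane | p 0 = q 0} := isClosed_eq (by fun_prop) continuous_const
    obtain ⟨m, hm, hmax⟩ := (hK.isCompact.inter_right hcl).exists_isMaxOn ⟨q, hq, rfl⟩
      (f := fun p : Plane => p 1) (by fun_prop)
    refine ⟨m, ⟨hm.1, fun hmN => ?_⟩, hm.2⟩
    rw [niche_eq] at hmN
    obtain ⟨δ, hδ, hmem⟩ := exists_add_smul_mem_nicheSet (d := !₂[0, 1]) hmN
      (by simpa [pr] using hsinω) (by simp)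
    rw [← niche_eq] at hmem
    have h0 : m 0 = q 0 := hm.2
    have h1 : (m + δ • (!₂[0, 1] : Plane)) 1 ≤ m 1 :=
      hmax ⟨hN hmem, by simpa using h0⟩
    simp at h1
    linarith
  have hseg : ∀ a ∈ S, ∀ b ∈ S, a 0 = b 0 → a 1 ≤ b 1 → segment ℝ a b ⊆ S := by
    intro a ha b hb h0 h1 p hp
    refine ⟨hK.2.2.1.segment_subset ha.1 hb.1 hp, fun hpN => ha.2 ?_⟩
    obtain ⟨c, d, hc, hd, hcd, rfl⟩ := hp
    rw [niche_eq] at hpN ⊢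
    obtain ⟨-, t, ht, e1, e2⟩ := hpN
    have hs : 0 ≤ sin t :=
      sin_nonneg_of_nonneg_of_le_pi ht.1.le (by linarith [ht.2])
    have hcos : 0 ≤ cos t := cos_nonneg_of_mem_Icc ⟨by linarith [ht.1], by linarith [ht.2]⟩
    have hle1 : pr t a ≤ pr t b := by simp only [pr, h0]; nlinarith
    have hle2 : pr (t + π / 2) a ≤ pr (t + π / 2) b := by
      simp only [pr, h0, cos_add_pi_div_two, sin_add_pi_div_two]; nlinarith
    rw [pr_add, pr_smul, pr_smul] at e1 e2
    obtain rfl : c = 1 - d := by linarith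
    exact ⟨parallelogram_subset_fan ω (hK.subset_parallelogram ha.1), t, ht, by nlinarith,
      by nlinarith⟩
  obtain ⟨q, hq⟩ := hK.1
  obtain ⟨m, hm, -⟩ := htop q hq
  refine ⟨⟨m, hm⟩, isPreconnected_closed_iff.2 fun A B hA hB hAB hSA hSB => ?_⟩
  have hf : Continuous fun p : Plane => p 0 := by fun_prop
  have hcA : IsClosed ((fun p : Plane => p 0) '' (S ∩ A)) := ((hSc.inter_right hA).image hf).isClosed
  have hcB : IsClosed ((fun p : Plane => p 0) '' (S ∩ B)) := ((hSc.inter_right hB).image hf).isClosed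
  have hpre : IsPreconnected ((fun p : Plane => p 0) '' K) :=
    hK.2.2.1.isPreconnected.image _ hf.continuousOn
  obtain ⟨x, -, ⟨a, ha, hax⟩, b, hb, hbx⟩ := isPreconnected_closed_iff.1 hpre _ _ hcA hcB
    (by
      rintro _ ⟨p, hp, rfl⟩
      obtain ⟨m, hm, h0⟩ := htop p hp
      rcases hAB hm with h | h
      · exact Or.inl ⟨m, ⟨hm, h⟩, h0⟩
      · exact Or.inr ⟨m, ⟨hm, h⟩, h0⟩)
    (by obtain ⟨p, hp, hpA⟩ := hSA; exact ⟨_, ⟨p, hp.1, rfl⟩, p, ⟨hp, hpA⟩, rfl⟩)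
    (by obtain ⟨p, hp, hpB⟩ := hSB; exact ⟨_, ⟨p, hp.1, rfl⟩, p, ⟨hp, hpB⟩, rfl⟩)
  have h0 : a 0 = b 0 := hax.trans hbx.symm
  have hsub : segment ℝ a b ⊆ S := by
    rcases le_total (a 1) (b 1) with h | h
    · exact hseg a ha.1 b hb.1 h0 h
    · rw [segment_symm]; exact hseg b hb.1 a ha.1 h0.symm h
  obtain ⟨y, hy, hyA, hyB⟩ := isPreconnected_closed_iff.1 (convex_segment a b).isPreconnected A B hA hB
    (hsub.trans hAB) ⟨a, left_mem_segment ℝ a b, ha.2⟩ ⟨b, right_mem_segment ℝ a b, hb.2⟩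
  exact ⟨y, hsub hy, hyA, hyB⟩

theorem IsCap.inStandardPosition_diff_niche (hω : ω ∈ Ioc 0 (π / 2)) (hK : IsCap ω K)
    (hN : niche ω K ⊆ K) : InStandardPosition ω (K \ niche ω K) := by
  have h1 := hω.1
  have h2 := hω.2
  rw [InStandardPosition, hK.supp_diff_niche hω hN ⟨by linarith, by linarith⟩,
    hK.supp_diff_niche hω hN ⟨by linarith, by linarith⟩]
  exact ⟨hK.2.2.2.1, hK.2.2.2.2.1⟩

theorem IsCap.supp_diff_niche' (hω : ω ∈ Ioc 0 (π / 2)) (hK : IsCap ω K) (hN : niche ω K ⊆ K)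
    {t : ℝ} (ht : t ∈ Icc 0 ω) : supp (K \ niche ω K) t = supp K t ∧
      supp (K \ niche ω K) (t + π / 2) = supp K (t + π / 2) := by
  have h1 := ht.1
  have h2 := ht.2
  have h3 := pi_pos
  exact ⟨hK.supp_diff_niche hω hN ⟨h1, by linarith⟩,
    hK.supp_diff_niche hω hN ⟨by linarith, by linarith⟩⟩

theorem IsCap.capOf_diff_niche (hω : ω ∈ Ioc 0 (π / 2)) (hK : IsCap ω K) (hN : niche ω K ⊆ K) :
    capOf ω (K \ niche ω K) = K := by
  have h : ∀ t ∈ Icc 0 ω, _ := fun t ht => hK.supp_diff_niche' hω hN ht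
  rw [capOf_eq, capSet_congr h]
  exact (hK.eq_capSet hω).symm

theorem IsCap.monotonization_diff_niche (hω : ω ∈ Ioc 0 (π / 2)) (hK : IsCap ω K)
    (hN : niche ω K ⊆ K) : monotonization ω (K \ niche ω K) = K \ niche ω K := by
  have h : ∀ t ∈ Ioo 0 ω, _ := fun t ht => hK.supp_diff_niche' hω hN (Ioo_subset_Icc_self ht)
  rw [monotonization_eq (hK.inStandardPosition_diff_niche hω hN), ← capOf_eq,
    hK.capOf_diff_niche hω hN, nicheSet_congr h, ← niche_eq]

/-- The set equals its own monotonization, so it lies in all its supporting hallways. Rotating at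
constant speed and keeping both outer walls in contact is a movement, continuous because the support
function is. -/
theorem IsCap.isMovingSofa_diff_niche (hω : ω ∈ Ioc 0 (π / 2)) (hK : IsCap ω K)
    (hN : niche ω K ⊆ K) : IsMovingSofa ω (K \ niche ω K) := by
  have hmem : ∀ p ∈ K \ niche ω K, p ∈ parallelogram ω ∧ ∀ t ∈ Icc 0 ω,
      p ∈ supportHallway (K \ niche ω K) t := fun p hp => by
    rw [← hK.monotonization_diff_niche hω hN] at hp
    exact ⟨hp.1, mem_iInter₂.1 hp.2⟩
  have hrw : ∀ p ∈ K \ niche ω K, ∀ t ∈ Icc 0 ω, pr t p ≤ supp K t ∧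
      pr (t + π / 2) p ≤ supp K (t + π / 2) ∧
      (supp K t - 1 ≤ pr t p ∨ supp K (t + π / 2) - 1 ≤ pr (t + π / 2) p) := fun p hp t ht => by
    have h := mem_supportHallway.1 ((hmem p hp).2 t ht)
    rwa [(hK.supp_diff_niche' hω hN ht).1, (hK.supp_diff_niche' hω hN ht).2] at h
  have hω1 := hω.1
  have hsc := continuous_supp hK.isCompact
  refine ⟨hK.isConnected_diff_niche hω hN, hK.isClosed_diff_niche, fun s => s * ω,
    fun s => !₂[1 - supp K (s * ω), 1 - supp K (s * ω + π / 2)], by fun_prop, ?_, by simp, by simp,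
    fun p hp => ?_, fun s hs p hp => ?_, fun p hp => ?_⟩
  · have : Continuous fun s : ℝ =>
        (!₂[1 - supp K (s * ω), 1 - supp K (s * ω + π / 2)] : Plane) := by fun_prop
    exact this.continuousOn
  · have h1 := hrw p hp 0 ⟨le_rfl, hω1.le⟩
    have h2 := mem_parallelogram.1 (hmem p hp).1
    have h3 := hK.2.2.2.2.1
    simp only [hallH, mem_ofPred_eq, PiLp.add_apply, rot_neg_zero, rot_neg_one]
    simp only [zero_mul, zero_add, pr_pi_div_two, Matrix.cons_val_zero, Matrix.cons_val_one, h3]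
    exact ⟨by linarith [h1.1], by linarith [h2.1.1], by linarith [h2.1.2]⟩
  · have ht : s * ω ∈ Icc 0 ω := ⟨by have := hs.1; positivity, by nlinarith [hs.2]⟩
    have h1 := hrw p hp _ ht
    rw [mem_hallway]
    simp only [PiLp.add_apply, rot_neg_zero, rot_neg_one, Matrix.cons_val_zero, Matrix.cons_val_one]
    refine ⟨by linarith [h1.1], by linarith [h1.2.1], ?_⟩
    rcases h1.2.2 with h | h
    · left; linarith
    · right; linarith
  · have h1 := hrw p hp ω ⟨hω1.le, le_rfl⟩
    have h2 := mem_parallelogram.1 (hmem p hp).1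
    have h3 := hK.2.2.2.1
    simp only [hallV, mem_ofPred_eq, PiLp.add_apply, rot_neg_zero, rot_neg_one]
    simp only [one_mul, Matrix.cons_val_zero, Matrix.cons_val_one, h3]
    exact ⟨by linarith [h2.2.1], by linarith [h2.2.2], by linarith [h1.2.1]⟩

end Cap

/-! ### Optimality -/

theorem IsBalancedMaximumCap.isBalancedMaximumSofa {ω : ℝ} (hω : ω ∈ Ioc 0 (π / 2)) {K : Set Plane}
    (hK : IsBalancedMaximumCap ω K) : IsBalancedMaximumSofa ω (K \ niche ω K) := by
  have hN := hK.niche_subset hω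
  refine ⟨⟨_, hK.1.isMovingSofa_diff_niche hω hN, hK.1.inStandardPosition_diff_niche hω hN,
    (hK.1.monotonization_diff_niche hω hN).symm⟩, ?_⟩
  rwa [hK.1.capOf_diff_niche hω hN]

/-- Monotonization lies between `S'` and its cap, so it keeps the support values at all wall angles
and has the same cap as `S'`. -/
theorem IsMonotoneSofa.eq_diff_niche {ω : ℝ} (hω : ω ∈ Ioc 0 (π / 2)) {S : Set Plane}
    (hS : IsMonotoneSofa ω S) : S = capOf ω S \ niche ω (capOf ω S) := by
  obtain ⟨S', hS', hst, rfl⟩ := hS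
  have hsub := hS'.subset_monotonization hω hst
  have hcap : monotonization ω S' ⊆ capSet ω (Icc 0 ω) (supp S') := by
    rw [monotonization_eq hst]; exact fun _ h => h.1
  have hb : Bornology.IsBounded (monotonization ω S') :=
    (isBounded_capSet_Icc hω _).subset hcap
  have hsupp : ∀ t ∈ Icc 0 ω, supp (monotonization ω S') t = supp S' t ∧
      supp (monotonization ω S') (t + π / 2) = supp S' (t + π / 2) := fun t ht =>
    ⟨(supp_le (hS'.1.nonempty.mono hsub) fun p hp => ((hcap hp).2 t ht).1).antisymm
        (supp_mono hS'.1.nonempty hb hsub t),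
      (supp_le (hS'.1.nonempty.mono hsub) fun p hp => ((hcap hp).2 t ht).2).antisymm
        (supp_mono hS'.1.nonempty hb hsub _)⟩
  have h : capOf ω (monotonization ω S') = capOf ω S' := by
    rw [capOf_eq, capOf_eq, capSet_congr hsupp]
  rw [h]
  exact hS'.monotonization_eq_diff hω hst

/-- A translate of the sofa lies in its cap minus the niche of that cap. This cap contains the apex
and its niche, so it is a competitor for `IsBalancedMaximumCap.volume_le`. -/
theorem IsBalancedMaximumCap.volume_le_of_isMovingSofa {ω : ℝ} (hω : ω ∈ Ioc 0 (π / 2))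
    {K : Set Plane} (hK : IsBalancedMaximumCap ω K) {S : Set Plane} (hS : IsMovingSofa ω S) :
    volume S ≤ volume (K \ niche ω K) := by
  obtain ⟨w, hst, ha⟩ := hS.exists_translate hω
  have hS' := hS.translate w
  set S' := (fun p => p + w) '' S
  have hcap : IsCap ω (capOf ω S') := by
    rw [capOf_eq] at ha ⊢
    exact isCap_capSet hω subset_rfl ha (isBounded_capSet_Icc hω _)
  have hle := hK.volume_le hω hcap ha (hS'.niche_subset hω hst)
  have hN := hK.niche_subset hω
  have hfinN : volume (niche ω K) ≠ ⊤ :=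
    measure_ne_top_of_subset hN hK.1.isBounded.measure_lt_top.ne
  rw [measure_sdiff hN (measurableSet_niche ω K).nullMeasurableSet hfinN]
  refine ENNReal.le_sub_of_add_le_right hfinN (le_trans ?_ hle)
  refine add_le_add_left ?_ _
  rw [← volume_image_add w S, ← hS'.monotonization_eq_diff hω hst]
  exact measure_mono (hS'.subset_monotonization hω hst)

end MovingSofa

end

theorem mainTheorem7 (ω : ℝ) (hω : ω ∈ Set.Ioc 0 (Real.pi / 2)) :
    (∃ K : Set MovingSofa.Plane, MovingSofa.IsBalancedMaximumCap ω K) ∧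
    (∀ K : Set MovingSofa.Plane, MovingSofa.IsBalancedMaximumCap ω K →
      MovingSofa.IsBalancedMaximumSofa ω (K \ MovingSofa.niche ω K) ∧
      MovingSofa.capOf ω (K \ MovingSofa.niche ω K) = K) ∧
    (∀ S : Set MovingSofa.Plane, MovingSofa.IsBalancedMaximumSofa ω S →
      S = MovingSofa.capOf ω S \ MovingSofa.niche ω (MovingSofa.capOf ω S) ∧
      MovingSofa.IsMovingSofa ω S ∧
      ∀ S' : Set MovingSofa.Plane, MovingSofa.IsMovingSofa ω S' →
        MovingSofa.area S' ≤ MovingSofa.area S) := by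
  refine ⟨MovingSofa.exists_isBalancedMaximumCap hω, fun K hK =>
    ⟨hK.isBalancedMaximumSofa hω, hK.1.capOf_diff_niche hω (hK.niche_subset hω)⟩, fun S hS => ?_⟩
  have hSe := hS.1.eq_diff_niche hω
  refine ⟨hSe, ?_, fun S' hS' => ?_⟩
  · rw [hSe]
    exact hS.2.1.isMovingSofa_diff_niche hω (hS.2.niche_subset hω)
  · rw [hSe]
    exact hS.2.volume_le_of_isMovingSofa hω hS'
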